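/- Let $H=L^2(0,1)$ with its inner product $\langle\cdot,\cdot\rangle$, let $K=\{z\in H: z\ge 0\text{ a.e.}\}$, $j:H\to K$, $j(z)=|z|$, and $e_k(x)=\sqrt2\sin(k\pi x)$, $k\ge1$. Let $\beta$ be a Brownian bridge from $0$ to $0$ on $[0,1]$ (a continuous centred Gaussian process with covariance $s\wedge t-st$), let $\mu$ be the law of $\beta$ on $H$, and let $\nu$, the law on $K$ of the reflected Brownian bridge $|\beta|$, be the image of $\mu$ under $j$. Let $\mathcal{FC}_b^\infty(H)$ be the set of functions $F(z)=\psi(\langle l_1,z\rangle,\dots,\langle l_m,z\rangle)$ on $H$ with $m\in\mathbb N$, $\psi\in C^\infty(\mathbb R^m)$ bounded together with all its derivatives, and $l_1,\dots,l_m\in\mathrm{Span}\{e_k:k\ge1\}$. Let $\mathcal{FC}_b^\infty(K)=\{F|_K: F\in\mathcal{FC}_b^\infty(H)\}$, and for $f=F|_K$ put $\nabla f=\nabla F$ on $K$ (this does not depend on the choice of $F$). Define $$\mathcal E(f,g)=\tfrac12\int_K\langle\nabla f,\nabla g\rangle\,d\nu,\qquad f,g\in\mathcal{FC}_b^\infty(K).$$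 Let $(\Lambda,D(\Lambda))$ be the Gaussian Dirichlet form on $L^2(H,\mu)$, that is, $D(\Lambda)=W^{1,2}(\mu)$ and $\Lambda(F,G)=\frac12\int_H\langle\nabla F,\nabla G\rangle\,d\mu$; it is the closure in $L^2(\mu)$ of this expression on $\mathcal{FC}_b^\infty(H)$. **Proposition.** The form $(\mathcal E,\mathcal{FC}_b^\infty(K))$ is closable in $L^2(K,\nu)$. Its closure $(\mathcal E,D(\mathcal E))$ is a local, quasi-regular (symmetric) Dirichlet form on $L^2(K,\nu)$; here local means that $\mathcal E(u,v)=0$ for all $u,v\in D(\mathcal E)$ with disjoint supports. In addition, for every $f\in D(\mathcal E)$ we have $f\circ j\in D(\Lambda)$, and $$\mathcal E(f,g)=\Lambda(f\circ j,g\circ j)\qquad\text{for all } f,g\in D(\mathcal E).$$ -/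

import Mathlib

open MeasureTheory ProbabilityTheory Filter Topology Set
open scoped ContDiff unitInterval RealInnerProductSpace

/-! ### Symmetric forms on `L²(E, m)`: closability, closure, Dirichlet forms, quasi-regularity -/

namespace DirichletForms

/-- A nonnegative definite symmetric bilinear form with domain a linear subspace of a real
Hilbert space `X`. -/
structure SymmForm (X : Type*) [NormedAddCommGroup X] [InnerProductSpace ℝ X] where
  /-- the domain of the form -/
  dom : Submodule ℝ X
  /-- the form itself -/
  form : dom →ₗ[ℝ] dom →ₗ[ℝ] ℝ
  symm : ∀ u v, form u v = form v u
  nonneg : ∀ u, 0 ≤ form u u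

/-- The squared norm `𝓔₁(u, u) = 𝓔(u, u) + ‖u‖²` on the domain. -/
def SymmForm.energyOne {X : Type*} [NormedAddCommGroup X] [InnerProductSpace ℝ X]
    (Q : SymmForm X) (u : Q.dom) : ℝ :=
  Q.form u u + ‖(u : X)‖ ^ 2

/-- The form is densely defined, and its domain is complete for the norm `𝓔₁ ^ (1/2)`. -/
structure SymmForm.IsClosedForm {X : Type*} [NormedAddCommGroup X] [InnerProductSpace ℝ X]
    (Q : SymmForm X) : Prop where
  dense : Dense (Q.dom : Set X)
  complete : ∀ u : ℕ → Q.dom,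
    Tendsto (fun p : ℕ × ℕ => Q.energyOne (u p.1 - u p.2)) atTop (𝓝 0) →
      ∃ v : Q.dom, Tendsto (fun n => Q.energyOne (u n - v)) atTop (𝓝 0)

section PreForm

variable {E : Type*} [MeasurableSpace E]

/-- Cauchy sequences for the seminorm `a(u, u) ^ (1/2)`. -/
def FormCauchy (a : (E → ℝ) → (E → ℝ) → ℝ) (v : ℕ → E → ℝ) : Prop :=
  Tendsto (fun p : ℕ × ℕ => a (v p.1 - v p.2) (v p.1 - v p.2)) atTop (𝓝 0)

/-- Closability in `L²(m)` of the form `a` defined on the set `V` of (square integrable) functions: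
if `v n ∈ V` is Cauchy for `a` and tends to `0` in `L²(m)`, then `a (v n) (v n) → 0`.
(In particular `a u u = 0` if `u ∈ V` vanishes `m`-almost everywhere, so that the form is well
defined on classes.) -/
def Closable (m : Measure E) (V : Set (E → ℝ)) (a : (E → ℝ) → (E → ℝ) → ℝ) : Prop :=
  ∀ v : ℕ → E → ℝ, (∀ n, v n ∈ V) → FormCauchy a v →
    Tendsto (fun n => eLpNorm (v n) 2 m) atTop (𝓝 0) →
      Tendsto (fun n => a (v n) (v n)) atTop (𝓝 0)

/-- `v` is a sequence in `V`, Cauchy for `a`, and tending to `u` in `L²(m)`. -/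
structure Approximates (m : Measure E) (V : Set (E → ℝ)) (a : (E → ℝ) → (E → ℝ) → ℝ)
    (v : ℕ → E → ℝ) (u : Lp ℝ 2 m) : Prop where
  mem : ∀ n, v n ∈ V
  cauchy : FormCauchy a v
  tendsto : Tendsto (fun n => eLpNorm (v n - ⇑u) 2 m) atTop (𝓝 0)

/-- `Q` is the closure in `L²(m)` of the form `(a, V)`. The domain consists of the `L²`-limits of
the `a`-Cauchy sequences of `V`, and `Q(u, w)` is the limit of `a (v n) (v' n)` along any such
sequences converging to `u`, `w`. These two conditions determine `Q`. -/
structure IsClosureOf (m : Measure E) (Q : SymmForm (Lp ℝ 2 m)) (V : Set (E → ℝ))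
    (a : (E → ℝ) → (E → ℝ) → ℝ) : Prop where
  mem_dom_iff : ∀ u : Lp ℝ 2 m, u ∈ Q.dom ↔ ∃ v, Approximates m V a v u
  tendsto_form : ∀ (u w : Q.dom) (v v' : ℕ → E → ℝ),
    Approximates m V a v (u : Lp ℝ 2 m) → Approximates m V a v' (w : Lp ℝ 2 m) →
      Tendsto (fun n => a (v n) (v' n)) atTop (𝓝 (Q.form u w))

/-- A (symmetric) Dirichlet form on `L²(m)`: a closed form on which the unit contraction
`u ↦ u⁺ ∧ 1` operates. -/
structure IsDirichletForm {m : Measure E} (Q : SymmForm (Lp ℝ 2 m)) : Prop where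
  closed : Q.IsClosedForm
  markov : ∀ (u : Q.dom) (v : Lp ℝ 2 m),
    (∀ᵐ x ∂m, v x = min (max ((u : Lp ℝ 2 m) x) 0) 1) →
      ∃ hv : v ∈ Q.dom, Q.form ⟨v, hv⟩ ⟨v, hv⟩ ≤ Q.form u u

variable [TopologicalSpace E]

/-- The support of the measure `|u| · m`: the points having no neighbourhood on which `u = 0`
almost everywhere. -/
def essSupport {m : Measure E} (u : Lp ℝ 2 m) : Set E :=
  {x | ∀ U : Set E, IsOpen U → x ∈ U → ¬ ∀ᵐ y ∂m, y ∈ U → u y = 0}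

/-- The local property: `𝓔(u, v) = 0` whenever `u`, `v` have disjoint supports. -/
def IsLocalForm {m : Measure E} (Q : SymmForm (Lp ℝ 2 m)) : Prop :=
  ∀ u v : Q.dom, Disjoint (essSupport (u : Lp ℝ 2 m)) (essSupport (v : Lp ℝ 2 m)) → Q.form u v = 0

/-- An `𝓔`-nest: an increasing sequence of closed sets `F k` such that the elements of the domain
vanishing almost everywhere off some `F k` are `𝓔₁`-dense in the domain. -/
structure IsNest {m : Measure E} (Q : SymmForm (Lp ℝ 2 m)) (F : ℕ → Set E) : Prop where
  closed : ∀ k, IsClosed (F k)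
  mono : Monotone F
  dense : ∀ (u : Q.dom) (ε : ℝ), 0 < ε → ∃ w : Q.dom,
    (∃ k, ∀ᵐ x ∂m, x ∉ F k → (w : Lp ℝ 2 m) x = 0) ∧ Q.energyOne (u - w) < ε

/-- `𝓔`-exceptional sets. -/
def IsExceptional {m : Measure E} (Q : SymmForm (Lp ℝ 2 m)) (N : Set E) : Prop :=
  ∃ F : ℕ → Set E, IsNest Q F ∧ N ⊆ ⋂ k, (F k)ᶜ

/-- `𝓔`-quasi-continuous functions: continuous on each member of some nest. -/
def QuasiContinuous {m : Measure E} (Q : SymmForm (Lp ℝ 2 m)) (f : E → ℝ) : Prop :=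
  ∃ F : ℕ → Set E, IsNest Q F ∧ ∀ k, ContinuousOn f (F k)

/-- Quasi-regularity of a form on `L²(E, m)`. -/
structure IsQuasiRegular {m : Measure E} (Q : SymmForm (Lp ℝ 2 m)) : Prop where
  /-- there is a nest of compact sets -/
  compact_nest : ∃ F : ℕ → Set E, IsNest Q F ∧ ∀ k, IsCompact (F k)
  /-- an `𝓔₁`-dense set of elements of the domain have quasi-continuous versions -/
  dense_quasiContinuous : ∀ (u : Q.dom) (ε : ℝ), 0 < ε → ∃ w : Q.dom,
    (∃ f : E → ℝ, QuasiContinuous Q f ∧ f =ᵐ[m] ⇑(w : Lp ℝ 2 m)) ∧ Q.energyOne (u - w) < ε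
  /-- countably many elements of the domain have quasi-continuous versions which separate the
  points off an exceptional set -/
  separating : ∃ (u : ℕ → Q.dom) (f : ℕ → E → ℝ) (N : Set E),
    (∀ n, QuasiContinuous Q (f n) ∧ f n =ᵐ[m] ⇑(u n : Lp ℝ 2 m)) ∧ IsExceptional Q N ∧
      ∀ x ∉ N, ∀ y ∉ N, x ≠ y → ∃ n, f n x ≠ f n y

end PreForm

end DirichletForms

/-! ### The cone of nonnegative functions, cylindrical functions, and the Brownian bridge -/

namespace BridgeForm

/-- `H = L²(0, 1)`. -/
abbrev H : Type := Lp ℝ 2 (volume : Measure I)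

noncomputable instance instMeasurableSpaceH : MeasurableSpace H := borel H

instance instBorelSpaceH : BorelSpace H := ⟨rfl⟩

/-- The closed convex cone of the elements of `H` that are nonnegative almost everywhere. -/
def cone : Set H := {z | ∀ᵐ x ∂(volume : Measure I), 0 ≤ z x}

/-- The cone as a topological and measurable space. -/
abbrev K : Type := cone

/-- The absolute value map `j(z) = |z|`. -/
noncomputable def j (z : H) : K :=
  ⟨|z|, by
    filter_upwards [Lp.coeFn_abs z] with x hx
    rw [hx]
    exact abs_nonneg _⟩

/-- The function `e_k(x) = √2 sin(k π x)` in `H`. -/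
noncomputable def e (k : ℕ) : H :=
  ContinuousMap.toLp 2 volume ℝ ⟨fun x : I => √2 * Real.sin (k * Real.pi * x), by fun_prop⟩

/-- The linear span of `e_1, e_2, …`. -/
noncomputable def testSpace : Submodule ℝ H := Submodule.span ℝ (e '' {k | 1 ≤ k})

/-- The set of functions `F(z) = ψ(⟨l₁, z⟩, …, ⟨l_m, z⟩)` with `ψ` smooth and bounded together with
all its derivatives, and `l₁, …, l_m` in the span of the `e_k`. -/
def cylindricalH : Set (H → ℝ) :=
  {F | ∃ (m : ℕ) (ψ : (Fin m → ℝ) → ℝ) (l : Fin m → H),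
    ContDiff ℝ ∞ ψ ∧ (∀ n : ℕ, ∃ C : ℝ, ∀ x, ‖iteratedFDeriv ℝ n ψ x‖ ≤ C) ∧
      (∀ i, l i ∈ testSpace) ∧ ∀ z, F z = ψ (fun i => ⟪l i, z⟫)}

/-- Restrictions to the cone of the cylindrical functions on `H`. -/
def cylindricalK : Set (K → ℝ) :=
  {f | ∃ F ∈ cylindricalH, ∀ z : K, f z = F z}

open Classical in
/-- The gradient `∇f : K → H` of a cylindrical function on the cone: the gradient of a cylindrical
extension of `f` to `H`. The choice of the extension does not matter, see
`gradK_eq_gradient`. (Junk value `0` off the cylindrical functions.) -/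
noncomputable def gradK (f : K → ℝ) (z : K) : H :=
  if h : f ∈ cylindricalK then gradient h.choose (z : H) else 0

theorem differentiable_of_mem_cylindricalH {F : H → ℝ} (hF : F ∈ cylindricalH) :
    Differentiable ℝ F := by
  obtain ⟨m, ψ, l, hψ, -, -, h⟩ := hF
  have : F = fun z => ψ (fun i => ⟪l i, z⟫) := funext h
  rw [this]
  have h1 : Differentiable ℝ ψ := hψ.differentiable (by simp)
  exact h1.comp (differentiable_pi.2 fun i => (innerSL ℝ (l i)).differentiable)

theorem gradient_eq_of_eq_on_cone {F G : H → ℝ} (hF : Differentiable ℝ F)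
    (hG : Differentiable ℝ G) (heq : ∀ z ∈ cone, F z = G z) {z : H} (hz : z ∈ cone) :
    gradient F z = gradient G z := by
  have key : ∀ h ∈ cone, fderiv ℝ (fun y => F y - G y) z h = 0 := by
    intro h hh
    have hline : HasDerivAt (fun t : ℝ => z + t • h) h 0 := by
      simpa using ((hasDerivAt_id (0 : ℝ)).smul_const h).const_add z
    have hD : HasFDerivAt (fun y => F y - G y) (fderiv ℝ (fun y => F y - G y) z)
        (z + (0 : ℝ) • h) := by
      rw [zero_smul, add_zero]
      exact (((hF z).fun_sub (hG z))).hasFDerivAt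
    have h1 := (hD.comp_hasDerivAt (0 : ℝ) hline).hasDerivWithinAt (s := Ici 0)
    have h2 : HasDerivWithinAt (fun _ : ℝ => (0 : ℝ)) 0 (Ici 0) 0 :=
      hasDerivWithinAt_const _ _ _
    refine (uniqueDiffOn_Ici (0 : ℝ) 0 self_mem_Ici).eq_deriv (Ici 0) h1
      (h2.congr_of_mem (fun t ht => ?_) self_mem_Ici)
    have hmem : z + t • h ∈ cone := by
      filter_upwards [hz, hh, Lp.coeFn_add z (t • h), Lp.coeFn_smul t h] with x h3 h4 h5 h6
      rw [h5, Pi.add_apply, h6, Pi.smul_apply, smul_eq_mul]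
      exact add_nonneg h3 (mul_nonneg ht h4)
    simp [heq _ hmem]
  have hzero : fderiv ℝ (fun y => F y - G y) z = 0 := by
    ext h
    have hp : h⁺ ∈ cone := by
      filter_upwards [(Lp.coeFn_nonneg h⁺).2 (posPart_nonneg h)] with x hx using hx
    have hn : h⁻ ∈ cone := by
      filter_upwards [(Lp.coeFn_nonneg h⁻).2 (negPart_nonneg h)] with x hx using hx
    rw [← posPart_sub_negPart h, map_sub, key _ hp, key _ hn]
    simp
  rw [fderiv_fun_sub (hF z) (hG z), sub_eq_zero] at hzero
  rw [gradient, gradient, hzero]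

theorem gradK_eq_gradient {f : K → ℝ} {F : H → ℝ} (hF : F ∈ cylindricalH)
    (h : ∀ z : K, f z = F z) (z : K) : gradK f z = gradient F (z : H) := by
  have hf : f ∈ cylindricalK := ⟨F, hF, h⟩
  rw [gradK, dif_pos hf]
  refine gradient_eq_of_eq_on_cone (differentiable_of_mem_cylindricalH hf.choose_spec.1)
    (differentiable_of_mem_cylindricalH hF) (fun y hy => ?_) z.2
  rw [← hf.choose_spec.2 ⟨y, hy⟩, h ⟨y, hy⟩]

/-- The form `½ ∫_H ⟨∇F, ∇G⟩ dμ`. -/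
noncomputable def preFormH (μ : Measure H) (F G : H → ℝ) : ℝ :=
  1 / 2 * ∫ z, ⟪gradient F z, gradient G z⟫ ∂μ

/-- The form `½ ∫_K ⟨∇f, ∇g⟩ dν`. -/
noncomputable def preFormK (ν : Measure K) (f g : K → ℝ) : ℝ :=
  1 / 2 * ∫ z, ⟪gradK f z, gradK g z⟫ ∂ν

/-- A Brownian bridge from `0` to `0` on `[0, 1]`: a centred Gaussian process with continuous paths
and covariance `s ∧ t - s t`. -/
structure IsBrownianBridge {Ω : Type*} [MeasurableSpace Ω] (P : Measure Ω) (β : Ω → C(I, ℝ)) :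
    Prop where
  gaussian : IsGaussianProcess (fun (t : I) (w : Ω) => β w t) P
  centered : ∀ t : I, ∫ w, β w t ∂P = 0
  covariance : ∀ s t : I, cov[fun w => β w s, fun w => β w t; P] = min (s : ℝ) t - s * t

/-- The law on `H` of a process with continuous paths. -/
noncomputable def lawH {Ω : Type*} [MeasurableSpace Ω] (P : Measure Ω) (β : Ω → C(I, ℝ)) :
    Measure H :=
  P.map (fun w => ContinuousMap.toLp 2 volume ℝ (β w))

/-- The law on the cone of the absolute value of a process with continuous paths. -/
noncomputable def lawAbs {Ω : Type*} [MeasurableSpace Ω] (P : Measure Ω) (β : Ω → C(I, ℝ)) :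
    Measure K :=
  (lawH P β).map j

theorem measurePreserving_j {Ω : Type*} [MeasurableSpace Ω] (P : Measure Ω) (β : Ω → C(I, ℝ)) :
    MeasurePreserving j (lawH P β) (lawAbs P β) := by
  refine ⟨Continuous.measurable ?_, rfl⟩
  exact Continuous.subtype_mk (continuous_id.sup continuous_neg) _

/-- The map `f ↦ f ∘ j` from `L²(ν)` to `L²(μ)`, where `ν` is the image of `μ` under `j`. -/
noncomputable def compJ {Ω : Type*} [MeasurableSpace Ω] {P : Measure Ω} {β : Ω → C(I, ℝ)}
    (f : Lp ℝ 2 (lawAbs P β)) : Lp ℝ 2 (lawH P β) :=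
  Lp.compMeasurePreserving j (measurePreserving_j P β) f

end BridgeForm

/-! No integration by parts is carried out on the cone. Closability is proved for the Gaussian form
on `H` and pulled back through `j`. Both forms are treated as `½⟪T u, T v⟫`, with `T` the operator
whose graph is the closure in `L² × L²` of the graph of the gradient; closability says that this
closed graph is single valued.

On `H`: the covariance kernel `s ∧ t - s t` is diagonal in the sine basis, so the coordinates `⟪e_k,
z⟫` are independent centred Gaussians of variance `(kπ)⁻²` (`map_coords_eq_pi`). Integration by
parts in one coordinate, tested against cylindrical functions, shows that the zero function has only
the zero gradient (`singleValued_closedGraph_H`).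

The transfer: for `f = ψ(⟪l₁, ·⟫, …)` on the cone, `f ∘ j` lies in the domain on `H`, with gradient
`sign(z) · (∇f)(|z|)` (`hasGrad_comp_abs`). Almost every bridge path vanishes only on a Lebesgue
null set (`ae_ne_zero`), so multiplication by `sign(z)` preserves the norm of `H`, and `‖∇(f ∘
j)(z)‖ = ‖∇f(j z)‖` almost surely. As `ν` is the image of `μ`, the map `f ↦ f ∘ j` preserves both
the `L²` norm and the energy of cylindrical functions. Such an isometry carries single-valuedness
back to `K` (`singleValued_closure_of_isometry`), extends to the closure, and gives the identity of
the forms by polarization (`graphForm_eq_of_isometry`).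

The other properties follow on `K` itself. Smooth functions operate on cylindrical ones, and the
chain rule passes to the closure, also for primitives of bounded pointwise limits of bumps
(`HasGrad.comp_primitive`). The unit contraction gives the Markov property; the indicator of `{0}`
shows that gradients vanish almost everywhere on the zero set of the function, whence locality. For
quasi-regularity, weights `c_k → ∞` are chosen with `∑ c_k² E⟪e_k, z⟫² < ∞`; the sets `∑ c_k ⟪e_k,
z⟫² ≤ R` are compact, and smooth cut-offs of this sum have gradients in `L²`
(`exists_compact_nest`). -/

/-! ### Smooth functions bounded together with all their derivatives -/

namespace DirichletForms

section BddSmooth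

variable {W Y Z : Type*} [NormedAddCommGroup W] [NormedSpace ℝ W] [NormedAddCommGroup Y]
  [NormedSpace ℝ Y] [NormedAddCommGroup Z] [NormedSpace ℝ Z]

/-- Smooth functions bounded together with all their derivatives. -/
def BddSmooth (f : W → Y) : Prop :=
  ContDiff ℝ ∞ f ∧ ∀ n : ℕ, ∃ C : ℝ, ∀ x, ‖iteratedFDeriv ℝ n f x‖ ≤ C

theorem BddSmooth.bound {f : W → Y} (hf : BddSmooth f) : ∃ C, 0 ≤ C ∧ ∀ x, ‖f x‖ ≤ C := by
  obtain ⟨C, hC⟩ := hf.2 0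
  refine ⟨C, (norm_nonneg _).trans (hC 0), fun x => ?_⟩
  simpa using hC x

theorem BddSmooth.bound_fderiv {f : W → Y} (hf : BddSmooth f) :
    ∃ C, 0 ≤ C ∧ ∀ x, ‖fderiv ℝ f x‖ ≤ C := by
  obtain ⟨C, hC⟩ := hf.2 1
  refine ⟨C, (norm_nonneg _).trans (hC 0), fun x => ?_⟩
  simpa [norm_iteratedFDeriv_one] using hC x

theorem BddSmooth.differentiable {f : W → Y} (hf : BddSmooth f) : Differentiable ℝ f :=
  hf.1.differentiable (by simp)

theorem BddSmooth.continuous_fderiv {f : W → Y} (hf : BddSmooth f) :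
    Continuous (fderiv ℝ f) :=
  hf.1.continuous_fderiv (by simp)

theorem natCast_le_infty (n : ℕ) : ((n : ℕ∞ω)) ≤ ∞ := by
  exact_mod_cast le_top

theorem bddSmooth_const (c : Y) : BddSmooth (fun _ : W => c) := by
  refine ⟨contDiff_const, fun n => ⟨‖c‖, fun x => ?_⟩⟩
  rcases Nat.eq_zero_or_pos n with rfl | hn
  · simp
  · rw [iteratedFDeriv_const_of_ne hn.ne']
    simp

theorem BddSmooth.add {f g : W → Y} (hf : BddSmooth f) (hg : BddSmooth g) :
    BddSmooth (fun x => f x + g x) := by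
  refine ⟨hf.1.add hg.1, fun n => ?_⟩
  obtain ⟨C, hC⟩ := hf.2 n
  obtain ⟨C', hC'⟩ := hg.2 n
  refine ⟨C + C', fun x => ?_⟩
  have : iteratedFDeriv ℝ n (fun x => f x + g x) x =
      iteratedFDeriv ℝ n f x + iteratedFDeriv ℝ n g x :=
    iteratedFDeriv_add_apply ((hf.1.of_le (natCast_le_infty n)).contDiffAt)
      ((hg.1.of_le (natCast_le_infty n)).contDiffAt)
  rw [this]
  exact (norm_add_le _ _).trans (add_le_add (hC x) (hC' x))

theorem BddSmooth.sum {ι : Type*} (s : Finset ι) {f : ι → W → Y} (hf : ∀ i, BddSmooth (f i)) :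
    BddSmooth (fun x => ∑ i ∈ s, f i x) := by
  classical
  induction s using Finset.induction_on with
  | empty => simpa using bddSmooth_const (W := W) (0 : Y)
  | insert a s ha ih => simpa only [Finset.sum_insert ha] using (hf a).add ih

theorem BddSmooth.mul {f g : W → ℝ} (hf : BddSmooth f) (hg : BddSmooth g) :
    BddSmooth (fun x => f x * g x) := by
  refine ⟨hf.1.mul hg.1, fun n => ?_⟩
  choose C hC using hf.2
  choose C' hC' using hg.2
  refine ⟨∑ i ∈ Finset.range (n + 1), (n.choose i : ℝ) * C i * C' (n - i), fun x => ?_⟩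
  refine (norm_iteratedFDeriv_mul_le hf.1 hg.1 x (natCast_le_infty n)).trans ?_
  refine Finset.sum_le_sum fun i _ => ?_
  have h0 : 0 ≤ C i := (norm_nonneg _).trans (hC i x)
  gcongr
  · exact hC i x
  · exact hC' _ x

theorem BddSmooth.clm_comp (L : Y →L[ℝ] Z) {f : W → Y} (hf : BddSmooth f) :
    BddSmooth (fun x => L (f x)) := by
  refine ⟨L.contDiff.comp hf.1, fun n => ?_⟩
  obtain ⟨C, hC⟩ := hf.2 n
  refine ⟨‖L‖ * C, fun x => ?_⟩
  refine (L.norm_iteratedFDeriv_comp_left (hf.1.of_le (natCast_le_infty n)).contDiffAt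
    le_rfl).trans ?_
  gcongr
  exact hC x

theorem BddSmooth.const_mul (c : ℝ) {f : W → ℝ} (hf : BddSmooth f) :
    BddSmooth (fun x => c * f x) :=
  hf.clm_comp (c • ContinuousLinearMap.id ℝ ℝ)

theorem BddSmooth.comp_clm {f : Y → Z} (hf : BddSmooth f) (L : W →L[ℝ] Y) :
    BddSmooth (fun x => f (L x)) := by
  refine ⟨hf.1.comp L.contDiff, fun n => ?_⟩
  obtain ⟨C, hC⟩ := hf.2 n
  refine ⟨C * ∏ _i : Fin n, ‖L‖, fun x => ?_⟩
  have := L.iteratedFDeriv_comp_right hf.1 x (natCast_le_infty n)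
  rw [show (fun x => f (L x)) = f ∘ L from rfl, this]
  refine (ContinuousMultilinearMap.norm_compContinuousLinearMap_le _ _).trans ?_
  gcongr
  exact hC _

theorem BddSmooth.pi {ι : Type*} [Fintype ι] {f : W → ι → ℝ}
    (hf : ∀ i, BddSmooth (fun x => f x i)) : BddSmooth f := by
  classical
  have h := BddSmooth.sum Finset.univ fun i =>
    (hf i).clm_comp (ContinuousLinearMap.single ℝ (fun _ : ι => ℝ) i)
  convert h using 1
  ext x j
  simp [Finset.sum_apply, Pi.single_apply]

theorem BddSmooth.comp {g : Y → Z} {f : W → Y} (hg : BddSmooth g) (hf : BddSmooth f) :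
    BddSmooth (fun x => g (f x)) := by
  refine ⟨hg.1.comp hf.1, fun n => ?_⟩
  choose C hC using hf.2
  choose C' hC' using hg.2
  have hC0 : ∀ i, 0 ≤ C i := fun i => (norm_nonneg _).trans (hC i 0)
  have hC0' : ∀ i, 0 ≤ C' i := fun i => (norm_nonneg _).trans (hC' i 0)
  have hle : ∀ (c : ℕ → ℝ), (∀ i, 0 ≤ c i) → ∀ i ≤ n, c i ≤ ∑ j ∈ Finset.range (n + 1), c j :=
    fun c hc i hi => Finset.single_le_sum (f := c) (fun j _ => hc j)
      (Finset.mem_range.2 (Nat.lt_succ_of_le hi))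
  have hone : 1 ≤ 1 + ∑ j ∈ Finset.range (n + 1), C j :=
    le_add_of_nonneg_right (Finset.sum_nonneg fun j _ => hC0 j)
  -- The composition bound wants a single constant for the outer derivatives and the `i`-th power of
  -- one number for the inner ones. Sums of the constants dominate each of them, and the added `1`
  -- makes the base at least `1`, so that its positive powers dominate it.
  refine ⟨n.factorial * (∑ j ∈ Finset.range (n + 1), C' j) *
    (1 + ∑ j ∈ Finset.range (n + 1), C j) ^ n, fun x => ?_⟩
  refine norm_iteratedFDeriv_comp_le hg.1 hf.1 (natCast_le_infty n) x
    (fun i hi => (hC' i _).trans (hle C' hC0' i hi)) fun i hi hin => ?_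
  calc ‖iteratedFDeriv ℝ i f x‖ ≤ C i := hC i x
    _ ≤ ∑ j ∈ Finset.range (n + 1), C j := hle C hC0 i hin
    _ ≤ 1 + ∑ j ∈ Finset.range (n + 1), C j := by linarith
    _ ≤ _ := le_self_pow₀ hone (by omega)

theorem BddSmooth.of_hasCompactSupport {f : W → Y} (hf : ContDiff ℝ ∞ f)
    (hc : HasCompactSupport f) : BddSmooth f := by
  refine ⟨hf, fun n => ?_⟩
  have h1 : Continuous (iteratedFDeriv ℝ n f) :=
    hf.continuous_iteratedFDeriv (natCast_le_infty n)
  exact h1.bounded_above_of_compact_support (hc.iteratedFDeriv n)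

theorem bddSmooth_of_iteratedDeriv {f : ℝ → ℝ} (hf : ContDiff ℝ ∞ f)
    (h : ∀ n, ∃ C, ∀ x, |iteratedDeriv n f x| ≤ C) : BddSmooth f :=
  ⟨hf, fun n => by simpa [norm_iteratedFDeriv_eq_norm_iteratedDeriv] using h n⟩

theorem bddSmooth_sin : BddSmooth Real.sin :=
  bddSmooth_of_iteratedDeriv Real.contDiff_sin fun n =>
    ⟨1, fun x => Real.abs_iteratedDeriv_sin_le_one n x⟩

theorem hasDerivAt_primitive {χ : ℝ → ℝ} (hχ : Continuous χ) (t : ℝ) :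
    HasDerivAt (fun t => ∫ s in (0 : ℝ)..t, χ s) (χ t) t :=
  intervalIntegral.integral_hasDerivAt_right (hχ.intervalIntegrable _ _)
    (hχ.stronglyMeasurableAtFilter _ _) hχ.continuousAt

/-- The `L¹` norm of `χ` bounds the primitive itself, and its derivatives are those of `χ`. Such
primitives approximate Lipschitz functions like `|t|` or the unit contraction by functions that are
bounded and smooth. -/
theorem bddSmooth_primitive {χ : ℝ → ℝ} (hχ : ContDiff ℝ ∞ χ) (hc : HasCompactSupport χ) :
    BddSmooth (fun t => ∫ s in (0 : ℝ)..t, χ s) := by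
  have hd : deriv (fun t => ∫ s in (0 : ℝ)..t, χ s) = χ :=
    funext fun t => (hasDerivAt_primitive hχ.continuous t).deriv
  refine bddSmooth_of_iteratedDeriv ?_ fun n => ?_
  · rw [contDiff_infty_iff_deriv, hd]
    exact ⟨fun t => (hasDerivAt_primitive hχ.continuous t).differentiableAt, hχ⟩
  · rcases n with _ | n
    · refine ⟨∫ s, |χ s|, fun x => ?_⟩
      have hi : Integrable χ := hχ.continuous.integrable_of_hasCompactSupport hc
      rw [iteratedDeriv_zero]
      refine (intervalIntegral.norm_integral_le_integral_norm_uIoc (f := χ) (a := 0) (b := x)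
        (μ := volume)).trans ?_
      exact setIntegral_le_integral hi.norm (Eventually.of_forall fun _ => norm_nonneg _)
    · obtain ⟨C, hC⟩ := (BddSmooth.of_hasCompactSupport hχ hc).2 n
      refine ⟨C, fun x => ?_⟩
      rw [iteratedDeriv_succ', hd]
      simpa [norm_iteratedFDeriv_eq_norm_iteratedDeriv] using hC x

theorem abs_primitive_le {χ : ℝ → ℝ} {C : ℝ} (hC : ∀ s, |χ s| ≤ C) (t : ℝ) :
    |∫ s in (0 : ℝ)..t, χ s| ≤ C * |t| := by
  simpa using intervalIntegral.norm_integral_le_of_norm_le_const (a := 0) (b := t) (f := χ)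
    (C := C) (fun s _ => hC s)

theorem tendsto_primitive {χ : ℕ → ℝ → ℝ} {ρ : ℝ → ℝ} {C : ℝ} (hχ : ∀ n, Continuous (χ n))
    (hC : ∀ n s, |χ n s| ≤ C) (hlim : ∀ s, Tendsto (fun n => χ n s) atTop (𝓝 (ρ s))) (t : ℝ) :
    Tendsto (fun n => ∫ s in (0 : ℝ)..t, χ n s) atTop (𝓝 (∫ s in (0 : ℝ)..t, ρ s)) := by
  refine intervalIntegral.tendsto_integral_filter_of_dominated_convergence (fun _ => C)
    (Eventually.of_forall fun n => (hχ n).aestronglyMeasurable)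
    (Eventually.of_forall fun n => Eventually.of_forall fun s _ => hC n s)
    (by simp) (Eventually.of_forall fun s _ => hlim s)

end BddSmooth

end DirichletForms

/-! ### Forms `½⟪T u, T v⟫` associated with a graph -/

namespace DirichletForms

section Graph

variable {X Y : Type*} [NormedAddCommGroup X] [InnerProductSpace ℝ X] [NormedAddCommGroup Y]
  [InnerProductSpace ℝ Y]

/-- The graph `Γ` is the graph of a (single valued) operator. -/
def SingleValued (Γ : Submodule ℝ (X × Y)) : Prop :=
  ∀ p ∈ Γ, p.1 = 0 → p.2 = 0

theorem SingleValued.eq {Γ : Submodule ℝ (X × Y)} (h : SingleValued Γ) {u : X} {w w' : Y}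
    (hw : (u, w) ∈ Γ) (hw' : (u, w') ∈ Γ) : w = w' := by
  have := h _ (Γ.sub_mem hw hw') (by simp)
  simpa [sub_eq_zero] using this

/-- The form `½⟪T u, T v⟫`, where `T` is the operator with graph `Γ`. -/
noncomputable def graphForm (Γ : Submodule ℝ (X × Y)) : SymmForm X where
  dom := Γ.toLinearPMap.domain
  form := (1 / 2 : ℝ) • (innerₗ Y).compl₁₂ Γ.toLinearPMap.toFun Γ.toLinearPMap.toFun
  symm u v := by
    simp only [LinearMap.smul_apply, LinearMap.compl₁₂_apply, innerₗ_apply_apply, smul_eq_mul]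
    rw [real_inner_comm]
  nonneg u := by
    simp only [LinearMap.smul_apply, LinearMap.compl₁₂_apply, innerₗ_apply_apply, smul_eq_mul]
    exact mul_nonneg (by norm_num) real_inner_self_nonneg

theorem mem_graphForm_dom {Γ : Submodule ℝ (X × Y)} {u : X} :
    u ∈ (graphForm Γ).dom ↔ ∃ w, (u, w) ∈ Γ := by
  change u ∈ Γ.toLinearPMap.domain ↔ _
  rw [Submodule.toLinearPMap_domain]
  simp

theorem exists_graph_mem {Γ : Submodule ℝ (X × Y)} (u : (graphForm Γ).dom) :
    ∃ w, ((u : X), w) ∈ Γ :=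
  mem_graphForm_dom.1 u.2

theorem graphForm_apply {Γ : Submodule ℝ (X × Y)} (hΓ : SingleValued Γ)
    {u v : (graphForm Γ).dom} {w w' : Y} (hu : ((u : X), w) ∈ Γ) (hv : ((v : X), w') ∈ Γ) :
    (graphForm Γ).form u v = 1 / 2 * ⟪w, w'⟫ := by
  have key : ∀ (u : (graphForm Γ).dom) (w : Y), ((u : X), w) ∈ Γ → Γ.toLinearPMap.toFun u = w := by
    intro u w hu
    exact hΓ.eq (Submodule.mem_graph_toLinearPMap hΓ u) hu
  rw [← key u w hu, ← key v w' hv]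
  rfl

theorem graphForm_energyOne {Γ : Submodule ℝ (X × Y)} (hΓ : SingleValued Γ)
    {u : (graphForm Γ).dom} {w : Y} (hu : ((u : X), w) ∈ Γ) :
    (graphForm Γ).energyOne u = 1 / 2 * ‖w‖ ^ 2 + ‖(u : X)‖ ^ 2 := by
  rw [SymmForm.energyOne, graphForm_apply hΓ hu hu, real_inner_self_eq_norm_sq]

theorem tendsto_zero_of_sq {ι : Type*} {l : Filter ι} {a b : ι → ℝ} {c : ℝ} (hc : 0 < c)
    (ha : ∀ i, 0 ≤ a i) (hab : ∀ i, c * a i ^ 2 ≤ b i) (hb : Tendsto b l (𝓝 0)) :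
    Tendsto a l (𝓝 0) := by
  have h1 : Tendsto (fun i => √(b i / c)) l (𝓝 0) := by
    have := (Real.continuous_sqrt.tendsto 0).comp (by simpa using hb.div_const c)
    simpa [Function.comp_def] using this
  refine squeeze_zero ha (fun i => ?_) h1
  refine Real.le_sqrt_of_sq_le ?_
  rw [le_div_iff₀ hc, mul_comm]
  exact hab i

/-- The norm `𝓔₁ ^ (1/2)` is equivalent to the graph norm, so completeness of the domain is
closedness of the graph. -/
theorem graphForm_isClosedForm [CompleteSpace X] [CompleteSpace Y] {Γ : Submodule ℝ (X × Y)}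
    (hΓ : SingleValued Γ) (hc : IsClosed (Γ : Set (X × Y)))
    (hd : Dense ((graphForm Γ).dom : Set X)) : (graphForm Γ).IsClosedForm := by
  refine ⟨hd, fun u hu => ?_⟩
  choose w hw using fun n => exists_graph_mem (u n)
  have hdiff : ∀ p q, (((u p - u q : (graphForm Γ).dom) : X), w p - w q) ∈ Γ := fun p q =>
    Γ.sub_mem (hw p) (hw q)
  have he : ∀ p : ℕ × ℕ, (graphForm Γ).energyOne (u p.1 - u p.2) =
      1 / 2 * ‖w p.1 - w p.2‖ ^ 2 + ‖(u p.1 : X) - u p.2‖ ^ 2 := fun p => by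
    rw [graphForm_energyOne hΓ (hdiff p.1 p.2)]
    simp
  have hu1 : CauchySeq (fun n => (u n : X)) := by
    rw [cauchySeq_iff_tendsto_dist_atTop_0]
    refine tendsto_zero_of_sq one_pos (fun _ => dist_nonneg) (fun p => ?_) hu
    rw [he, dist_eq_norm]
    nlinarith [sq_nonneg ‖w p.1 - w p.2‖]
  have hw1 : CauchySeq w := by
    rw [cauchySeq_iff_tendsto_dist_atTop_0]
    refine tendsto_zero_of_sq (c := 1 / 2) (by norm_num) (fun _ => dist_nonneg) (fun p => ?_) hu
    rw [he, dist_eq_norm]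
    nlinarith [sq_nonneg ‖(u p.1 : X) - u p.2‖]
  obtain ⟨x, hx⟩ := cauchySeq_tendsto_of_complete hu1
  obtain ⟨y, hy⟩ := cauchySeq_tendsto_of_complete hw1
  have hxy : (x, y) ∈ Γ := hc.mem_of_tendsto (hx.prodMk_nhds hy) (Eventually.of_forall hw)
  refine ⟨⟨x, mem_graphForm_dom.2 ⟨y, hxy⟩⟩, ?_⟩
  have : ∀ n, (graphForm Γ).energyOne (u n - ⟨x, mem_graphForm_dom.2 ⟨y, hxy⟩⟩) =
      1 / 2 * ‖w n - y‖ ^ 2 + ‖(u n : X) - x‖ ^ 2 := fun n => by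
    rw [graphForm_energyOne hΓ (w := w n - y)]
    · simp
    · exact Γ.sub_mem (hw n) hxy
  simp_rw [this]
  have h1 : Tendsto (fun n => ‖w n - y‖) atTop (𝓝 0) := tendsto_iff_norm_sub_tendsto_zero.1 hy
  have h2 : Tendsto (fun n => ‖(u n : X) - x‖) atTop (𝓝 0) :=
    tendsto_iff_norm_sub_tendsto_zero.1 hx
  have := ((h1.pow 2).const_mul (1 / 2)).add (h2.pow 2)
  rwa [show (1 / 2 * 0 ^ 2 + 0 ^ 2 : ℝ) = 0 by norm_num] at this

end Graph

/-! ### Transport of closability along an energy isometry -/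

section Transfer

variable {X Y X' Y' : Type*} [NormedAddCommGroup X] [InnerProductSpace ℝ X]
  [NormedAddCommGroup Y] [InnerProductSpace ℝ Y] [NormedAddCommGroup X'] [InnerProductSpace ℝ X']
  [NormedAddCommGroup Y'] [InnerProductSpace ℝ Y']

/-- Applying `h` to differences of elements of `S`, and using that `Γ` is single valued, the lifts
`w n` have the same mutual distances as the second components of `q n`. They are therefore Cauchy,
and their limit is the lift sought. -/
theorem exists_mem_of_mem_closure [CompleteSpace Y'] {S : Submodule ℝ (X × Y)}
    {Γ : Submodule ℝ (X' × Y')}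
    (hΓ : SingleValued Γ) (hc : IsClosed (Γ : Set (X' × Y'))) (ι : X →L[ℝ] X')
    (h : ∀ p ∈ S, ∃ w, (ι p.1, w) ∈ Γ ∧ ‖w‖ = ‖p.2‖) {p : X × Y}
    (hp : p ∈ S.topologicalClosure) : ∃ w, (ι p.1, w) ∈ Γ ∧ ‖w‖ = ‖p.2‖ := by
  rw [← SetLike.mem_coe, Submodule.topologicalClosure_coe, mem_closure_iff_seq_limit] at hp
  obtain ⟨q, hq, hlim⟩ := hp
  choose w hw hn using fun n => h (q n) (hq n)
  have hdist : ∀ m n, ‖w m - w n‖ = ‖(q m).2 - (q n).2‖ := by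
    intro m n
    obtain ⟨w', hw', hn'⟩ := h _ (S.sub_mem (hq m) (hq n))
    have : (ι ((q m - q n).1), w m - w n) ∈ Γ := by
      have := Γ.sub_mem (hw m) (hw n)
      simpa using this
    rw [hΓ.eq this hw', hn']
    rfl
  have h2 : Tendsto (fun n => (q n).2) atTop (𝓝 p.2) := (continuous_snd.tendsto p).comp hlim
  have h1 : Tendsto (fun n => (q n).1) atTop (𝓝 p.1) := (continuous_fst.tendsto p).comp hlim
  have hcau : CauchySeq w := by
    rw [cauchySeq_iff_tendsto_dist_atTop_0]
    have := cauchySeq_iff_tendsto_dist_atTop_0.1 h2.cauchySeq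
    simpa only [dist_eq_norm, hdist] using this
  obtain ⟨y, hy⟩ := cauchySeq_tendsto_of_complete hcau
  refine ⟨y, hc.mem_of_tendsto (((ι.continuous.tendsto _).comp h1).prodMk_nhds hy)
    (Eventually.of_forall hw), ?_⟩
  have := hy.norm
  simp_rw [hn] at this
  exact tendsto_nhds_unique this h2.norm

/-- A pair `(0, y)` in the closure lifts to some `(0, w) ∈ Γ` with `‖w‖ = ‖y‖`, and `w = 0`. -/
theorem singleValued_closure_of_isometry [CompleteSpace Y'] {S : Submodule ℝ (X × Y)}
    {Γ : Submodule ℝ (X' × Y')}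
    (hΓ : SingleValued Γ) (hc : IsClosed (Γ : Set (X' × Y'))) (ι : X →L[ℝ] X')
    (h : ∀ p ∈ S, ∃ w, (ι p.1, w) ∈ Γ ∧ ‖w‖ = ‖p.2‖) :
    SingleValued S.topologicalClosure := by
  intro p hp h0
  obtain ⟨w, hw, hn⟩ := exists_mem_of_mem_closure hΓ hc ι h hp
  rw [h0, map_zero] at hw
  have hw0 : w = 0 := hΓ _ hw rfl
  rw [hw0, norm_zero] at hn
  exact norm_eq_zero.1 hn.symm

/-- Equality of norms gives equality of the quadratic forms; polarization, through `u + v`, gives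
that of the bilinear forms. -/
theorem graphForm_eq_of_isometry {Γ : Submodule ℝ (X × Y)} {Γ' : Submodule ℝ (X' × Y')}
    (hΓ : SingleValued Γ) (hΓ' : SingleValued Γ') (ι : X →L[ℝ] X')
    (h : ∀ p ∈ Γ, ∃ w, (ι p.1, w) ∈ Γ' ∧ ‖w‖ = ‖p.2‖) :
    ∃ hj : ∀ u ∈ (graphForm Γ).dom, ι u ∈ (graphForm Γ').dom, ∀ u v : (graphForm Γ).dom,
      (graphForm Γ).form u v = (graphForm Γ').form ⟨ι u, hj u u.2⟩ ⟨ι v, hj v v.2⟩ := by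
  have hj : ∀ u ∈ (graphForm Γ).dom, ι u ∈ (graphForm Γ').dom := by
    intro u hu
    obtain ⟨w, hw⟩ := mem_graphForm_dom.1 hu
    obtain ⟨w', hw', -⟩ := h _ hw
    exact mem_graphForm_dom.2 ⟨w', hw'⟩
  have hq : ∀ u : (graphForm Γ).dom,
      (graphForm Γ).form u u = (graphForm Γ').form ⟨ι u, hj u u.2⟩ ⟨ι u, hj u u.2⟩ := by
    intro u
    obtain ⟨w, hw⟩ := exists_graph_mem u
    obtain ⟨w', hw', hn⟩ := h _ hw
    rw [graphForm_apply hΓ hw hw, graphForm_apply hΓ' hw' hw', real_inner_self_eq_norm_sq,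
      real_inner_self_eq_norm_sq, hn]
  refine ⟨hj, fun u v => ?_⟩
  have h1 := hq (u + v)
  have h2 : (⟨ι ((u + v : (graphForm Γ).dom) : X), hj _ (u + v).2⟩ : (graphForm Γ').dom) =
      ⟨ι u, hj u u.2⟩ + ⟨ι v, hj v v.2⟩ := by
    ext
    simp
  rw [h2] at h1
  simp only [map_add, LinearMap.add_apply] at h1
  rw [(graphForm Γ).symm v u, (graphForm Γ').symm ⟨ι v, hj v v.2⟩ ⟨ι u, hj u u.2⟩, hq u, hq v]
    at h1
  linarith

end Transfer

/-! ### Gradient type operators -/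

section Gradient

theorem tendsto_eLpNorm_two_of_dominated {E F : Type*} [MeasurableSpace E] [NormedAddCommGroup F]
    {m : Measure E} {f : ℕ → E → F} {g : E → F} {b : E → ℝ}
    (hf : ∀ n, AEStronglyMeasurable (f n) m) (hb : MemLp b 2 m)
    (hfb : ∀ n, ∀ᵐ x ∂m, ‖f n x‖ ≤ b x)
    (hlim : ∀ᵐ x ∂m, Tendsto (fun n => f n x) atTop (𝓝 (g x))) :
    MemLp g 2 m ∧ Tendsto (fun n => eLpNorm (f n - g) 2 m) atTop (𝓝 0) := by
  have hg : AEStronglyMeasurable g m := aestronglyMeasurable_of_tendsto_ae atTop hf hlim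
  have hgb : ∀ᵐ x ∂m, ‖g x‖ ≤ b x := by
    filter_upwards [hlim, ae_all_iff.2 hfb] with x hx hx'
    exact le_of_tendsto hx.norm (Eventually.of_forall hx')
  refine ⟨hb.mono' hg hgb, ?_⟩
  have hint : Tendsto (fun n => ∫⁻ x, ‖(f n - g) x‖ₑ ^ (2 : ℝ) ∂m) atTop (𝓝 0) := by
    -- Both `f n` and its limit are bounded by `b`, so `(2b)²` dominates `‖f n - g‖²`.
    have h2b : ∫⁻ x, (2 * ‖b x‖ₑ) ^ (2 : ℝ) ∂m ≠ ⊤ := by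
      have := (hb.const_mul 2).eLpNorm_ne_top
      rw [eLpNorm_eq_lintegral_rpow_enorm_toReal (by simp) (by simp)] at this
      have h3 := (ENNReal.rpow_lt_top_iff_of_pos (by simp)).1 this.lt_top
      refine (lt_of_eq_of_lt ?_ h3).ne
      congr 1 with x
      rw [enorm_mul]
      simp [Real.enorm_eq_ofReal]
    rw [show (0 : ENNReal) = ∫⁻ x, 0 ∂m by simp]
    refine tendsto_lintegral_of_dominated_convergence' _
      (fun n => (((hf n).sub hg).enorm.pow_const 2)) (fun n => ?_) h2b ?_
    · filter_upwards [hfb n, hgb] with x h1 h2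
      gcongr
      have hb0 : 0 ≤ b x := (norm_nonneg _).trans h1
      have : ‖(f n - g) x‖ ≤ 2 * ‖b x‖ := by
        rw [Real.norm_of_nonneg hb0]
        exact (norm_sub_le _ _).trans (by linarith)
      calc ‖(f n - g) x‖ₑ = ENNReal.ofReal ‖(f n - g) x‖ := (ofReal_norm _).symm
        _ ≤ ENNReal.ofReal (2 * ‖b x‖) := ENNReal.ofReal_le_ofReal this
        _ = 2 * ‖b x‖ₑ := by rw [ENNReal.ofReal_mul (by norm_num), ofReal_norm]; simp
    · filter_upwards [hlim] with x hx
      have h1 : Tendsto (fun n => ‖(f n - g) x‖ₑ) atTop (𝓝 0) := by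
        have := (hx.sub_const (g x)).enorm
        simpa using this
      have := (ENNReal.continuous_rpow_const (y := 2)).tendsto 0 |>.comp h1
      simpa [Function.comp_def] using this
  have := (ENNReal.continuous_rpow_const (y := 1 / 2)).tendsto 0 |>.comp hint
  simp_rw [eLpNorm_eq_lintegral_rpow_enorm_toReal (p := 2) (by simp) (by simp)]
  simpa [Function.comp_def] using this

variable {E G : Type*} [MeasurableSpace E] [NormedAddCommGroup G] [InnerProductSpace ℝ G]

/-- A linear operator `D`, defined on a vector space `V` of square integrable functions, with
values in the square integrable `G`-valued functions. -/
structure IsL2Gradient (m : Measure E) (V : Set (E → ℝ)) (D : (E → ℝ) → E → G) : Prop where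
  memLp : ∀ f ∈ V, MemLp f 2 m
  memLp_grad : ∀ f ∈ V, MemLp (D f) 2 m
  zero_mem : (0 : E → ℝ) ∈ V
  add_mem : ∀ f ∈ V, ∀ g ∈ V, f + g ∈ V
  smul_mem : ∀ (c : ℝ), ∀ f ∈ V, c • f ∈ V
  grad_add : ∀ f ∈ V, ∀ g ∈ V, D (f + g) = D f + D g
  grad_smul : ∀ (c : ℝ), ∀ f ∈ V, D (c • f) = c • D f

/-- The form `½ ∫ ⟪D f, D g⟫ dm`. -/
noncomputable def gradForm (m : Measure E) (D : (E → ℝ) → E → G) (f g : E → ℝ) : ℝ :=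
  1 / 2 * ∫ x, ⟪D f x, D g x⟫ ∂m

namespace IsL2Gradient

variable {m : Measure E} {V : Set (E → ℝ)} {D : (E → ℝ) → E → G}

theorem sub_mem (h : IsL2Gradient m V D) {f g : E → ℝ} (hf : f ∈ V) (hg : g ∈ V) :
    f - g ∈ V ∧ D (f - g) = D f - D g := by
  have h1 : f - g = f + (-1 : ℝ) • g := by simp [sub_eq_add_neg]
  have h2 := h.smul_mem (-1) g hg
  refine ⟨h1 ▸ h.add_mem f hf _ h2, ?_⟩
  rw [h1, h.grad_add f hf _ h2, h.grad_smul _ g hg]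
  simp [sub_eq_add_neg]

/-- The graph of the operator `D` on classes. -/
noncomputable def graph (h : IsL2Gradient m V D) : Submodule ℝ (Lp ℝ 2 m × Lp G 2 m) where
  carrier := {p | ∃ f ∈ V, p.1 =ᵐ[m] f ∧ p.2 =ᵐ[m] D f}
  zero_mem' := by
    refine ⟨0, h.zero_mem, Lp.coeFn_zero _ _ _, ?_⟩
    have : D 0 = 0 := by simpa using h.grad_smul 0 0 h.zero_mem
    rw [this]
    exact Lp.coeFn_zero _ _ _
  add_mem' := by
    rintro p q ⟨f, hf, h1, h2⟩ ⟨g, hg, h3, h4⟩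
    refine ⟨f + g, h.add_mem f hf g hg, (Lp.coeFn_add _ _).trans (h1.add h3), ?_⟩
    rw [h.grad_add f hf g hg]
    exact (Lp.coeFn_add _ _).trans (h2.add h4)
  smul_mem' := by
    rintro c p ⟨f, hf, h1, h2⟩
    refine ⟨c • f, h.smul_mem c f hf, (Lp.coeFn_smul _ _).trans (h1.const_smul c), ?_⟩
    rw [h.grad_smul c f hf]
    exact (Lp.coeFn_smul _ _).trans (h2.const_smul c)

/-- The closure of the graph of `D`. -/
noncomputable def closedGraph (h : IsL2Gradient m V D) : Submodule ℝ (Lp ℝ 2 m × Lp G 2 m) :=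
  h.graph.topologicalClosure

theorem isClosed_closedGraph (h : IsL2Gradient m V D) :
    IsClosed (h.closedGraph : Set (Lp ℝ 2 m × Lp G 2 m)) :=
  h.graph.isClosed_topologicalClosure

theorem toLp_mem_graph (h : IsL2Gradient m V D) {f : E → ℝ} (hf : f ∈ V) :
    ((h.memLp f hf).toLp f, (h.memLp_grad f hf).toLp (D f)) ∈ h.graph :=
  ⟨f, hf, (h.memLp f hf).coeFn_toLp, (h.memLp_grad f hf).coeFn_toLp⟩

theorem toLp_mem_closedGraph (h : IsL2Gradient m V D) {f : E → ℝ} (hf : f ∈ V) :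
    ((h.memLp f hf).toLp f, (h.memLp_grad f hf).toLp (D f)) ∈ h.closedGraph :=
  h.graph.le_topologicalClosure (h.toLp_mem_graph hf)

theorem exists_seq (h : IsL2Gradient m V D) {p : Lp ℝ 2 m × Lp G 2 m} (hp : p ∈ h.closedGraph) :
    ∃ (v : ℕ → E → ℝ) (hv : ∀ n, v n ∈ V),
      Tendsto (fun n => (h.memLp _ (hv n)).toLp (v n)) atTop (𝓝 p.1) ∧
      Tendsto (fun n => (h.memLp_grad _ (hv n)).toLp (D (v n))) atTop (𝓝 p.2) := by
  rw [closedGraph, ← SetLike.mem_coe, Submodule.topologicalClosure_coe,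
    mem_closure_iff_seq_limit] at hp
  obtain ⟨q, hq, hlim⟩ := hp
  choose v hv h1 h2 using hq
  refine ⟨v, hv, ?_, ?_⟩
  · convert (continuous_fst.tendsto p).comp hlim using 2 with n
    exact (Lp.ext ((h1 n).trans (MemLp.coeFn_toLp _).symm)).symm
  · convert (continuous_snd.tendsto p).comp hlim using 2 with n
    exact (Lp.ext ((h2 n).trans (MemLp.coeFn_toLp _).symm)).symm

theorem gradForm_eq_inner (h : IsL2Gradient m V D) {f g : E → ℝ} (hf : f ∈ V) (hg : g ∈ V) :
    gradForm m D f g =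
      1 / 2 * ⟪(h.memLp_grad f hf).toLp (D f), (h.memLp_grad g hg).toLp (D g)⟫ := by
  rw [gradForm, L2.inner_def]
  congr 1
  refine integral_congr_ae ?_
  filter_upwards [(h.memLp_grad f hf).coeFn_toLp, (h.memLp_grad g hg).coeFn_toLp] with x h1 h2
  rw [h1, h2]

theorem cauchySeq_of_formCauchy (h : IsL2Gradient m V D) {v : ℕ → E → ℝ} (hv : ∀ n, v n ∈ V)
    (hc : FormCauchy (gradForm m D) v) :
    CauchySeq (fun n => (h.memLp_grad _ (hv n)).toLp (D (v n))) := by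
  rw [cauchySeq_iff_tendsto_dist_atTop_0]
  refine tendsto_zero_of_sq (c := 1 / 2) (by norm_num) (fun _ => dist_nonneg) (fun p => ?_) hc
  obtain ⟨h1, h2⟩ := h.sub_mem (hv p.1) (hv p.2)
  rw [h.gradForm_eq_inner h1 h1, real_inner_self_eq_norm_sq, dist_eq_norm, ← MemLp.toLp_sub]
  refine le_of_eq ?_
  congr 4
  exact h2.symm

theorem formCauchy_of_cauchySeq (h : IsL2Gradient m V D) {v : ℕ → E → ℝ} (hv : ∀ n, v n ∈ V)
    (hc : CauchySeq (fun n => (h.memLp_grad _ (hv n)).toLp (D (v n)))) :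
    FormCauchy (gradForm m D) v := by
  rw [cauchySeq_iff_tendsto_dist_atTop_0] at hc
  have := (hc.pow 2).const_mul (1 / 2)
  simp only [ne_eq, OfNat.ofNat_ne_zero, not_false_eq_true, zero_pow, mul_zero] at this
  refine this.congr fun p => ?_
  obtain ⟨h1, h2⟩ := h.sub_mem (hv p.1) (hv p.2)
  rw [h.gradForm_eq_inner h1 h1, real_inner_self_eq_norm_sq, dist_eq_norm, ← MemLp.toLp_sub]
  congr 4
  exact h2.symm

theorem mem_closedGraph_of_tendsto (h : IsL2Gradient m V D) {v : ℕ → E → ℝ} (hv : ∀ n, v n ∈ V)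
    {u : Lp ℝ 2 m} {w : Lp G 2 m}
    (hu : Tendsto (fun n => eLpNorm (v n - ⇑u) 2 m) atTop (𝓝 0))
    (hw : Tendsto (fun n => (h.memLp_grad _ (hv n)).toLp (D (v n))) atTop (𝓝 w)) :
    (u, w) ∈ h.closedGraph := by
  have hu' : Tendsto (fun n => (h.memLp _ (hv n)).toLp (v n)) atTop (𝓝 u) := by
    have := (Lp.tendsto_Lp_iff_tendsto_eLpNorm'' v (fun n => h.memLp _ (hv n)) u (Lp.memLp u)).2 hu
    simpa using this
  exact h.isClosed_closedGraph.mem_of_tendsto (hu'.prodMk_nhds hw)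
    (Eventually.of_forall fun n => h.toLp_mem_closedGraph (hv n))

variable [CompleteSpace G]

/-- Form-Cauchy means that the gradients are Cauchy in `L²`. Their limit is paired with `u` in the
closed graph, hence equals `w`. -/
theorem tendsto_of_approximates (h : IsL2Gradient m V D) (hs : SingleValued h.closedGraph)
    {u : Lp ℝ 2 m} {w : Lp G 2 m} (hu : (u, w) ∈ h.closedGraph) {v : ℕ → E → ℝ}
    (hv : Approximates m V (gradForm m D) v u) :
    Tendsto (fun n => (h.memLp_grad _ (hv.mem n)).toLp (D (v n))) atTop (𝓝 w) := by
  obtain ⟨w', hw'⟩ := cauchySeq_tendsto_of_complete (h.cauchySeq_of_formCauchy hv.mem hv.cauchy)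
  rwa [hs.eq hu (h.mem_closedGraph_of_tendsto hv.mem hv.tendsto hw')]

theorem isClosureOf (h : IsL2Gradient m V D) (hs : SingleValued h.closedGraph) :
    IsClosureOf m (graphForm h.closedGraph) V (gradForm m D) := by
  refine ⟨fun u => ⟨fun hu => ?_, ?_⟩, ?_⟩
  · obtain ⟨w, hw⟩ := mem_graphForm_dom.1 hu
    obtain ⟨v, hv, h1, h2⟩ := h.exists_seq hw
    refine ⟨v, hv, h.formCauchy_of_cauchySeq hv h2.cauchySeq, ?_⟩
    exact (Lp.tendsto_Lp_iff_tendsto_eLpNorm'' v (fun n => h.memLp _ (hv n)) u (Lp.memLp u)).1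
      (by simpa using h1)
  · rintro ⟨v, hv⟩
    obtain ⟨w, hw⟩ := cauchySeq_tendsto_of_complete (h.cauchySeq_of_formCauchy hv.mem hv.cauchy)
    exact mem_graphForm_dom.2 ⟨w, h.mem_closedGraph_of_tendsto hv.mem hv.tendsto hw⟩
  · intro u u' v v' hv hv'
    obtain ⟨w, hw⟩ := exists_graph_mem u
    obtain ⟨w', hw'⟩ := exists_graph_mem u'
    rw [graphForm_apply hs hw hw']
    simp_rw [h.gradForm_eq_inner (hv.mem _) (hv'.mem _)]
    exact ((h.tendsto_of_approximates hs hw hv).inner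
      (h.tendsto_of_approximates hs hw' hv')).const_mul _

/-- The sequence approximates `0`, whose gradient in the closed graph is `0`. -/
theorem closable (h : IsL2Gradient m V D) (hs : SingleValued h.closedGraph) :
    Closable m V (gradForm m D) := by
  intro v hv hc h0
  have happ : Approximates m V (gradForm m D) v (0 : Lp ℝ 2 m) := by
    refine ⟨hv, hc, h0.congr fun n => eLpNorm_congr_ae ?_⟩
    filter_upwards [Lp.coeFn_zero ℝ 2 m] with x hx
    rw [Pi.sub_apply, hx, Pi.zero_apply, sub_zero]
  have := h.tendsto_of_approximates hs h.closedGraph.zero_mem happ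
  simp_rw [h.gradForm_eq_inner (hv _) (hv _)]
  have := (this.inner (𝕜 := ℝ) this).const_mul (1 / 2)
  rwa [inner_zero_left, mul_zero] at this

end IsL2Gradient

end Gradient

end DirichletForms

namespace DirichletForms

/-! ### Calculus in the domain of the closed gradient -/

section HasGrad

variable {E G : Type*} [MeasurableSpace E] [NormedAddCommGroup G] [InnerProductSpace ℝ G]
  {m : Measure E} {V : Set (E → ℝ)} {D : (E → ℝ) → E → G}

/-- The function `f` is in the domain of the closure of `D`, which maps it to `g`. -/
def IsL2Gradient.HasGrad (h : IsL2Gradient m V D) (f : E → ℝ) (g : E → G) : Prop :=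
  ∃ (hf : MemLp f 2 m) (hg : MemLp g 2 m), (hf.toLp f, hg.toLp g) ∈ h.closedGraph

namespace IsL2Gradient

variable {h : IsL2Gradient m V D}

theorem hasGrad_of_mem (h : IsL2Gradient m V D) {f : E → ℝ} (hf : f ∈ V) : h.HasGrad f (D f) :=
  ⟨h.memLp f hf, h.memLp_grad f hf, h.toLp_mem_closedGraph hf⟩

theorem hasGrad_of_mem_closedGraph {u : Lp ℝ 2 m} {w : Lp G 2 m} (hu : (u, w) ∈ h.closedGraph) :
    h.HasGrad u w :=
  ⟨Lp.memLp u, Lp.memLp w, by simpa using hu⟩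

theorem HasGrad.congr {f f' : E → ℝ} {g g' : E → G} (hfg : h.HasGrad f g) (hf : f =ᵐ[m] f')
    (hg : g =ᵐ[m] g') : h.HasGrad f' g' := by
  obtain ⟨h1, h2, h3⟩ := hfg
  refine ⟨h1.ae_eq hf, h2.ae_eq hg, ?_⟩
  rwa [MemLp.toLp_congr h1 (h1.ae_eq hf) hf, MemLp.toLp_congr h2 (h2.ae_eq hg) hg] at h3

theorem HasGrad.mem_closedGraph {f : E → ℝ} {g : E → G} (hfg : h.HasGrad f g) {u : Lp ℝ 2 m}
    {w : Lp G 2 m} (hu : f =ᵐ[m] u) (hw : g =ᵐ[m] w) : (u, w) ∈ h.closedGraph := by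
  obtain ⟨h1, h2, h3⟩ := hfg.congr hu hw
  simpa using h3

theorem HasGrad.ae_eq (hs : SingleValued h.closedGraph) {f : E → ℝ} {g g' : E → G}
    (hfg : h.HasGrad f g) (hfg' : h.HasGrad f g') : g =ᵐ[m] g' := by
  obtain ⟨h1, h2, h3⟩ := hfg
  obtain ⟨_, h2', h3'⟩ := hfg'
  exact (MemLp.toLp_eq_toLp_iff h2 h2').1 (hs.eq h3 h3')

theorem HasGrad.of_tendsto_eLpNorm {f : ℕ → E → ℝ} {g : ℕ → E → G} {F : E → ℝ} {F' : E → G}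
    (hfg : ∀ n, h.HasGrad (f n) (g n)) (hF : MemLp F 2 m) (hF' : MemLp F' 2 m)
    (hlim : Tendsto (fun n => eLpNorm (f n - F) 2 m) atTop (𝓝 0))
    (hlim' : Tendsto (fun n => eLpNorm (g n - F') 2 m) atTop (𝓝 0)) : h.HasGrad F F' := by
  choose h1 h2 h3 using hfg
  refine ⟨hF, hF', h.isClosed_closedGraph.mem_of_tendsto (b := atTop) (Tendsto.prodMk_nhds ?_ ?_)
    (Eventually.of_forall h3)⟩
  · exact (Lp.tendsto_Lp_iff_tendsto_eLpNorm'' f h1 F hF).2 hlim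
  · exact (Lp.tendsto_Lp_iff_tendsto_eLpNorm'' g h2 F' hF').2 hlim'

theorem HasGrad.of_tendsto {f : ℕ → E → ℝ} {g : ℕ → E → G} {F : E → ℝ} {F' : E → G}
    (hfg : ∀ n, h.HasGrad (f n) (g n)) {b b' : E → ℝ} (hb : MemLp b 2 m) (hb' : MemLp b' 2 m)
    (hfb : ∀ n, ∀ᵐ x ∂m, ‖f n x‖ ≤ b x) (hgb : ∀ n, ∀ᵐ x ∂m, ‖g n x‖ ≤ b' x)
    (hlim : ∀ᵐ x ∂m, Tendsto (fun n => f n x) atTop (𝓝 (F x)))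
    (hlim' : ∀ᵐ x ∂m, Tendsto (fun n => g n x) atTop (𝓝 (F' x))) : h.HasGrad F F' := by
  obtain ⟨h1, h2⟩ := tendsto_eLpNorm_two_of_dominated (fun n => (hfg n).1.1) hb hfb hlim
  obtain ⟨h3, h4⟩ := tendsto_eLpNorm_two_of_dominated (fun n => (hfg n).2.1.1) hb' hgb hlim'
  exact HasGrad.of_tendsto_eLpNorm hfg h1 h3 h2 h4

/-- Smooth functions of one variable operate on `V`, and `D` obeys the chain rule. -/
def HasChainRule (V : Set (E → ℝ)) (D : (E → ℝ) → E → G) : Prop :=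
  ∀ φ : ℝ → ℝ, BddSmooth φ → ∀ f ∈ V, φ ∘ f ∈ V ∧ ∀ x, D (φ ∘ f) x = deriv φ (f x) • D f x

theorem norm_deriv_eq (φ : ℝ → ℝ) (t : ℝ) : ‖deriv φ t‖ = ‖fderiv ℝ φ t‖ :=
  norm_deriv_eq_norm_fderiv

theorem HasGrad.comp [IsFiniteMeasure m] (hch : HasChainRule V D) {f : E → ℝ} {g : E → G}
    (hfg : h.HasGrad f g) {φ : ℝ → ℝ} (hφ : BddSmooth φ) :
    h.HasGrad (φ ∘ f) (fun x => deriv φ (f x) • g x) := by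
  obtain ⟨hf, hg, hmem⟩ := hfg
  obtain ⟨v, hv, h1, h2⟩ := h.exists_seq hmem
  rw [Lp.tendsto_Lp_iff_tendsto_eLpNorm''] at h1 h2
  obtain ⟨ns, hns, hae⟩ := (tendstoInMeasure_of_tendsto_eLpNorm (by simp)
    (fun n => (h.memLp _ (hv n)).1) hf.1 h1).exists_seq_tendsto_ae
  have h2' := h2.comp hns.tendsto_atTop
  obtain ⟨C, hC0, hC⟩ := hφ.bound
  obtain ⟨C', hC0', hC'⟩ := hφ.bound_fderiv
  have hdc : Continuous (deriv φ) := hφ.1.continuous_deriv (by simp)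
  obtain ⟨hA1, hA2⟩ := tendsto_eLpNorm_two_of_dominated (m := m) (f := fun n => φ ∘ v (ns n))
    (g := φ ∘ f) (b := fun _ => C)
    (fun n => (h.memLp _ (hch φ hφ _ (hv (ns n))).1).1) (memLp_const C)
    (fun n => Eventually.of_forall fun x => hC _)
    (by filter_upwards [hae] with x hx using (hφ.1.continuous.tendsto _).comp hx)
  have hdv : ∀ n, AEStronglyMeasurable (fun x => deriv φ (v n x)) m := fun n =>
    hdc.comp_aestronglyMeasurable (h.memLp _ (hv n)).1
  have hdf : AEStronglyMeasurable (fun x => deriv φ (f x)) m :=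
    hdc.comp_aestronglyMeasurable hf.1
  have hder : ∀ t, ‖deriv φ t‖ ≤ C' := fun t => (norm_deriv_eq φ t).trans_le (hC' t)
  obtain ⟨hB1, hB2⟩ := tendsto_eLpNorm_two_of_dominated (m := m)
    (f := fun n x => deriv φ (v (ns n) x) • g x)
    (g := fun x => deriv φ (f x) • g x) (b := fun x => C' * ‖g x‖)
    (fun n => (hdv _).smul hg.1) (hg.norm.const_mul C')
    (fun n => Eventually.of_forall fun x => by rw [norm_smul]; gcongr; exact hder _)
    (by
      filter_upwards [hae] with x hx
      exact ((hdc.tendsto _).comp hx).smul_const _)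
  refine HasGrad.of_tendsto_eLpNorm (fun n => h.hasGrad_of_mem (hch φ hφ _ (hv (ns n))).1)
    hA1 hB1 hA2 ?_
  have hsum : ∀ n, eLpNorm (D (φ ∘ v (ns n)) - fun x => deriv φ (f x) • g x) 2 m ≤
      ENNReal.ofReal C' * eLpNorm (D (v (ns n)) - g) 2 m +
      eLpNorm ((fun x => deriv φ (v (ns n) x) • g x) - fun x => deriv φ (f x) • g x) 2 m := by
    intro n
    -- The error is split as `φ'(v)(D v - g) + (φ'(v) - φ'(f)) g`: the first term is small since
    -- `φ'` is bounded, the second by dominated convergence.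
    have heq : (D (φ ∘ v (ns n)) - fun x => deriv φ (f x) • g x) =
        (fun x => deriv φ (v (ns n) x) • (D (v (ns n)) - g) x) +
        ((fun x => deriv φ (v (ns n) x) • g x) - fun x => deriv φ (f x) • g x) := by
      ext x
      simp [(hch φ hφ _ (hv (ns n))).2 x, smul_sub]
    rw [heq]
    have hm1 : AEStronglyMeasurable (D (v (ns n)) - g) m := (h.memLp_grad _ (hv _)).1.sub hg.1
    refine (eLpNorm_add_le ((hdv _).smul hm1) (((hdv _).smul hg.1).sub (hdf.smul hg.1))
      (by simp)).trans (add_le_add_left ?_ _)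
    refine eLpNorm_le_mul_eLpNorm_of_ae_le_mul (Eventually.of_forall fun x => ?_) 2
    rw [Pi.smul_apply', norm_smul]
    gcongr
    exact hder _
  refine tendsto_of_tendsto_of_tendsto_of_le_of_le tendsto_const_nhds ?_ (fun _ => zero_le)
    hsum
  have := (ENNReal.Tendsto.const_mul h2' (Or.inr ENNReal.ofReal_ne_top)
    (a := ENNReal.ofReal C')).add hB2
  simpa [Function.comp_def] using this

/-- The bounds `C|f|` and `C‖g‖` dominate, so the limit `θ` may be unbounded and non-smooth, and `ρ`
discontinuous. -/
theorem HasGrad.comp_tendsto [IsFiniteMeasure m] (hch : HasChainRule V D) {f : E → ℝ} {g : E → G}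
    (hfg : h.HasGrad f g) {φ : ℕ → ℝ → ℝ} (hφ : ∀ n, BddSmooth (φ n)) {θ ρ : ℝ → ℝ} {C : ℝ}
    (hθ : ∀ t, Tendsto (fun n => φ n t) atTop (𝓝 (θ t)))
    (hρ : ∀ t, Tendsto (fun n => deriv (φ n) t) atTop (𝓝 (ρ t)))
    (hC : ∀ n t, |φ n t| ≤ C * |t|) (hC' : ∀ n t, |deriv (φ n) t| ≤ C) :
    h.HasGrad (θ ∘ f) (fun x => ρ (f x) • g x) := by
  refine HasGrad.of_tendsto (fun n => hfg.comp hch (hφ n)) (hfg.1.norm.const_mul C)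
    (hfg.2.1.norm.const_mul C) (fun n => Eventually.of_forall fun x => hC n _)
    (fun n => Eventually.of_forall fun x => ?_) (Eventually.of_forall fun x => hθ _)
    (Eventually.of_forall fun x => (hρ _).smul_const _)
  rw [norm_smul]
  gcongr
  exact hC' n _

/-- The gradient involves the pointwise values of `ρ`, although the primitive sees `ρ` only up to
null sets. This discrepancy is what `HasGrad.ae_eq_zero_of_eq_zero` exploits. -/
theorem HasGrad.comp_primitive [IsFiniteMeasure m] (hch : HasChainRule V D) {f : E → ℝ}
    {g : E → G} (hfg : h.HasGrad f g) {χ : ℕ → ℝ → ℝ} (hχ : ∀ n, ContDiff ℝ ∞ (χ n))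
    (hχc : ∀ n, HasCompactSupport (χ n)) {ρ : ℝ → ℝ} {C : ℝ} (hC : ∀ n t, |χ n t| ≤ C)
    (hρ : ∀ t, Tendsto (fun n => χ n t) atTop (𝓝 (ρ t))) :
    h.HasGrad (fun x => ∫ s in (0 : ℝ)..f x, ρ s) (fun x => ρ (f x) • g x) := by
  have hd : ∀ n, deriv (fun t => ∫ s in (0 : ℝ)..t, χ n s) = χ n :=
    fun n => funext fun t => (hasDerivAt_primitive (hχ n).continuous t).deriv
  refine hfg.comp_tendsto hch (fun n => bddSmooth_primitive (hχ n) (hχc n)) (C := C)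
    (θ := fun t => ∫ s in (0 : ℝ)..t, ρ s) (fun t => ?_) (fun t => ?_) (fun n t => ?_)
    (fun n t => ?_)
  · exact tendsto_primitive (fun n => (hχ n).continuous) hC hρ t
  · simpa only [hd] using hρ t
  · exact abs_primitive_le (hC n) t
  · rw [hd]
    exact hC n t

end IsL2Gradient

end HasGrad

/-! ### Cut-off functions on the line -/

/-- A smooth bump, equal to `1` on `[c - r, c + r]` and vanishing off `(c - r', c + r')`. -/
theorem exists_bump (c r r' : ℝ) (hr : 0 < r) (hr' : r < r') :
    ∃ χ : ℝ → ℝ, ContDiff ℝ ∞ χ ∧ HasCompactSupport χ ∧ (∀ t, 0 ≤ χ t ∧ χ t ≤ 1) ∧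
      (∀ t, |t - c| ≤ r → χ t = 1) ∧ ∀ t, r' ≤ |t - c| → χ t = 0 := by
  let f : ContDiffBump c := ⟨r, r', hr, hr'⟩
  refine ⟨f, f.contDiff, f.hasCompactSupport, fun t => ⟨f.nonneg, f.le_one⟩, fun t ht => ?_,
    fun t ht => ?_⟩
  · exact f.one_of_mem_closedBall (by simpa [Real.dist_eq] using ht)
  · exact f.zero_of_le_dist (by simpa [Real.dist_eq] using ht)

theorem abs_le_one_of_mem {a : ℝ} (h : 0 ≤ a ∧ a ≤ 1) : |a| ≤ 1 :=
  abs_le.2 ⟨by linarith [h.1], h.2⟩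

/-- The plateaus are exactly `[a, b]` and the supports shrink to it, so the limit is the indicator
of the closed interval, endpoints included. -/
theorem exists_bumps_Icc (a b : ℝ) (hab : a < b) :
    ∃ χ : ℕ → ℝ → ℝ, (∀ n, ContDiff ℝ ∞ (χ n)) ∧ (∀ n, HasCompactSupport (χ n)) ∧
      (∀ n t, |χ n t| ≤ 1) ∧
      ∀ t, Tendsto (fun n => χ n t) atTop (𝓝 ((Icc a b).indicator (fun _ => 1) t)) := by
  have hpos : ∀ n : ℕ, (0 : ℝ) < 1 / (n + 1) := fun n => by positivity
  choose χ h1 h2 h3 h4 h5 using fun n : ℕ =>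
    exists_bump ((a + b) / 2) ((b - a) / 2) ((b - a) / 2 + 1 / (n + 1)) (by linarith)
      (by linarith [hpos n])
  refine ⟨χ, h1, h2, fun n t => abs_le_one_of_mem (h3 n t), fun t => ?_⟩
  by_cases ht : t ∈ Icc a b
  · rw [indicator_of_mem ht]
    refine tendsto_const_nhds.congr fun n => (h4 n t ?_).symm
    rw [abs_le]
    constructor <;> linarith [ht.1, ht.2]
  · rw [indicator_of_notMem ht]
    have hlt : (b - a) / 2 < |t - (a + b) / 2| := by
      by_contra hcon
      rw [not_lt, abs_le] at hcon
      exact ht ⟨by linarith [hcon.1], by linarith [hcon.2]⟩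
    have hev : ∀ᶠ n : ℕ in atTop, 1 / ((n : ℝ) + 1) < |t - (a + b) / 2| - (b - a) / 2 :=
      tendsto_one_div_add_atTop_nhds_zero_nat.eventually_lt_const (by linarith)
    refine (tendsto_const_nhds (x := (0 : ℝ))).congr' ?_
    filter_upwards [hev] with n hn
    exact (h5 n t (by linarith)).symm

theorem exists_bumps_zero :
    ∃ χ : ℕ → ℝ → ℝ, (∀ n, ContDiff ℝ ∞ (χ n)) ∧ (∀ n, HasCompactSupport (χ n)) ∧
      (∀ n t, |χ n t| ≤ 1) ∧
      ∀ t, Tendsto (fun n => χ n t) atTop (𝓝 (({0} : Set ℝ).indicator (fun _ => 1) t)) := by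
  have hpos : ∀ n : ℕ, (0 : ℝ) < 1 / (n + 1) := fun n => by positivity
  choose χ h1 h2 h3 h4 h5 using fun n : ℕ =>
    exists_bump 0 (1 / (n + 1)) (2 * (1 / (n + 1))) (hpos n) (by linarith [hpos n])
  refine ⟨χ, h1, h2, fun n t => abs_le_one_of_mem (h3 n t), fun t => ?_⟩
  by_cases ht : t = 0
  · rw [indicator_of_mem (by simpa using ht)]
    refine tendsto_const_nhds.congr fun n => (h4 n t ?_).symm
    rw [ht]
    simpa using (hpos n).le
  · rw [indicator_of_notMem (by simpa using ht)]
    have hev : ∀ᶠ n : ℕ in atTop, 1 / ((n : ℝ) + 1) < |t| / 2 :=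
      tendsto_one_div_add_atTop_nhds_zero_nat.eventually_lt_const (by positivity)
    refine (tendsto_const_nhds (x := (0 : ℝ))).congr' ?_
    filter_upwards [hev] with n hn
    exact (h5 n t (by rw [sub_zero]; linarith)).symm

theorem integral_indicator_Icc_eq_clamp (t : ℝ) :
    ∫ s in (0 : ℝ)..t, (Icc (0 : ℝ) 1).indicator (fun _ => (1 : ℝ)) s = min (max t 0) 1 := by
  rcases le_total t 0 with ht | ht
  · rw [max_eq_right ht, min_eq_left zero_le_one, intervalIntegral.integral_symm,
      intervalIntegral.integral_of_le ht, neg_eq_zero]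
    rw [← integral_Ico_eq_integral_Ioc]
    refine setIntegral_eq_zero_of_forall_eq_zero fun s hs => ?_
    exact indicator_of_notMem (fun h => absurd h.1 (not_le.2 hs.2)) _
  · rw [max_eq_left ht, intervalIntegral.integral_of_le ht,
      setIntegral_indicator measurableSet_Icc, setIntegral_const, smul_eq_mul, mul_one]
    have : Ioc 0 t ∩ Icc (0 : ℝ) 1 = Ioc 0 (min t 1) := by
      ext s
      simp only [mem_inter_iff, mem_Ioc, mem_Icc, le_min_iff]
      constructor
      · rintro ⟨⟨h1, h2⟩, -, h4⟩; exact ⟨h1, h2, h4⟩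
      · rintro ⟨h1, h2, h3⟩; exact ⟨⟨h1, h2⟩, h1.le, h3⟩
    rw [this, Real.volume_real_Ioc_of_le (le_min ht zero_le_one), sub_zero]

end DirichletForms

/-! ### The Dirichlet form of a closable gradient -/

namespace DirichletForms

/-! ### Square integrable functions are determined by a separating algebra -/

section Algebra

open scoped BoundedContinuousFunction

/-- Algebras of bounded continuous functions which separate points. -/
structure IsSeparatingAlgebra {E : Type*} [TopologicalSpace E] (V : Set (E → ℝ)) : Prop where
  continuous : ∀ f ∈ V, Continuous f
  bounded : ∀ f ∈ V, ∃ C, ∀ x, |f x| ≤ C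
  const_mem : ∀ c : ℝ, (fun _ => c) ∈ V
  add_mem : ∀ f ∈ V, ∀ g ∈ V, f + g ∈ V
  mul_mem : ∀ f ∈ V, ∀ g ∈ V, f * g ∈ V
  separates : ∀ x y, x ≠ y → ∃ f ∈ V, f x ≠ f y

theorem IsSeparatingAlgebra.smul_mem {E : Type*} [TopologicalSpace E] {V : Set (E → ℝ)}
    (hV : IsSeparatingAlgebra V) (c : ℝ) (f : E → ℝ) (hf : f ∈ V) : c • f ∈ V := by
  exact hV.mul_mem _ (hV.const_mem c) f hf

/-- The bounded continuous functions belonging to `V`. -/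
def IsSeparatingAlgebra.toStarSubalgebra {E : Type*} [TopologicalSpace E] {V : Set (E → ℝ)}
    (hV : IsSeparatingAlgebra V) : StarSubalgebra ℝ (E →ᵇ ℝ) where
  carrier := {f | ⇑f ∈ V}
  mul_mem' {f g} hf hg := hV.mul_mem _ hf _ hg
  add_mem' {f g} hf hg := hV.add_mem _ hf _ hg
  algebraMap_mem' c := hV.const_mem c
  star_mem' {f} hf := by
    have : ⇑(star f) = ⇑f := by
      ext x
      simp
    rwa [mem_ofPred_eq, this]

variable {E : Type*} [PseudoEMetricSpace E] [MeasurableSpace E] [BorelSpace E] [CompleteSpace E]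
  [SecondCountableTopology E] {m : Measure E} [IsFiniteMeasure m]

/-- The finite measures `u⁺ m` and `u⁻ m` give the same integrals to the elements of `V`. On a
complete separable space a point-separating algebra of bounded continuous functions determines
finite measures, so `u⁺ = u⁻` almost everywhere. -/
theorem IsSeparatingAlgebra.ae_eq_zero {V : Set (E → ℝ)} (hV : IsSeparatingAlgebra V)
    {u : E → ℝ} (hu : MemLp u 2 m) (h : ∀ f ∈ V, ∫ x, u x * f x ∂m = 0) : u =ᵐ[m] 0 := by
  have hi : Integrable u m := hu.integrable (by norm_num)
  have hni : Integrable (fun x => - u x) m := hi.neg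
  have hlt : ∀ v : E → ℝ, Integrable v m → ∫⁻ x, ENNReal.ofReal (v x) ∂m ≠ ⊤ := fun v hv =>
    hv.lintegral_lt_top.ne
  have hfin : ∀ v : E → ℝ, Integrable v m →
      IsFiniteMeasure (m.withDensity fun x => ENNReal.ofReal (v x)) := fun v hv =>
    isFiniteMeasure_withDensity (hlt v hv)
  have := hfin u hi
  have := hfin _ hni
  have hint : ∀ (v : E → ℝ), Integrable v m → ∀ g : E →ᵇ ℝ,
      ∫ x, g x ∂(m.withDensity fun x => ENNReal.ofReal (v x)) = ∫ x, max (v x) 0 * g x ∂m := by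
    intro v hv g
    rw [integral_withDensity_eq_integral_toReal_smul₀ hv.aestronglyMeasurable.aemeasurable.ennreal_ofReal
      (Eventually.of_forall fun x => ENNReal.ofReal_lt_top)]
    simp [ENNReal.toReal_ofReal']
  have heq : (m.withDensity fun x => ENNReal.ofReal (u x)) =
      m.withDensity fun x => ENNReal.ofReal (- u x) := by
    refine ext_of_forall_mem_subalgebra_integral_eq_of_pseudoEMetric_complete_countable (𝕜 := ℝ)
      (A := hV.toStarSubalgebra) ?_ ?_
    · intro x y hxy
      obtain ⟨f, hf, hne⟩ := hV.separates x y hxy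
      obtain ⟨C, hC⟩ := hV.bounded f hf
      let g : E →ᵇ ℝ := BoundedContinuousFunction.ofNormedAddCommGroup f (hV.continuous f hf) C hC
      refine ⟨f, ⟨g.toContinuousMap, ⟨g, hf, rfl⟩, rfl⟩, hne⟩
    · intro g hg
      rw [hint u hi, hint _ hni, ← sub_eq_zero]
      have hb : ∀ v : E → ℝ, Integrable v m → Integrable (fun x => max (v x) 0 * g x) m :=
        fun v hv => hv.pos_part.mul_bdd (c := ‖g‖) g.continuous.aestronglyMeasurable
          (Eventually.of_forall g.norm_coe_le_norm)
      have h1 := hb u hi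
      have h2 := hb _ hni
      rw [← integral_sub h1 h2]
      refine Eq.trans ?_ (h g hg)
      refine integral_congr_ae (Eventually.of_forall fun x => ?_)
      simp only
      rw [← sub_mul]
      congr 1
      rcases le_total (u x) 0 with hx | hx
      · rw [max_eq_right hx, max_eq_left (by linarith)]; ring
      · rw [max_eq_left hx, max_eq_right (by linarith)]; ring
  rw [withDensity_eq_iff hi.aestronglyMeasurable.aemeasurable.ennreal_ofReal
    hni.aestronglyMeasurable.aemeasurable.ennreal_ofReal (hlt u hi)] at heq
  filter_upwards [heq] with x hx
  rcases le_total (u x) 0 with h0 | h0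
  · rw [ENNReal.ofReal_of_nonpos h0] at hx
    have := ENNReal.ofReal_eq_zero.1 hx.symm
    simp only [Pi.zero_apply]
    linarith
  · rw [ENNReal.ofReal_of_nonpos (p := - u x) (by linarith)] at hx
    have := ENNReal.ofReal_eq_zero.1 hx
    simp only [Pi.zero_apply]
    linarith

end Algebra

/-! ### Markov property, locality, nests and density of the domain -/

namespace IsL2Gradient

section Basic

variable {E G : Type*} [MeasurableSpace E] [NormedAddCommGroup G] [InnerProductSpace ℝ G]
  {m : Measure E} {V : Set (E → ℝ)} {D : (E → ℝ) → E → G} {h : IsL2Gradient m V D}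

/-- With `ρ` the indicator of `{0}`, the primitive vanishes identically while the chain rule gives
it the gradient `1_{f = 0} g`. Single-valuedness forces this to be zero. -/
theorem HasGrad.ae_eq_zero_of_eq_zero [IsFiniteMeasure m] (hs : SingleValued h.closedGraph)
    (hch : HasChainRule V D) {f : E → ℝ} {g : E → G} (hfg : h.HasGrad f g) :
    ∀ᵐ x ∂m, f x = 0 → g x = 0 := by
  obtain ⟨χ, h1, h2, h3, h4⟩ := exists_bumps_zero
  have key := hfg.comp_primitive hch h1 h2 h3 h4
  have h0 : h.HasGrad (fun _ => 0) (fun _ => 0) :=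
    ⟨memLp_const 0, memLp_const 0, by
      convert h.closedGraph.zero_mem
      · exact MemLp.toLp_zero _
      · exact MemLp.toLp_zero _⟩
  have hzero : ∀ t : ℝ, ∫ s in (0 : ℝ)..t, ({0} : Set ℝ).indicator (fun _ => (1 : ℝ)) s = 0 := by
    intro t
    refine intervalIntegral.integral_zero_ae ?_
    have : ∀ᵐ s : ℝ, s ≠ 0 := Measure.ae_ne volume 0
    filter_upwards [this] with s hs _
    exact indicator_of_notMem (by simpa using hs) _
  simp_rw [hzero] at key
  filter_upwards [key.ae_eq hs h0] with x hx hx0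
  simpa [hx0] using hx

/-- The unit contraction is the primitive of the indicator of `[0, 1]`, so it multiplies the
gradient by a factor at most `1`. -/
theorem markov [IsFiniteMeasure m] (hs : SingleValued h.closedGraph)
    (hch : HasChainRule V D) (u : (graphForm h.closedGraph).dom) (v : Lp ℝ 2 m)
    (hv : ∀ᵐ x ∂m, v x = min (max ((u : Lp ℝ 2 m) x) 0) 1) :
    ∃ hv : v ∈ (graphForm h.closedGraph).dom,
      (graphForm h.closedGraph).form ⟨v, hv⟩ ⟨v, hv⟩ ≤ (graphForm h.closedGraph).form u u := by
  obtain ⟨χ, h1, h2, h3, h4⟩ := exists_bumps_Icc 0 1 one_pos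
  obtain ⟨w, hw⟩ := exists_graph_mem u
  have key := (hasGrad_of_mem_closedGraph hw).comp_primitive hch h1 h2 h3 h4
  simp_rw [integral_indicator_Icc_eq_clamp] at key
  obtain ⟨h5, h6, h7⟩ := key.congr (hv.mono fun x hx => hx.symm) ae_eq_rfl
  rw [Lp.toLp_coeFn] at h7
  refine ⟨mem_graphForm_dom.2 ⟨_, h7⟩, ?_⟩
  rw [graphForm_apply hs h7 h7, graphForm_apply hs hw hw, real_inner_self_eq_norm_sq,
    real_inner_self_eq_norm_sq]
  have : ‖h6.toLp _‖ ≤ ‖w‖ := by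
    refine Lp.norm_le_norm_of_ae_le ?_
    filter_upwards [h6.coeFn_toLp] with x hx
    rw [hx, norm_smul]
    refine mul_le_of_le_one_left (norm_nonneg _) ?_
    by_cases hm : (u : Lp ℝ 2 m) x ∈ Icc (0 : ℝ) 1
    · simp [indicator_of_mem hm]
    · simp [indicator_of_notMem hm]
  gcongr

/-- The local null sets patch together because the topology is second countable. -/
theorem ae_eq_zero_of_notMem_essSupport [TopologicalSpace E] [SecondCountableTopology E]
    (u : Lp ℝ 2 m) : ∀ᵐ x ∂m, x ∉ essSupport u → u x = 0 := by
  have : m {x | x ∉ essSupport u ∧ u x ≠ 0} = 0 := by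
    refine measure_null_of_locally_null _ fun x hx => ?_
    have hx1 := hx.1
    simp only [essSupport, mem_ofPred_eq, not_forall, not_not] at hx1
    obtain ⟨U, hU, hxU, hae⟩ := hx1
    refine ⟨U ∩ {x | x ∉ essSupport u ∧ u x ≠ 0},
      inter_mem (mem_nhdsWithin_of_mem_nhds (hU.mem_nhds hxU)) self_mem_nhdsWithin, ?_⟩
    refine measure_mono_null (fun y hy => ?_) (ae_iff.1 hae)
    simp only [mem_ofPred_eq, Classical.not_imp]
    exact ⟨hy.1, hy.2.2⟩
  rw [ae_iff]
  convert this using 3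
  simp

/-- At almost every point one of the two functions vanishes, and then so does its gradient. -/
theorem isLocalForm [IsFiniteMeasure m] [TopologicalSpace E] [SecondCountableTopology E]
    (hs : SingleValued h.closedGraph) (hch : HasChainRule V D) :
    IsLocalForm (graphForm h.closedGraph) := by
  intro u v hd
  obtain ⟨w, hw⟩ := exists_graph_mem u
  obtain ⟨w', hw'⟩ := exists_graph_mem v
  rw [graphForm_apply hs hw hw', L2.inner_def]
  have hz : ∀ᵐ x ∂m, ⟪w x, w' x⟫ = 0 := by
    filter_upwards [(hasGrad_of_mem_closedGraph hw).ae_eq_zero_of_eq_zero hs hch,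
      (hasGrad_of_mem_closedGraph hw').ae_eq_zero_of_eq_zero hs hch,
      ae_eq_zero_of_notMem_essSupport (u : Lp ℝ 2 m),
      ae_eq_zero_of_notMem_essSupport (v : Lp ℝ 2 m)] with x h1 h2 h3 h4
    by_cases hx : x ∈ essSupport (u : Lp ℝ 2 m)
    · rw [h2 (h4 (Set.disjoint_left.1 hd hx)), inner_zero_right]
    · rw [h1 (h3 hx), inner_zero_left]
  rw [integral_congr_ae hz]
  simp

theorem isNest_univ [TopologicalSpace E] (Q : SymmForm (Lp ℝ 2 m)) :
    IsNest Q (fun _ => (univ : Set E)) := by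
  refine ⟨fun _ => isClosed_univ, monotone_const, fun u ε hε => ⟨u, ⟨0, by simp⟩, ?_⟩⟩
  simpa [SymmForm.energyOne] using hε

/-- Density of `S` for `𝓔₁` needs checking only on elements of `V`: the closure of `S` then contains
the graph, hence the closed graph. -/
theorem exists_energyOne_lt (hs : SingleValued h.closedGraph) {S : Set (Lp ℝ 2 m × Lp G 2 m)}
    (hS : S ⊆ h.closedGraph) (hd : ∀ f (hf : f ∈ V),
      ((h.memLp f hf).toLp f, (h.memLp_grad f hf).toLp (D f)) ∈ closure S)
    (u : (graphForm h.closedGraph).dom) {ε : ℝ} (hε : 0 < ε) :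
    ∃ w : (graphForm h.closedGraph).dom, (∃ y, ((w : Lp ℝ 2 m), y) ∈ S) ∧
      (graphForm h.closedGraph).energyOne (u - w) < ε := by
  obtain ⟨y, hy⟩ := exists_graph_mem u
  have hcl : ((u : Lp ℝ 2 m), y) ∈ closure S := by
    have hsub : (h.graph : Set (Lp ℝ 2 m × Lp G 2 m)) ⊆ closure S := by
      rintro ⟨p, q⟩ ⟨f, hf, h1, h2⟩
      have := hd f hf
      convert this
      · exact Lp.ext (h1.trans (h.memLp f hf).coeFn_toLp.symm)
      · exact Lp.ext (h2.trans (h.memLp_grad f hf).coeFn_toLp.symm)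
    have := closure_minimal hsub isClosed_closure
    rw [← Submodule.topologicalClosure_coe] at this
    exact this hy
  -- The product carries the maximum distance, so both squared components are below `ε / 2`, and `½
  -- · ε/2 + ε/2 < ε`.
  obtain ⟨⟨p, q⟩, hpq, hdist⟩ := Metric.mem_closure_iff.1 hcl (√(ε / 2)) (by positivity)
  have hmem := hS hpq
  refine ⟨⟨p, mem_graphForm_dom.2 ⟨q, hmem⟩⟩, ⟨q, hpq⟩, ?_⟩
  rw [graphForm_energyOne hs (w := y - q)
    (by exact h.closedGraph.sub_mem hy hmem)]
  rw [Prod.dist_eq, max_lt_iff, dist_eq_norm, dist_eq_norm] at hdist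
  have hsq : ∀ a : ℝ, 0 ≤ a → a < √(ε / 2) → a ^ 2 < ε / 2 := fun a ha hlt => by
    have := pow_lt_pow_left₀ hlt ha two_ne_zero
    rwa [Real.sq_sqrt (by positivity)] at this
  have h1 := hsq _ (norm_nonneg _) hdist.1
  have h2 := hsq _ (norm_nonneg _) hdist.2
  have h3 : ‖((u - ⟨p, mem_graphForm_dom.2 ⟨q, hmem⟩⟩ : (graphForm h.closedGraph).dom) :
    Lp ℝ 2 m)‖ = ‖(u : Lp ℝ 2 m) - p‖ := rfl
  rw [h3]
  linarith

theorem isNest_of_tendsto [TopologicalSpace E] (hs : SingleValued h.closedGraph) {F : ℕ → Set E}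
    (hF : ∀ k, IsClosed (F k)) (hmono : Monotone F)
    (happ : ∀ f ∈ V, ∃ (w : ℕ → E → ℝ) (g : ℕ → E → G), (∀ n, h.HasGrad (w n) (g n)) ∧
      (∀ n, ∀ᵐ x ∂m, x ∉ F n → w n x = 0) ∧
      Tendsto (fun n => eLpNorm (w n - f) 2 m) atTop (𝓝 0) ∧
      Tendsto (fun n => eLpNorm (g n - D f) 2 m) atTop (𝓝 0)) :
    IsNest (graphForm h.closedGraph) F := by
  refine ⟨hF, hmono, fun u ε hε => ?_⟩
  have hd : ∀ f (hf : f ∈ V), ((h.memLp f hf).toLp f, (h.memLp_grad f hf).toLp (D f)) ∈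
      closure {p | p ∈ h.closedGraph ∧ ∃ k, ∀ᵐ x ∂m, x ∉ F k → p.1 x = 0} := by
    intro f hf
    obtain ⟨w, g, h1, h2, h3, h4⟩ := happ f hf
    choose hw hg hmem using h1
    refine mem_closure_of_tendsto (f := fun n => ((hw n).toLp (w n), (hg n).toLp (g n)))
      (b := atTop) (Tendsto.prodMk_nhds ?_ ?_) (Eventually.of_forall fun n => ⟨hmem n, n, ?_⟩)
    · exact (Lp.tendsto_Lp_iff_tendsto_eLpNorm'' w hw f (h.memLp f hf)).2 h3
    · exact (Lp.tendsto_Lp_iff_tendsto_eLpNorm'' g hg (D f) (h.memLp_grad f hf)).2 h4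
    · filter_upwards [h2 n, (hw n).coeFn_toLp] with x hx hx' hxF
      rw [hx', hx hxF]
  obtain ⟨w, ⟨y, hy⟩, hw⟩ := exists_energyOne_lt hs (fun p hp => hp.1) hd u hε
  exact ⟨w, hy.2, hw⟩

end Basic

section Dense

variable {E G : Type*} [PseudoEMetricSpace E] [MeasurableSpace E] [BorelSpace E] [CompleteSpace E]
  [SecondCountableTopology E] [NormedAddCommGroup G] [InnerProductSpace ℝ G]
  {m : Measure E} [IsFiniteMeasure m] {V : Set (E → ℝ)} {D : (E → ℝ) → E → G}
  {h : IsL2Gradient m V D}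

/-- An element orthogonal to the domain integrates to zero against every function of `V`. -/
theorem dense_dom (hV : IsSeparatingAlgebra V) :
    Dense ((graphForm h.closedGraph).dom : Set (Lp ℝ 2 m)) := by
  rw [Submodule.dense_iff_topologicalClosure_eq_top, Submodule.topologicalClosure_eq_top_iff,
    Submodule.eq_bot_iff]
  intro u hu
  have : ⇑u =ᵐ[m] 0 := by
    refine hV.ae_eq_zero (Lp.memLp u) fun f hf => ?_
    have := hu _ (mem_graphForm_dom.2 ⟨_, h.toLp_mem_closedGraph hf⟩)
    rw [L2.inner_def] at this
    rw [← this]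
    refine integral_congr_ae ?_
    filter_upwards [(h.memLp f hf).coeFn_toLp] with x hx
    rw [hx]
    rfl
  exact Lp.ext (this.trans (Lp.coeFn_zero _ _ _).symm)

theorem isDirichletForm [CompleteSpace G] (hV : IsSeparatingAlgebra V)
    (hs : SingleValued h.closedGraph) (hch : HasChainRule V D) :
    IsDirichletForm (graphForm h.closedGraph) :=
  ⟨graphForm_isClosedForm hs h.isClosed_closedGraph (dense_dom hV), fun u v hv =>
    markov hs hch u v hv⟩

end Dense

end IsL2Gradient

end DirichletForms

/-! ### The sine basis of `L²(0, 1)` -/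

namespace BridgeForm

instance instSecondCountableTopologyH : SecondCountableTopology H := by
  have : DenseRange (ContinuousMap.toLp 2 (volume : Measure I) ℝ : C(I, ℝ) → H) :=
    ContinuousMap.toLp_denseRange ℝ volume ℝ (by simp)
  have := this.separableSpace (ContinuousMap.toLp 2 (volume : Measure I) ℝ).continuous
  exact UniformSpace.secondCountable_of_separable H

/-- The element of `H` defined by a continuous function. -/
noncomputable abbrev ofC : C(I, ℝ) →L[ℝ] H := ContinuousMap.toLp 2 volume ℝ

theorem coeFn_ofC (f : C(I, ℝ)) : ⇑(ofC f) =ᵐ[volume] f :=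
  ContinuousMap.coeFn_toLp (p := 2) (𝕜 := ℝ) volume f

theorem denseRange_ofC : DenseRange ofC :=
  ContinuousMap.toLp_denseRange ℝ volume ℝ (by simp)

/-- The function `√2 sin(kπx)`. -/
noncomputable def sinC (k : ℕ) : C(I, ℝ) := ⟨fun x : I => √2 * Real.sin (k * Real.pi * x), by fun_prop⟩

theorem ofC_sinC (k : ℕ) : ofC (sinC k) = e k := rfl

theorem sinC_apply (k : ℕ) (x : I) : sinC k x = √2 * Real.sin (k * Real.pi * x) := rfl

theorem inner_ofC (f g : C(I, ℝ)) : ⟪ofC f, ofC g⟫ = ∫ x : I, f x * g x := by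
  rw [ContinuousMap.inner_toLp]
  simp [mul_comm]

theorem inner_ofC_left (f : C(I, ℝ)) (z : H) : ⟪ofC f, z⟫ = ∫ x : I, f x * z x := by
  rw [L2.inner_def]
  refine integral_congr_ae ?_
  filter_upwards [coeFn_ofC f] with x hx
  rw [hx]
  simp [mul_comm]

theorem integral_I {F : Type*} [NormedAddCommGroup F] [NormedSpace ℝ F] (f : ℝ → F) :
    ∫ x : I, f x = ∫ x in (0 : ℝ)..1, f x := by
  rw [integral_subtype measurableSet_Icc f, integral_Icc_eq_integral_Ioc,
    ← intervalIntegral.integral_of_le zero_le_one]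

theorem integral_cos_int_mul_pi (n : ℤ) (hn : n ≠ 0) :
    ∫ x in (0 : ℝ)..1, Real.cos (n * Real.pi * x) = 0 := by
  have h0 : (n * Real.pi : ℝ) ≠ 0 := mul_ne_zero (by exact_mod_cast hn) Real.pi_ne_zero
  rw [intervalIntegral.integral_comp_mul_left (fun x => Real.cos x) h0, integral_cos]
  simp [Real.sin_int_mul_pi]

theorem inner_e_e (j k : ℕ) : ⟪e (j + 1), e (k + 1)⟫ = if j = k then 1 else 0 := by
  rw [← ofC_sinC, ← ofC_sinC, inner_ofC]
  simp only [sinC_apply]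
  rw [integral_I (fun x => √2 * Real.sin ((j + 1 : ℕ) * Real.pi * x) *
    (√2 * Real.sin ((k + 1 : ℕ) * Real.pi * x)))]
  have h2 : ∀ x : ℝ, √2 * Real.sin ((j + 1 : ℕ) * Real.pi * x) *
      (√2 * Real.sin ((k + 1 : ℕ) * Real.pi * x)) =
      Real.cos (((j - k : ℤ) : ℝ) * Real.pi * x) - Real.cos (((j + k + 2 : ℤ) : ℝ) * Real.pi * x) := by
    intro x
    have e1 : ((j - k : ℤ) : ℝ) * Real.pi * x =
      ((j + 1 : ℕ) : ℝ) * Real.pi * x - ((k + 1 : ℕ) : ℝ) * Real.pi * x := by push_cast; ring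
    have e2 : ((j + k + 2 : ℤ) : ℝ) * Real.pi * x =
      ((j + 1 : ℕ) : ℝ) * Real.pi * x + ((k + 1 : ℕ) : ℝ) * Real.pi * x := by push_cast; ring
    rw [e1, e2, Real.cos_sub, Real.cos_add]
    have := Real.mul_self_sqrt (show (0 : ℝ) ≤ 2 by norm_num)
    linear_combination (Real.sin ((j + 1 : ℕ) * Real.pi * x) *
      Real.sin ((k + 1 : ℕ) * Real.pi * x)) * this
  simp_rw [h2]
  rw [intervalIntegral.integral_sub (Continuous.intervalIntegrable (by fun_prop) _ _)
    (Continuous.intervalIntegrable (by fun_prop) _ _),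
    integral_cos_int_mul_pi (j + k + 2) (by omega), sub_zero]
  split_ifs with h
  · simp [h]
  · exact integral_cos_int_mul_pi _ (by omega)

theorem orthonormal_e : Orthonormal ℝ (fun k : ℕ => e (k + 1)) := by
  rw [orthonormal_iff_ite]
  exact fun j k => inner_e_e j k

/-- The function `cos(πx)`. -/
noncomputable def cosC : C(I, ℝ) := ⟨fun x : I => Real.cos (Real.pi * x), by fun_prop⟩

theorem e_mem_testSpace (k : ℕ) : e (k + 1) ∈ testSpace :=
  Submodule.subset_span ⟨k + 1, by simp, rfl⟩

theorem exists_of_mem_testSpace {l : H} (hl : l ∈ testSpace) : ∃ f : C(I, ℝ), ofC f = l := by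
  have : testSpace ≤ LinearMap.range (ofC : C(I, ℝ) →ₗ[ℝ] H) := by
    rw [testSpace, Submodule.span_le]
    rintro _ ⟨k, -, rfl⟩
    exact ⟨sinC k, rfl⟩
  exact this hl

/-- The span of the sines is stable under multiplication by `cos(πx)`, since `cos(πx) sin(kπx)` is
half the sum of the neighbouring sines; for `k = 1` the lower neighbour `sinC 0` is zero. -/
theorem cosC_mul_mem (g : C(I, ℝ)) (hg : g ∈ Submodule.span ℝ (sinC '' {k | 1 ≤ k})) :
    cosC * g ∈ Submodule.span ℝ (sinC '' {k | 1 ≤ k}) := by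
  have hk : ∀ k, sinC k ∈ Submodule.span ℝ (sinC '' {k | 1 ≤ k}) := by
    intro k
    rcases Nat.eq_zero_or_pos k with rfl | hk
    · convert Submodule.zero_mem _
      ext x
      simp [sinC_apply]
    · exact Submodule.subset_span ⟨k, hk, rfl⟩
  induction hg using Submodule.span_induction with
  | mem g hg =>
    obtain ⟨k, hk1, rfl⟩ := hg
    have : cosC * sinC k = (1 / 2 : ℝ) • (sinC (k + 1) + sinC (k - 1)) := by
      ext x
      have hk1' : 1 ≤ k := hk1
      have e1 : ((k + 1 : ℕ) : ℝ) * Real.pi * x = k * Real.pi * x + Real.pi * x := by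
        push_cast; ring
      have e2 : ((k - 1 : ℕ) : ℝ) * Real.pi * x = k * Real.pi * x - Real.pi * x := by
        push_cast [hk1']; ring
      simp only [ContinuousMap.mul_apply, ContinuousMap.smul_apply, ContinuousMap.add_apply,
        sinC_apply, e1, e2, Real.sin_add, Real.sin_sub, smul_eq_mul, cosC, ContinuousMap.coe_mk]
      ring
    rw [this]
    exact Submodule.smul_mem _ _ (Submodule.add_mem _ (hk _) (hk _))
  | zero => simp
  | add g g' _ _ h h' => rw [mul_add]; exact Submodule.add_mem _ h h'
  | smul c g _ h => rw [mul_smul_comm]; exact Submodule.smul_mem _ _ h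

theorem mul_sinC_mem (g : C(I, ℝ)) (hg : g ∈ Algebra.adjoin ℝ {cosC}) :
    g * sinC 1 ∈ Submodule.span ℝ (sinC '' {k | 1 ≤ k}) := by
  suffices h : ∀ f ∈ Submodule.span ℝ (sinC '' {k | 1 ≤ k}),
      g * f ∈ Submodule.span ℝ (sinC '' {k | 1 ≤ k}) from
    h _ (Submodule.subset_span ⟨1, le_refl 1, rfl⟩)
  induction hg using Algebra.adjoin_induction with
  | mem g hg =>
    rw [mem_singleton_iff.1 hg]
    exact cosC_mul_mem
  | algebraMap r =>
    intro f hf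
    rw [← Algebra.smul_def]
    exact Submodule.smul_mem _ _ hf
  | add g g' _ _ h h' =>
    intro f hf
    rw [add_mul]
    exact Submodule.add_mem _ (h f hf) (h' f hf)
  | mul g g' _ _ h h' =>
    intro f hf
    rw [mul_assoc]
    exact h _ (h' f hf)

/-- As `cos(πx)` is injective on `[0, 1]`, its polynomials are dense in `C(I, ℝ)`, and their
products with `sin(πx)` stay in the span of the sines. So `z sin(πx)` is orthogonal to all
continuous functions, and `sin(πx)` vanishes only at the endpoints. -/
theorem eq_zero_of_inner_e (z : H) (hz : ∀ k : ℕ, ⟪e (k + 1), z⟫ = 0) : z = 0 := by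
  have h1 : ∀ f ∈ Submodule.span ℝ (sinC '' {k | 1 ≤ k}), ⟪ofC f, z⟫ = 0 := by
    intro f hf
    induction hf using Submodule.span_induction with
    | mem f hf =>
      obtain ⟨k, hk, rfl⟩ := hf
      obtain ⟨k, rfl⟩ := Nat.exists_eq_add_of_le' (show 1 ≤ k from hk)
      exact hz k
    | zero => simp
    | add f g _ _ h h' => rw [map_add, inner_add_left, h, h', add_zero]
    | smul c f _ h => rw [map_smul, inner_smul_left, h, mul_zero]
  have hdense : Dense (Algebra.adjoin ℝ {cosC} : Set C(I, ℝ)) := by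
    have hsep : (Algebra.adjoin ℝ {cosC}).SeparatesPoints := by
      intro x y hxy
      refine ⟨_, ⟨cosC, Algebra.subset_adjoin rfl, rfl⟩, fun h => hxy ?_⟩
      have hmem : ∀ x : I, Real.pi * x ∈ Icc 0 Real.pi := fun x =>
        ⟨mul_nonneg Real.pi_pos.le x.2.1, mul_le_of_le_one_right Real.pi_pos.le x.2.2⟩
      have := Real.injOn_cos (hmem x) (hmem y) h
      exact Subtype.ext (mul_left_cancel₀ Real.pi_ne_zero this)
    have := ContinuousMap.subalgebra_topologicalClosure_eq_top_of_separatesPoints _ hsep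
    rw [dense_iff_closure_eq, ← Subalgebra.topologicalClosure_coe, this]
    rfl
  have h2 : ∀ g : C(I, ℝ), ⟪ofC (g * sinC 1), z⟫ = 0 := by
    have hcl : IsClosed {g : C(I, ℝ) | ⟪ofC (g * sinC 1), z⟫ = 0} :=
      isClosed_eq (by fun_prop) continuous_const
    intro g
    exact hcl.closure_subset_iff.2 (fun g hg => h1 _ (mul_sinC_mem g hg)) (hdense g)
  have hm : MemLp (fun x : I => sinC 1 x * z x) 2 volume := by
    refine (Lp.memLp z).of_le_mul (c := ‖sinC 1‖)
      ((sinC 1).continuous.aestronglyMeasurable.mul (Lp.aestronglyMeasurable z))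
      (Eventually.of_forall fun x => ?_)
    rw [norm_mul]
    gcongr
    exact (sinC 1).norm_coe_le_norm x
  have h3 : hm.toLp _ = 0 := by
    refine denseRange_ofC.eq_zero_of_inner_right ℝ ?_
    intro g
    rw [inner_ofC_left, ← h2 g, inner_ofC_left]
    refine integral_congr_ae ?_
    filter_upwards [hm.coeFn_toLp] with x hx
    rw [hx, ContinuousMap.mul_apply, mul_assoc]
  have h4 : (fun x : I => sinC 1 x * z x) =ᵐ[volume] 0 :=
    hm.coeFn_toLp.symm.trans (by rw [h3]; exact Lp.coeFn_zero _ _ _)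
  refine Lp.ext ?_
  filter_upwards [h4, Lp.coeFn_zero ℝ 2 (volume : Measure I), Measure.ae_ne volume (0 : I),
    Measure.ae_ne volume (1 : I)] with x hx h0 hx0 hx1
  rw [h0]
  refine (mul_eq_zero.1 hx).resolve_left ?_
  rw [sinC_apply]
  refine mul_ne_zero (by simp) (Real.sin_pos_of_pos_of_lt_pi ?_ ?_).ne'
  · have : 0 < (x : ℝ) := lt_of_le_of_ne x.2.1 fun h => hx0 (Subtype.ext h.symm)
    simp only [Nat.cast_one, one_mul]
    positivity
  · have : (x : ℝ) < 1 := lt_of_le_of_ne x.2.2 fun h => hx1 (Subtype.ext h)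
    simp only [Nat.cast_one, one_mul]
    exact mul_lt_of_lt_one_right Real.pi_pos this

/-- The Hilbert basis `e_1, e_2, …` of `H`. -/
noncomputable def sineBasis : HilbertBasis ℕ ℝ H :=
  HilbertBasis.mk orthonormal_e (by
    rw [top_le_iff, Submodule.topologicalClosure_eq_top_iff, Submodule.eq_bot_iff]
    intro z hz
    exact eq_zero_of_inner_e z fun k => hz _ (Submodule.subset_span ⟨k, rfl⟩))

theorem sineBasis_apply (k : ℕ) : sineBasis k = e (k + 1) := by
  simp [sineBasis]

end BridgeForm

/-! ### Cylindrical functions and their gradients -/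

namespace BridgeForm

open DirichletForms

section GradVec

variable {ι : Type*} [Fintype ι] [DecidableEq ι]

/-- The vector `∑ ∂ᵢψ(y) vᵢ`. -/
noncomputable def gradVec (ψ : (ι → ℝ) → ℝ) (y : ι → ℝ) (v : ι → H) : H :=
  ∑ i, fderiv ℝ ψ y (Pi.single i 1) • v i

theorem inner_gradVec (ψ : (ι → ℝ) → ℝ) (y : ι → ℝ) (v : ι → H) (h : H) :
    ⟪gradVec ψ y v, h⟫ = fderiv ℝ ψ y (fun i => ⟪v i, h⟫) := by
  rw [gradVec, sum_inner, ← ContinuousLinearMap.coe_coe (fderiv ℝ ψ y),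
    LinearMap.pi_apply_eq_sum_univ (fderiv ℝ ψ y : (ι → ℝ) →ₗ[ℝ] ℝ)]
  refine Finset.sum_congr rfl fun i _ => ?_
  rw [real_inner_smul_left, smul_eq_mul, mul_comm]
  congr 2
  ext j
  simp [Pi.single_apply, eq_comm]

theorem hasGradientAt_comp {ψ : (ι → ℝ) → ℝ} {Y : ι → H → ℝ} {v : ι → H} {z : H}
    (hψ : DifferentiableAt ℝ ψ (fun i => Y i z)) (hY : ∀ i, HasGradientAt (Y i) (v i) z) :
    HasGradientAt (fun z => ψ (fun i => Y i z)) (gradVec ψ (fun i => Y i z) v) z := by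
  rw [hasGradientAt_iff_hasFDerivAt]
  have h1 : HasFDerivAt (fun z i => Y i z)
      (ContinuousLinearMap.pi fun i => InnerProductSpace.toDual ℝ H (v i)) z :=
    hasFDerivAt_pi.2 fun i => (hY i).hasFDerivAt
  refine (hψ.hasFDerivAt.comp z h1).congr_fderiv ?_
  ext h
  rw [InnerProductSpace.toDual_apply_apply, inner_gradVec, ContinuousLinearMap.comp_apply]
  rfl

theorem hasGradientAt_inner (l z : H) : HasGradientAt (fun z => ⟪l, z⟫) l z := by
  rw [hasGradientAt_iff_hasFDerivAt]
  exact (innerSL ℝ l).hasFDerivAt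

theorem norm_gradVec_le {ψ : (ι → ℝ) → ℝ} {C : ℝ} (hC : ∀ y, ‖fderiv ℝ ψ y‖ ≤ C) (y : ι → ℝ)
    (v : ι → H) : ‖gradVec ψ y v‖ ≤ ∑ i, C * ‖v i‖ := by
  refine (norm_sum_le _ _).trans (Finset.sum_le_sum fun i _ => ?_)
  rw [norm_smul]
  gcongr
  refine ((fderiv ℝ ψ y).le_opNorm _).trans ?_
  have : ‖(Pi.single i 1 : ι → ℝ)‖ = 1 := by
    rw [Pi.norm_single]
    simp
  rw [this, mul_one]
  exact hC y

theorem tendsto_gradVec {ψ : (ι → ℝ) → ℝ} (hψ : Continuous (fderiv ℝ ψ)) {y : ℕ → ι → ℝ}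
    {y₀ : ι → ℝ} {v : ℕ → ι → H} {v₀ : ι → H} (hy : ∀ i, Tendsto (fun n => y n i) atTop (𝓝 (y₀ i)))
    (hv : ∀ i, Tendsto (fun n => v n i) atTop (𝓝 (v₀ i))) :
    Tendsto (fun n => gradVec ψ (y n) (v n)) atTop (𝓝 (gradVec ψ y₀ v₀)) := by
  refine tendsto_finsetSum _ fun i _ => Tendsto.smul ?_ (hv i)
  have h1 : Tendsto y atTop (𝓝 y₀) := tendsto_pi_nhds.2 hy
  exact ((hψ.clm_apply continuous_const).tendsto y₀).comp h1

end GradVec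

section CylindricalH

theorem mem_cylindricalH_iff {F : H → ℝ} : F ∈ cylindricalH ↔
    ∃ (m : ℕ) (ψ : (Fin m → ℝ) → ℝ) (l : Fin m → H), BddSmooth ψ ∧ (∀ i, l i ∈ testSpace) ∧
      F = fun z => ψ (fun i => ⟪l i, z⟫) :=
  ⟨fun ⟨m, ψ, l, h1, h2, h3, h4⟩ => ⟨m, ψ, l, ⟨h1, h2⟩, h3, funext h4⟩,
    fun ⟨m, ψ, l, h1, h2, h3⟩ => ⟨m, ψ, l, h1.1, h1.2, h2, fun z => congrFun h3 z⟩⟩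

theorem _root_.DirichletForms.BddSmooth.reindex {ι κ Y : Type*} [Fintype ι] [Fintype κ]
    [NormedAddCommGroup Y] [NormedSpace ℝ Y] {ψ : (ι → ℝ) → Y} (hψ : BddSmooth ψ) (s : ι → κ) :
    BddSmooth (fun y : κ → ℝ => ψ (fun i => y (s i))) :=
  hψ.comp_clm (ContinuousLinearMap.pi fun i =>
    ContinuousLinearMap.proj (R := ℝ) (φ := fun _ : κ => ℝ) (s i))

theorem mem_cylindricalH_of_fintype {ι : Type*} [Fintype ι] {ψ : (ι → ℝ) → ℝ} {l : ι → H}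
    (hψ : BddSmooth ψ) (hl : ∀ i, l i ∈ testSpace) :
    (fun z => ψ (fun i => ⟪l i, z⟫)) ∈ cylindricalH := by
  have e := Fintype.equivFin ι
  refine mem_cylindricalH_iff.2 ⟨_, _, fun i => l (e.symm i),
    hψ.reindex e,
    fun i => hl _, ?_⟩
  ext z
  congr 1
  ext i
  simp

/-- Both functions are viewed as functions of the joint family of variables, indexed by `Fin m ⊕ Fin
m'`. For this reason `hop` is required on every space `W`. -/
theorem op_mem_cylindricalH {op : ℝ → ℝ → ℝ}
    (hop : ∀ {W : Type} [NormedAddCommGroup W] [NormedSpace ℝ W] {f g : W → ℝ}, BddSmooth f →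
      BddSmooth g → BddSmooth (fun x => op (f x) (g x)))
    {F G : H → ℝ} (hF : F ∈ cylindricalH) (hG : G ∈ cylindricalH) :
    (fun z => op (F z) (G z)) ∈ cylindricalH := by
  obtain ⟨m, ψ, l, hψ, hl, rfl⟩ := mem_cylindricalH_iff.1 hF
  obtain ⟨m', ψ', l', hψ', hl', rfl⟩ := mem_cylindricalH_iff.1 hG
  have h1 : BddSmooth (fun y : Fin m ⊕ Fin m' → ℝ => ψ (fun i => y (Sum.inl i))) :=
    hψ.reindex Sum.inl
  have h2 : BddSmooth (fun y : Fin m ⊕ Fin m' → ℝ => ψ' (fun i => y (Sum.inr i))) :=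
    hψ'.reindex Sum.inr
  exact mem_cylindricalH_of_fintype (hop h1 h2) (l := Sum.elim l l')
    (by rintro (i | i); exacts [hl i, hl' i])

theorem add_mem_cylindricalH {F G : H → ℝ} (hF : F ∈ cylindricalH) (hG : G ∈ cylindricalH) :
    F + G ∈ cylindricalH :=
  op_mem_cylindricalH (op := fun a b => a + b) (fun hf hg => hf.add hg) hF hG

theorem mul_mem_cylindricalH {F G : H → ℝ} (hF : F ∈ cylindricalH) (hG : G ∈ cylindricalH) :
    F * G ∈ cylindricalH :=
  op_mem_cylindricalH (op := fun a b => a * b) (fun hf hg => hf.mul hg) hF hG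

theorem const_mem_cylindricalH (c : ℝ) : (fun _ => c) ∈ cylindricalH :=
  mem_cylindricalH_of_fintype (ι := Fin 0) (ψ := fun _ => c) (l := 0) (bddSmooth_const c)
    (fun _ => Fin.elim0 ‹_›)

theorem comp_mem_cylindricalH {φ : ℝ → ℝ} (hφ : BddSmooth φ) {F : H → ℝ}
    (hF : F ∈ cylindricalH) : φ ∘ F ∈ cylindricalH := by
  obtain ⟨m, ψ, l, hψ, hl, rfl⟩ := mem_cylindricalH_iff.1 hF
  exact mem_cylindricalH_of_fintype (hφ.comp hψ) hl

theorem comp_inner_mem_cylindricalH {φ : ℝ → ℝ} (hφ : BddSmooth φ) {l : H}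
    (hl : l ∈ testSpace) : (fun z => φ ⟪l, z⟫) ∈ cylindricalH :=
  mem_cylindricalH_of_fintype (ι := Unit) (ψ := fun y => φ (y ())) (l := fun _ => l)
    (hφ.comp_clm (ContinuousLinearMap.proj (R := ℝ) (φ := fun _ : Unit => ℝ) ())) (fun _ => hl)

theorem gradient_cylindrical {ι : Type*} [Fintype ι] [DecidableEq ι] {ψ : (ι → ℝ) → ℝ}
    {l : ι → H} (hψ : BddSmooth ψ) (z : H) :
    gradient (fun z => ψ (fun i => ⟪l i, z⟫)) z = gradVec ψ (fun i => ⟪l i, z⟫) l :=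
  (hasGradientAt_comp (hψ.differentiable _) fun _ => hasGradientAt_inner _ _).gradient

theorem continuous_of_mem_cylindricalH {F : H → ℝ} (hF : F ∈ cylindricalH) : Continuous F :=
  (differentiable_of_mem_cylindricalH hF).continuous

theorem bounded_of_mem_cylindricalH {F : H → ℝ} (hF : F ∈ cylindricalH) :
    ∃ C, 0 ≤ C ∧ ∀ z, ‖F z‖ ≤ C := by
  obtain ⟨m, ψ, l, hψ, hl, rfl⟩ := mem_cylindricalH_iff.1 hF
  obtain ⟨C, hC0, hC⟩ := hψ.bound
  exact ⟨C, hC0, fun z => hC _⟩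

theorem continuous_gradient {F : H → ℝ} (hF : F ∈ cylindricalH) : Continuous (gradient F) := by
  obtain ⟨m, ψ, l, hψ, hl, rfl⟩ := mem_cylindricalH_iff.1 hF
  have : gradient (fun z => ψ (fun i => ⟪l i, z⟫)) =
      fun z => gradVec ψ (fun i => ⟪l i, z⟫) l := funext fun z => gradient_cylindrical hψ z
  rw [this]
  unfold gradVec
  have h1 := hψ.continuous_fderiv
  fun_prop

theorem bounded_gradient {F : H → ℝ} (hF : F ∈ cylindricalH) :
    ∃ C, 0 ≤ C ∧ ∀ z, ‖gradient F z‖ ≤ C := by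
  obtain ⟨m, ψ, l, hψ, hl, rfl⟩ := mem_cylindricalH_iff.1 hF
  obtain ⟨C, hC0, hC⟩ := hψ.bound_fderiv
  refine ⟨∑ i, C * ‖l i‖, Finset.sum_nonneg fun _ _ => by positivity, fun z => ?_⟩
  rw [gradient_cylindrical hψ]
  exact norm_gradVec_le hC _ _

theorem gradient_add {F G : H → ℝ} {z : H} (hF : DifferentiableAt ℝ F z)
    (hG : DifferentiableAt ℝ G z) : gradient (F + G) z = gradient F z + gradient G z := by
  simp only [gradient]
  rw [fderiv_add hF hG, map_add]

theorem gradient_const_smul {F : H → ℝ} {z : H} (hF : DifferentiableAt ℝ F z) (c : ℝ) :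
    gradient (c • F) z = c • gradient F z := by
  simp only [gradient]
  rw [fderiv_const_smul hF, map_smulₛₗ]
  simp

theorem gradient_mul {F G : H → ℝ} {z : H} (hF : DifferentiableAt ℝ F z)
    (hG : DifferentiableAt ℝ G z) :
    gradient (F * G) z = F z • gradient G z + G z • gradient F z := by
  simp only [gradient]
  rw [fderiv_mul hF hG, map_add, map_smulₛₗ, map_smulₛₗ]
  simp

theorem gradient_real_comp {F : H → ℝ} {z : H} {φ : ℝ → ℝ} (hφ : DifferentiableAt ℝ φ (F z))
    (hF : DifferentiableAt ℝ F z) : gradient (φ ∘ F) z = deriv φ (F z) • gradient F z := by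
  simp only [gradient]
  have : fderiv ℝ (φ ∘ F) z = deriv φ (F z) • fderiv ℝ F z :=
    (hφ.hasDerivAt.comp_hasFDerivAt z hF.hasFDerivAt).fderiv
  rw [this, map_smulₛₗ]
  simp

/-- For large `n` both arguments lie in `[-π/2, π/2]`, where the sine is injective. Rescaled sines
thus separate points while being bounded with all their derivatives. -/
theorem sin_div_eq {a b : ℝ} (h : ∀ n : ℕ, Real.sin (((n : ℝ) + 1)⁻¹ * a) =
    Real.sin (((n : ℝ) + 1)⁻¹ * b)) : a = b := by
  have hlim : ∀ c : ℝ, Tendsto (fun n : ℕ => ((n : ℝ) + 1)⁻¹ * c) atTop (𝓝 0) := fun c => by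
    have : Tendsto (fun n : ℕ => ((n : ℝ) + 1)⁻¹) atTop (𝓝 0) := by
      simpa only [one_div] using tendsto_one_div_add_atTop_nhds_zero_nat (𝕜 := ℝ)
    simpa using this.mul_const c
  have hmem : Icc (-(Real.pi / 2)) (Real.pi / 2) ∈ 𝓝 (0 : ℝ) :=
    Icc_mem_nhds (by linarith [Real.pi_pos]) (by linarith [Real.pi_pos])
  obtain ⟨n, ha, hb⟩ := (((hlim a).eventually_mem hmem).and ((hlim b).eventually_mem hmem)).exists
  exact mul_left_cancel₀ (by positivity) (Real.injOn_sin ha hb (h n))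

theorem exists_sin_ne {y z : H} (hyz : y ≠ z) : ∃ k n : ℕ,
    Real.sin (((n : ℝ) + 1)⁻¹ * ⟪e (k + 1), y⟫) ≠ Real.sin (((n : ℝ) + 1)⁻¹ * ⟪e (k + 1), z⟫) := by
  by_contra! hcon
  refine hyz (sub_eq_zero.1 (eq_zero_of_inner_e _ fun k => ?_))
  rw [inner_sub_right, sub_eq_zero]
  exact sin_div_eq (hcon k)

theorem sin_mem_cylindricalH (k n : ℕ) :
    (fun z => Real.sin (((n : ℝ) + 1)⁻¹ * ⟪e (k + 1), z⟫)) ∈ cylindricalH :=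
  comp_inner_mem_cylindricalH (φ := fun t => Real.sin (((n : ℝ) + 1)⁻¹ * t))
    (bddSmooth_sin.comp_clm (((n : ℝ) + 1)⁻¹ • ContinuousLinearMap.id ℝ ℝ)) (e_mem_testSpace k)

theorem isSeparatingAlgebra_cylindricalH : IsSeparatingAlgebra cylindricalH where
  continuous _ hF := continuous_of_mem_cylindricalH hF
  bounded _ hF := let ⟨C, _, hC⟩ := bounded_of_mem_cylindricalH hF; ⟨C, hC⟩
  const_mem := const_mem_cylindricalH
  add_mem _ hF _ hG := add_mem_cylindricalH hF hG
  mul_mem _ hF _ hG := mul_mem_cylindricalH hF hG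
  separates _ _ hyz :=
    let ⟨k, n, h⟩ := exists_sin_ne hyz
    ⟨_, sin_mem_cylindricalH k n, h⟩

theorem isL2Gradient_H (μ : Measure H) [IsFiniteMeasure μ] :
    IsL2Gradient μ cylindricalH gradient where
  memLp F hF := by
    obtain ⟨C, -, hC⟩ := bounded_of_mem_cylindricalH hF
    exact MemLp.of_bound (continuous_of_mem_cylindricalH hF).aestronglyMeasurable C
      (Eventually.of_forall hC)
  memLp_grad F hF := by
    obtain ⟨C, -, hC⟩ := bounded_gradient hF
    exact MemLp.of_bound (continuous_gradient hF).aestronglyMeasurable C (Eventually.of_forall hC)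
  zero_mem := const_mem_cylindricalH 0
  add_mem _ hF _ hG := add_mem_cylindricalH hF hG
  smul_mem c F hF := isSeparatingAlgebra_cylindricalH.smul_mem c F hF
  grad_add F hF G hG := funext fun z => gradient_add (differentiable_of_mem_cylindricalH hF z)
    (differentiable_of_mem_cylindricalH hG z)
  grad_smul c F hF := funext fun z =>
    gradient_const_smul (differentiable_of_mem_cylindricalH hF z) c

end CylindricalH

/-! ### Cylindrical functions on the cone -/

section CylindricalK

theorem isClosed_cone : IsClosed cone := by
  have : cone = {z : H | |z| = z} := by
    ext z
    constructor
    · intro h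
      refine Lp.ext ?_
      filter_upwards [Lp.coeFn_abs z, show ∀ᵐ x ∂(volume : Measure I), 0 ≤ z x from h]
        with x hx hx'
      rw [hx, abs_of_nonneg hx']
    · intro h
      change ∀ᵐ x ∂(volume : Measure I), 0 ≤ z x
      filter_upwards [Lp.coeFn_abs z] with x hx
      rw [show |z| = z from h] at hx
      rw [hx]
      exact abs_nonneg _
  rw [this]
  exact isClosed_eq (continuous_id.sup continuous_neg) continuous_id

instance instCompleteSpaceK : CompleteSpace K := isClosed_cone.completeSpace_coe

theorem restrict_mem_cylindricalK {F : H → ℝ} (hF : F ∈ cylindricalH) :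
    (fun z : K => F z) ∈ cylindricalK :=
  ⟨F, hF, fun _ => rfl⟩

theorem isSeparatingAlgebra_cylindricalK : IsSeparatingAlgebra cylindricalK where
  continuous := by
    rintro f ⟨F, hF, h⟩
    rw [funext h]
    exact (continuous_of_mem_cylindricalH hF).comp continuous_subtype_val
  bounded := by
    rintro f ⟨F, hF, h⟩
    obtain ⟨C, -, hC⟩ := bounded_of_mem_cylindricalH hF
    exact ⟨C, fun z => by rw [h]; exact hC z⟩
  const_mem c := restrict_mem_cylindricalK (const_mem_cylindricalH c)
  add_mem := by
    rintro f ⟨F, hF, h⟩ g ⟨G, hG, h'⟩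
    exact ⟨F + G, add_mem_cylindricalH hF hG, fun z => by simp [h, h']⟩
  mul_mem := by
    rintro f ⟨F, hF, h⟩ g ⟨G, hG, h'⟩
    exact ⟨F * G, mul_mem_cylindricalH hF hG, fun z => by simp [h, h']⟩
  separates y z hyz := by
    obtain ⟨k, n, h⟩ := exists_sin_ne (Subtype.coe_injective.ne hyz)
    exact ⟨_, restrict_mem_cylindricalK (sin_mem_cylindricalH k n), h⟩

theorem continuous_gradK {f : K → ℝ} (hf : f ∈ cylindricalK) : Continuous (gradK f) := by
  obtain ⟨F, hF, h⟩ := hf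
  rw [funext (gradK_eq_gradient hF h)]
  exact (continuous_gradient hF).comp continuous_subtype_val

theorem bounded_gradK {f : K → ℝ} (hf : f ∈ cylindricalK) : ∃ C, 0 ≤ C ∧ ∀ z, ‖gradK f z‖ ≤ C := by
  obtain ⟨F, hF, h⟩ := hf
  obtain ⟨C, hC0, hC⟩ := bounded_gradient hF
  exact ⟨C, hC0, fun z => by rw [gradK_eq_gradient hF h]; exact hC _⟩

theorem isL2Gradient_K (ν : Measure K) [IsFiniteMeasure ν] :
    IsL2Gradient ν cylindricalK gradK where
  memLp f hf := by
    obtain ⟨C, hC⟩ := isSeparatingAlgebra_cylindricalK.bounded f hf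
    exact MemLp.of_bound (isSeparatingAlgebra_cylindricalK.continuous f hf).aestronglyMeasurable C
      (Eventually.of_forall hC)
  memLp_grad f hf := by
    obtain ⟨C, -, hC⟩ := bounded_gradK hf
    exact MemLp.of_bound (continuous_gradK hf).aestronglyMeasurable C (Eventually.of_forall hC)
  zero_mem := isSeparatingAlgebra_cylindricalK.const_mem 0
  add_mem := isSeparatingAlgebra_cylindricalK.add_mem
  smul_mem := isSeparatingAlgebra_cylindricalK.smul_mem
  grad_add := by
    rintro f ⟨F, hF, h⟩ g ⟨G, hG, h'⟩
    ext1 z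
    rw [Pi.add_apply, gradK_eq_gradient hF h, gradK_eq_gradient hG h',
      gradK_eq_gradient (add_mem_cylindricalH hF hG) (fun z => by simp [h, h']),
      gradient_add (differentiable_of_mem_cylindricalH hF z)
        (differentiable_of_mem_cylindricalH hG z)]
  grad_smul := by
    rintro c f ⟨F, hF, h⟩
    ext1 z
    rw [Pi.smul_apply, gradK_eq_gradient hF h,
      gradK_eq_gradient (isSeparatingAlgebra_cylindricalH.smul_mem c F hF) (fun z => by simp [h]),
      gradient_const_smul (differentiable_of_mem_cylindricalH hF z)]

theorem hasChainRule_K : IsL2Gradient.HasChainRule cylindricalK gradK := by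
  rintro φ hφ f ⟨F, hF, h⟩
  have hφF := comp_mem_cylindricalH hφ hF
  have h' : ∀ z : K, (φ ∘ f) z = (φ ∘ F) z := fun z => by simp [h]
  refine ⟨⟨_, hφF, h'⟩, fun z => ?_⟩
  rw [gradK_eq_gradient hφF h', gradK_eq_gradient hF h, h,
    gradient_real_comp (hφ.differentiable _) (differentiable_of_mem_cylindricalH hF z)]

end CylindricalK

end BridgeForm

/-! ### Quadrature on the unit interval -/

namespace BridgeForm

open DirichletForms

section Quadrature

variable {F : Type*} [NormedAddCommGroup F] [NormedSpace ℝ F]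

/-- The weights of the quadrature rule exact for Bernstein approximations. -/
noncomputable def weight (n : ℕ) (k : Fin (n + 1)) : ℝ := ∫ x : I, bernstein n k x

theorem integrable_ofC {F : Type*} [NormedAddCommGroup F] (f : C(I, F)) : Integrable f (volume : Measure I) :=
  f.continuous.integrable_of_hasCompactSupport (HasCompactSupport.of_compactSpace f)

theorem weight_nonneg (n : ℕ) (k : Fin (n + 1)) : 0 ≤ weight n k :=
  integral_nonneg fun _ => bernstein_nonneg

theorem sum_weight (n : ℕ) : ∑ k, weight n k = 1 := by
  unfold weight
  rw [← integral_finsetSum _ fun (k : Fin (n + 1)) _ => integrable_ofC (bernstein n k)]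
  simp [bernstein.probability]

/-- The quadrature rule `∑ w_k f(k/n)`. -/
noncomputable def quad (n : ℕ) (f : C(I, F)) : F := ∑ k : Fin (n + 1), weight n k • f (bernstein.z k)

theorem norm_quad_le (n : ℕ) (f : C(I, F)) : ‖quad n f‖ ≤ ‖f‖ := by
  calc ‖quad n f‖ ≤ ∑ k : Fin (n + 1), weight n k * ‖f‖ := by
        refine (norm_sum_le _ _).trans (Finset.sum_le_sum fun k _ => ?_)
        rw [norm_smul, Real.norm_of_nonneg (weight_nonneg n k)]
        exact mul_le_mul_of_nonneg_left (f.norm_coe_le_norm _) (weight_nonneg n k)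
    _ = ‖f‖ := by rw [← Finset.sum_mul, sum_weight, one_mul]

theorem norm_quad_le_of_forall {n : ℕ} {f : C(I, F)} {C : ℝ} (hC : ∀ x, ‖f x‖ ≤ C) :
    ‖quad n f‖ ≤ C :=
  (norm_quad_le n f).trans ((ContinuousMap.norm_le f ((norm_nonneg _).trans (hC 0))).2 hC)

theorem quad_sub (n : ℕ) (f g : C(I, F)) : quad n (f - g) = quad n f - quad n g := by
  simp [quad, smul_sub]

theorem norm_integral_le_norm (f : C(I, F)) : ‖∫ x : I, f x‖ ≤ ‖f‖ := by
  simpa using norm_integral_le_of_norm_le_const (μ := (volume : Measure I))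
    (Eventually.of_forall f.norm_coe_le_norm)

variable [CompleteSpace F]

theorem quad_eq_integral (n : ℕ) (f : C(I, F)) :
    quad n f = ∫ x : I, bernsteinApproximation n f x := by
  simp_rw [bernsteinApproximation.apply]
  rw [integral_finsetSum _ fun (k : Fin (n + 1)) _ =>
    (integrable_ofC (bernstein n k)).smul_const _]
  simp_rw [integral_smul_const]
  rfl

/-- Quadrature turns integrals over the interval into limits of finite combinations of point values.
This reduces path functionals to Gaussian vectors and integral functionals to cylindrical ones, with
no appeal to joint measurability of the bridge. -/
theorem tendsto_quad (f : C(I, F)) :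
    Tendsto (fun n => quad n f) atTop (𝓝 (∫ x : I, f x)) := by
  rw [tendsto_iff_norm_sub_tendsto_zero]
  refine squeeze_zero (fun _ => norm_nonneg _) (fun n => ?_)
    (tendsto_iff_norm_sub_tendsto_zero.1 (bernsteinApproximation_uniform f))
  rw [quad_eq_integral, ← integral_sub (integrable_ofC _) (integrable_ofC _)]
  exact norm_integral_le_norm (bernsteinApproximation n f - f)

/-- Applied to `f.curry`, with values in `C(I, ℝ)`, the inner quadrature converges uniformly in the
outer variable, and the outer quadrature does not increase the sup norm. -/
theorem tendsto_quad_quad (f : C(I × I, ℝ)) :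
    Tendsto (fun n => ∑ j : Fin (n + 1), ∑ k : Fin (n + 1),
      weight n j * weight n k * f (bernstein.z k, bernstein.z j)) atTop
      (𝓝 (∫ t : I, ∫ s : I, f (s, t))) := by
  have h1 := tendsto_quad f.curry
  have h2 : Tendsto (fun n => quad n (quad n f.curry - ∫ s : I, f.curry s)) atTop (𝓝 0) :=
    squeeze_zero_norm (fun n => norm_quad_le n _) (tendsto_iff_norm_sub_tendsto_zero.1 h1)
  have h3 := h2.add (tendsto_quad (∫ s : I, f.curry s))
  rw [zero_add] at h3
  have h4 : ∀ t : I, (∫ s : I, f.curry s) t = ∫ s : I, f (s, t) := fun t =>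
    ContinuousMap.integral_apply (integrable_ofC f.curry) t
  simp_rw [h4] at h3
  refine h3.congr fun n => ?_
  rw [quad_sub, sub_add_cancel, quad]
  refine Finset.sum_congr rfl fun j _ => ?_
  rw [quad, ContinuousMap.coe_sum, Finset.sum_apply, Finset.smul_sum]
  refine Finset.sum_congr rfl fun k _ => ?_
  simp [mul_assoc]

end Quadrature

/-! ### The covariance operator of the bridge -/

/-- The kernel is `(1 - t) s` before `t` and `t (1 - s)` after it; each piece has an explicit
primitive. The condition `sin κ = 0` removes the boundary term at `1`. -/
theorem integral_green (κ t : ℝ) (hκ : κ ≠ 0) (hs : Real.sin κ = 0) (ht : t ∈ Icc (0 : ℝ) 1) :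
    ∫ s in (0 : ℝ)..1, (min s t - s * t) * Real.sin (κ * s) = Real.sin (κ * t) / κ ^ 2 := by
  have hc : Continuous fun s : ℝ => (min s t - s * t) * Real.sin (κ * s) := by fun_prop
  rw [← intervalIntegral.integral_add_adjacent_intervals (b := t) (hc.intervalIntegrable _ _)
    (hc.intervalIntegrable _ _)]
  have h1 : ∫ s in (0 : ℝ)..t, (min s t - s * t) * Real.sin (κ * s) =
      (1 - t) * (-t * Real.cos (κ * t) / κ + Real.sin (κ * t) / κ ^ 2) := by
    have hd : ∀ s ∈ uIcc 0 t, HasDerivAt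
        (fun s => (1 - t) * (-s * Real.cos (κ * s) / κ + Real.sin (κ * s) / κ ^ 2))
        ((min s t - s * t) * Real.sin (κ * s)) s := by
      intro s hs'
      rw [uIcc_of_le ht.1] at hs'
      rw [min_eq_left hs'.2]
      have hl : HasDerivAt (fun s : ℝ => κ * s) κ s := by
        simpa using (hasDerivAt_id s).const_mul κ
      have hcos := (Real.hasDerivAt_cos (κ * s)).comp s hl
      have hsin := (Real.hasDerivAt_sin (κ * s)).comp s hl
      convert! (((((hasDerivAt_id s).neg).mul hcos).div_const κ).add
        (hsin.div_const (κ ^ 2))).const_mul (1 - t) using 1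
      simp only [Function.comp_apply, id, Pi.neg_apply]
      field_simp
      ring
    rw [intervalIntegral.integral_eq_sub_of_hasDerivAt hd (hc.intervalIntegrable _ _)]
    simp
  have h2 : ∫ s in t..1, (min s t - s * t) * Real.sin (κ * s) =
      t * ((1 - t) * Real.cos (κ * t) / κ + Real.sin (κ * t) / κ ^ 2) := by
    have hd : ∀ s ∈ uIcc t 1, HasDerivAt
        (fun s => -t * ((1 - s) * Real.cos (κ * s) / κ + Real.sin (κ * s) / κ ^ 2))
        ((min s t - s * t) * Real.sin (κ * s)) s := by
      intro s hs'
      rw [uIcc_of_le ht.2] at hs'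
      rw [min_eq_right hs'.1]
      have hl : HasDerivAt (fun s : ℝ => κ * s) κ s := by
        simpa using (hasDerivAt_id s).const_mul κ
      have hcos := (Real.hasDerivAt_cos (κ * s)).comp s hl
      have hsin := (Real.hasDerivAt_sin (κ * s)).comp s hl
      convert! ((((((hasDerivAt_id s).const_sub 1)).mul hcos).div_const κ).add
        (hsin.div_const (κ ^ 2))).const_mul (-t) using 1
      simp only [Function.comp_apply, id]
      field_simp
      ring
    rw [intervalIntegral.integral_eq_sub_of_hasDerivAt hd (hc.intervalIntegrable _ _)]
    simp [hs]
  rw [h1, h2]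
  field_simp
  ring

theorem integral_green_sinC (k : ℕ) (t : I) :
    ∫ s : I, (min (s : ℝ) t - s * t) * sinC (k + 1) s =
      sinC (k + 1) t * (((k + 1 : ℝ) * Real.pi) ^ 2)⁻¹ := by
  simp only [sinC_apply]
  rw [integral_I (fun s => (min s (t : ℝ) - s * t) *
    (√2 * Real.sin ((k + 1 : ℕ) * Real.pi * s)))]
  have h := integral_green ((k + 1 : ℕ) * Real.pi) t (by positivity)
    (by rw [Real.sin_nat_mul_pi]) t.2
  simp_rw [mul_left_comm _ (√2) _]
  rw [intervalIntegral.integral_const_mul, h]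
  push_cast
  ring

/-! ### The law of the coordinates of the bridge -/

section Law

variable {Ω : Type*} [MeasurableSpace Ω] {P : Measure Ω} {β : Ω → C(I, ℝ)}

/-- Measurability of `β` is known only at fixed times. Its Bernstein approximations depend on
finitely many times and converge uniformly. -/
theorem aemeasurable_ofC (hβ : IsBrownianBridge P β) : AEMeasurable (fun w => ofC (β w)) P := by
  refine aemeasurable_of_tendsto_metrizable_ae atTop (f := fun n w =>
    ofC (bernsteinApproximation n (β w))) (fun n => ?_) (Eventually.of_forall fun w =>
      (ofC.continuous.tendsto _).comp (bernsteinApproximation_uniform (β w)))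
  have h1 : ∀ w, ofC (bernsteinApproximation n (β w)) =
      ∑ k : Fin (n + 1), β w (bernstein.z k) • ofC (bernstein n k) := by
    intro w
    rw [bernsteinApproximation, map_sum]
    refine Finset.sum_congr rfl fun k _ => ?_
    rw [← map_smul]
    congr 1
    ext x
    simp [mul_comm]
  simp_rw [h1]
  refine Finset.aemeasurable_fun_sum _ fun k _ => ?_
  exact (hβ.gaussian.aemeasurable _).smul_const _

theorem isProbabilityMeasure_lawH [IsProbabilityMeasure P] (hβ : IsBrownianBridge P β) :
    IsProbabilityMeasure (lawH P β) :=
  Measure.isProbabilityMeasure_map (aemeasurable_ofC hβ)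

theorem integral_exp_sum [IsProbabilityMeasure P] (hβ : IsBrownianBridge P β) {n : ℕ}
    (c : Fin n → ℝ) (x : Fin n → I) :
    ∫ w, Complex.exp ((∑ k, c k * β w (x k) : ℝ) * Complex.I) ∂P =
      Complex.exp (-((∑ j, ∑ k, c j * c k * (min (x k : ℝ) (x j) - x k * x j) : ℝ) : ℂ) / 2) := by
  have hg : HasGaussianLaw (fun w => ∑ k, c k * β w (x k)) P :=
    ((hβ.gaussian.comp_right x).smul c).hasGaussianLaw_fun_sum
  have hm : ∀ k, MemLp (fun w => β w (x k)) 2 P := fun k =>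
    (hβ.gaussian.hasGaussianLaw_eval (x k)).memLp_two
  have hmean : ∫ w, ∑ k, c k * β w (x k) ∂P = 0 := by
    rw [integral_finsetSum _ fun k _ => ((hm k).integrable (by norm_num)).const_mul (c k)]
    simp [integral_const_mul, hβ.centered]
  have hvar : Var[fun w => ∑ k, c k * β w (x k); P] =
      ∑ j, ∑ k, c j * c k * (min (x k : ℝ) (x j) - x k * x j) := by
    rw [variance_fun_sum fun k => (hm k).const_mul (c k)]
    refine Finset.sum_congr rfl fun j _ => Finset.sum_congr rfl fun k _ => ?_
    rw [covariance_const_mul_left, covariance_const_mul_right, hβ.covariance, min_comm]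
    ring
  have h1 := hg.charFun_map_eq 1
  rw [charFun_apply_real, integral_map hg.aemeasurable (by fun_prop)] at h1
  have hin : ∀ x : ℝ, ⟪(1 : ℝ), x⟫ = x := fun x => by simp
  simp only [Complex.ofReal_one, one_mul, hin, hmean, hvar] at h1
  rw [h1]
  congr 1
  push_cast
  ring

theorem tendsto_quad_mul {Ω : Type*} {β : Ω → C(I, ℝ)} (f : C(I, ℝ)) (w : Ω) :
    Tendsto (fun n => ∑ k : Fin (n + 1), (weight n k * f (bernstein.z k)) * β w (bernstein.z k))
      atTop (𝓝 ⟪ofC f, ofC (β w)⟫) := by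
  rw [inner_ofC]
  refine (tendsto_quad (f * β w)).congr fun n => ?_
  simp [quad, mul_assoc]

/-- Finite Gaussian combinations of point values approximate `⟪ofC f, ofC (β w)⟫`; their
characteristic functions converge by domination, and their variances by the double quadrature. -/
theorem integral_exp_inner [IsProbabilityMeasure P] (hβ : IsBrownianBridge P β) (f : C(I, ℝ)) :
    ∫ w, Complex.exp ((⟪ofC f, ofC (β w)⟫ : ℝ) * Complex.I) ∂P =
      Complex.exp (-((∫ t : I, ∫ s : I, f s * f t * (min (s : ℝ) t - s * t) : ℝ) : ℂ) / 2) := by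
  have hlim : Tendsto (fun n : ℕ => ∫ w, Complex.exp
      ((∑ k : Fin (n + 1), (weight n k * f (bernstein.z k)) * β w (bernstein.z k) : ℝ) *
        Complex.I) ∂P) atTop
      (𝓝 (∫ w, Complex.exp ((⟪ofC f, ofC (β w)⟫ : ℝ) * Complex.I) ∂P)) := by
    refine tendsto_integral_of_dominated_convergence (fun _ => 1) (fun n => ?_)
      (integrable_const 1) (fun n => Eventually.of_forall fun w => ?_)
      (Eventually.of_forall fun w => ?_)
    · have : AEMeasurable (fun w => ∑ k : Fin (n + 1), (weight n k * f (bernstein.z k)) *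
          β w (bernstein.z k)) P :=
        Finset.aemeasurable_fun_sum _ fun k _ => (hβ.gaussian.aemeasurable _).const_mul _
      exact (Complex.measurable_exp.comp_aemeasurable
        ((Complex.measurable_ofReal.comp_aemeasurable this).mul_const _)).aestronglyMeasurable
    · rw [Complex.norm_exp_ofReal_mul_I]
    · have := tendsto_quad_mul (β := β) f w
      exact (Complex.continuous_exp.tendsto _).comp
        (((Complex.continuous_ofReal.tendsto _).comp this).mul_const _)
  refine tendsto_nhds_unique hlim ?_
  simp_rw [integral_exp_sum hβ]
  let F : C(I × I, ℝ) := ⟨fun p => f p.1 * f p.2 * (min (p.1 : ℝ) p.2 - p.1 * p.2), by fun_prop⟩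
  have h1 := tendsto_quad_quad F
  have h2 := (Complex.continuous_exp.tendsto _).comp
    ((((Complex.continuous_ofReal.tendsto _).comp h1).neg).div_const 2)
  refine h2.congr fun n => ?_
  simp only [Function.comp_apply, F, ContinuousMap.coe_mk]
  congr 5
  ext1 j
  congr 1
  ext1 k
  ring

/-- The variance of the coordinate `⟪e_{k+1}, β⟫`. -/
noncomputable def coordVar (k : ℕ) : NNReal := Real.toNNReal (((k + 1 : ℝ) * Real.pi) ^ 2)⁻¹

theorem coe_coordVar (k : ℕ) : (coordVar k : ℝ) = (((k + 1 : ℝ) * Real.pi) ^ 2)⁻¹ :=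
  Real.coe_toNNReal _ (by positivity)

theorem coordVar_pos (k : ℕ) : 0 < coordVar k :=
  Real.toNNReal_pos.2 (by positivity)

/-- The sines are eigenfunctions of the covariance kernel with eigenvalues `coordVar k`, and they
are orthonormal. -/
theorem covariance_sum_sinC {N : ℕ} (a : Fin N → ℝ) (f : C(I, ℝ))
    (hf : f = ∑ k, a k • sinC (k + 1)) :
    ∫ t : I, ∫ s : I, f s * f t * (min (s : ℝ) t - s * t) =
      ∑ k : Fin N, (coordVar k : ℝ) * a k ^ 2 := by
  have hf' : ∀ s, f s = ∑ k : Fin N, a k * sinC (k + 1) s := fun s => by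
    rw [hf]
    simp
  have h1 : ∀ t : I, ∫ s : I, f s * f t * (min (s : ℝ) t - s * t) =
      f t * ∑ k : Fin N, ((coordVar k : ℝ) * a k) * sinC (k + 1) t := by
    intro t
    have : ∀ s : I, f s * f t * (min (s : ℝ) t - s * t) =
        ∑ k : Fin N, (f t * a k) * ((min (s : ℝ) t - s * t) * sinC (k + 1) s) := by
      intro s
      rw [hf' s, Finset.sum_mul, Finset.sum_mul]
      exact Finset.sum_congr rfl fun k _ => by ring
    simp_rw [this]
    rw [integral_finsetSum _ fun (k : Fin N) _ => Integrable.const_mul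
      (integrable_ofC ⟨fun s : I => (min (s : ℝ) t - s * t) * sinC (k + 1) s, by fun_prop⟩) _]
    simp_rw [integral_const_mul, integral_green_sinC, Finset.mul_sum]
    refine Finset.sum_congr rfl fun k _ => ?_
    rw [coe_coordVar]
    ring
  simp_rw [h1]
  have h2 : ofC f = ∑ k : Fin N, a k • e (k + 1) := by
    rw [hf, map_sum]
    simp [ofC_sinC]
  have h3 : ∀ g : C(I, ℝ), g = ∑ k : Fin N, ((coordVar k : ℝ) * a k) • sinC (k + 1) →
      ∫ t : I, f t * ∑ k : Fin N, ((coordVar k : ℝ) * a k) * sinC (k + 1) t = ⟪ofC f, ofC g⟫ := by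
    rintro g rfl
    rw [inner_ofC]
    simp
  rw [h3 _ rfl, h2, map_sum, sum_inner]
  refine Finset.sum_congr rfl fun j _ => ?_
  rw [inner_sum, Finset.sum_eq_single j]
  · rw [map_smul, ofC_sinC, real_inner_smul_left, real_inner_smul_right, inner_e_e]
    simp
    ring
  · intro k _ hk
    rw [map_smul, ofC_sinC, real_inner_smul_left, real_inner_smul_right, inner_e_e,
      if_neg (fun h => hk (Fin.ext h.symm))]
    simp
  · simp

/-- The covariance is diagonal in the sine basis, so the joint characteristic function is the
product of the Gaussian ones. -/
theorem map_coords_eq_pi [IsProbabilityMeasure P] (hβ : IsBrownianBridge P β) (N : ℕ) :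
    (lawH P β).map (fun z (k : Fin N) => ⟪e (k + 1), z⟫) =
      Measure.pi fun k : Fin N => gaussianReal 0 (coordVar k) := by
  have := isProbabilityMeasure_lawH hβ
  have hmeas : Measurable fun (z : H) (k : Fin N) => ⟪e (k + 1), z⟫ :=
    measurable_pi_lambda _ fun k => Continuous.measurable (by fun_prop)
  have : IsProbabilityMeasure ((lawH P β).map (fun z (k : Fin N) => ⟪e (k + 1), z⟫)) :=
    Measure.isProbabilityMeasure_map hmeas.aemeasurable
  rw [← charFun_eq_pi_iff]
  intro a
  have hcont : Continuous fun y : H =>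
      Complex.exp ((∑ k : Fin N, ⟪⟪e (k + 1), y⟫, a k⟫ : ℝ) * Complex.I) := by fun_prop
  rw [charFun_apply, integral_map (by fun_prop) (by fun_prop),
    integral_map hmeas.aemeasurable (by fun_prop)]
  simp only [PiLp.inner_apply]
  rw [lawH, integral_map (aemeasurable_ofC hβ) hcont.aestronglyMeasurable]
  have h1 := integral_exp_inner hβ (∑ k : Fin N, a k • sinC (k + 1))
  rw [covariance_sum_sinC (fun k => a k) _ rfl] at h1
  simp_rw [charFun_gaussianReal]
  rw [← Complex.exp_sum]
  refine Eq.trans ?_ (h1.trans ?_)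
  · refine integral_congr_ae (Eventually.of_forall fun w => ?_)
    simp only [map_sum, sum_inner, map_smul, ofC_sinC, real_inner_smul_left]
    congr 4
  · congr 1
    push_cast
    rw [neg_div, Finset.sum_div, ← Finset.sum_neg_distrib]
    refine Finset.sum_congr rfl fun k _ => ?_
    simp

end Law

end BridgeForm

/-! ### The zero set and the second moments of the bridge -/

namespace BridgeForm

open DirichletForms

section ZeroSet

theorem integral_compLp {τ : ℝ → ℝ} {c : NNReal} (hτ : LipschitzWith c τ) (h0 : τ 0 = 0) (z : H) :
    ⟪ofC 1, hτ.compLp h0 z⟫ = ∫ x : I, τ (z x) := by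
  rw [inner_ofC_left]
  refine integral_congr_ae ?_
  filter_upwards [hτ.coeFn_compLp h0 z] with x hx
  rw [hx]
  simp

variable {Ω : Type*} [MeasurableSpace Ω] {P : Measure Ω} {β : Ω → C(I, ℝ)}

/-- This exchange of integrals is done on quadrature sums, where it is linearity, and then passed to
the limit. -/
theorem integral_integral_bridge [IsProbabilityMeasure P] (hβ : IsBrownianBridge P β) {τ : ℝ → ℝ}
    (hτ : Continuous τ) (hb : ∀ t, ‖τ t‖ ≤ 1) :
    ∫ w, (∫ x : I, τ (β w x)) ∂P = ∫ x : I, (∫ w, τ (β w x) ∂P) := by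
  have hm : ∀ x, AEStronglyMeasurable (fun w => τ (β w x)) P := fun x =>
    (hτ.measurable.comp_aemeasurable (hβ.gaussian.aemeasurable x)).aestronglyMeasurable
  let φ : C(I, ℝ) := ⟨fun x => ∫ w, τ (β w x) ∂P,
    continuous_of_dominated hm (bound := fun _ => 1) (fun x => Eventually.of_forall fun w => hb _)
      (integrable_const _) (Eventually.of_forall fun w => hτ.comp (β w).continuous)⟩
  have h1 := tendsto_quad φ
  let g : Ω → C(I, ℝ) := fun w => ⟨fun x => τ (β w x), hτ.comp (β w).continuous⟩
  have hi : ∀ x, Integrable (fun w => τ (β w x)) P := fun x =>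
    Integrable.of_bound (hm x) 1 (Eventually.of_forall fun w => hb _)
  have h2 : ∀ n, ∫ w, quad n (g w) ∂P = quad n φ := by
    intro n
    unfold quad
    rw [integral_finsetSum _ fun (k : Fin (n + 1)) _ =>
      (show Integrable (fun w => weight n k • g w (bernstein.z k)) P from
        (hi (bernstein.z k)).smul (weight n k))]
    refine Finset.sum_congr rfl fun k _ => ?_
    rw [integral_smul]
    rfl
  have h3 : Tendsto (fun n => ∫ w, quad n (g w) ∂P) atTop (𝓝 (∫ w, (∫ x : I, g w x) ∂P)) := by
    refine tendsto_integral_of_dominated_convergence (fun _ => 1) (fun n => ?_)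
      (integrable_const _) (fun n => Eventually.of_forall fun w =>
        norm_quad_le_of_forall fun x => hb _) (Eventually.of_forall fun w => tendsto_quad _)
    exact Finset.aestronglyMeasurable_fun_sum _ fun k _ => (hm _).const_smul (weight n k)
  simp_rw [h2] at h3
  exact tendsto_nhds_unique h3 h1

/-- The variance `x(1 - x)` is positive inside the interval, so the Gaussian law has no atom at `0`.
-/
theorem ae_bridge_ne_zero [IsProbabilityMeasure P] (hβ : IsBrownianBridge P β) {x : I}
    (h0 : x ≠ 0) (h1 : x ≠ 1) : ∀ᵐ w ∂P, β w x ≠ 0 := by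
  have hx0 : 0 < (x : ℝ) := lt_of_le_of_ne x.2.1 fun h => h0 (Subtype.ext h.symm)
  have hx1 : (x : ℝ) < 1 := lt_of_le_of_ne x.2.2 fun h => h1 (Subtype.ext h)
  have hae := hβ.gaussian.aemeasurable x
  have hmap := (hβ.gaussian.hasGaussianLaw_eval x).map_eq_gaussianReal
  have hv : Var[fun w => β w x; P].toNNReal ≠ 0 := by
    rw [← covariance_self hae, hβ.covariance, min_self]
    refine (Real.toNNReal_pos.2 ?_).ne'
    nlinarith
  have := nullSingletonClass_gaussianReal (μ := ∫ w, β w x ∂P) hv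
  refine ae_of_ae_map hae (p := fun y => y ≠ 0) ?_
  rw [hmap]
  exact Measure.ae_ne _ 0

/-- Lipschitz approximations of the indicator function of `{0}ᶜ`. -/
noncomputable def ramp (n : ℕ) (t : ℝ) : ℝ := min (n * |t|) 1

theorem ramp_zero (n : ℕ) : ramp n 0 = 0 := by simp [ramp]

theorem norm_ramp_le (n : ℕ) (t : ℝ) : ‖ramp n t‖ ≤ 1 := by
  rw [ramp, Real.norm_of_nonneg (le_min (by positivity) zero_le_one)]
  exact min_le_right _ _

theorem lipschitzWith_ramp (n : ℕ) : LipschitzWith n (ramp n) := by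
  refine LipschitzWith.min_const ?_ 1
  refine LipschitzWith.of_dist_le_mul fun s t => ?_
  rw [Real.dist_eq, Real.dist_eq, ← mul_sub, abs_mul, Nat.abs_cast, NNReal.coe_natCast]
  exact mul_le_mul_of_nonneg_left (abs_abs_sub_abs_le s t) (Nat.cast_nonneg n)

theorem tendsto_ramp (t : ℝ) :
    Tendsto (fun n => ramp n t) atTop (𝓝 (({0}ᶜ : Set ℝ).indicator (fun _ => 1) t)) := by
  by_cases ht : t = 0
  · rw [indicator_of_notMem (by simpa using ht), ht]
    simp [ramp_zero]
  · rw [indicator_of_mem (by simpa using ht)]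
    have h1 : Tendsto (fun n : ℕ => (n : ℝ) * |t|) atTop atTop :=
      tendsto_natCast_atTop_atTop.atTop_mul_const (by positivity)
    refine tendsto_const_nhds.congr' ?_
    filter_upwards [h1.eventually_ge_atTop 1] with n hn
    exact (min_eq_right hn).symm

/-- Let `S z` be the Lebesgue measure of `{z ≠ 0}`. Its mean is `1` because each `β w x` with `0 < x
< 1` is almost surely nonzero; as `S ≤ 1`, it equals `1` almost surely. The Lipschitz ramps replace
the indicator by functionals `T n` continuous on `H`. -/
theorem ae_ne_zero [IsProbabilityMeasure P] (hβ : IsBrownianBridge P β) :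
    ∀ᵐ z ∂(lawH P β), ∀ᵐ x ∂(volume : Measure I), z x ≠ 0 := by
  have := isProbabilityMeasure_lawH hβ
  let T : ℕ → H → ℝ := fun n z => ⟪ofC 1, (lipschitzWith_ramp n).compLp (ramp_zero n) z⟫
  have hT : ∀ n z, T n z = ∫ x : I, ramp n (z x) := fun n z => integral_compLp _ _ z
  have hTc : ∀ n, Continuous (T n) := fun n =>
    continuous_const.inner ((lipschitzWith_ramp n).continuous_compLp (ramp_zero n))
  have hTb : ∀ n z, ‖T n z‖ ≤ 1 := fun n z => by
    rw [hT]
    refine (norm_integral_le_of_norm_le_const (C := 1)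
      (Eventually.of_forall fun x => norm_ramp_le n _)).trans ?_
    simp
  let S : H → ℝ := fun z => ∫ x : I, ({0}ᶜ : Set ℝ).indicator (fun _ => (1 : ℝ)) (z x)
  have hS : ∀ z, Tendsto (fun n => T n z) atTop (𝓝 (S z)) := by
    intro z
    simp_rw [hT]
    refine tendsto_integral_of_dominated_convergence (fun _ => 1) (fun n => ?_)
      (integrable_const _) (fun n => Eventually.of_forall fun x => norm_ramp_le n _)
      (Eventually.of_forall fun x => tendsto_ramp _)
    exact (lipschitzWith_ramp n).continuous.comp_aestronglyMeasurable (Lp.aestronglyMeasurable z)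
  have hlim1 : Tendsto (fun n => ∫ z, T n z ∂(lawH P β)) atTop (𝓝 (∫ z, S z ∂(lawH P β))) :=
    tendsto_integral_of_dominated_convergence (fun _ => 1)
      (fun n => (hTc n).aestronglyMeasurable) (integrable_const _)
      (fun n => Eventually.of_forall fun z => hTb n z) (Eventually.of_forall hS)
  have hE : ∀ n, ∫ z, T n z ∂(lawH P β) = ∫ x : I, ∫ w, ramp n (β w x) ∂P := by
    intro n
    rw [lawH, integral_map (aemeasurable_ofC hβ) (hTc n).aestronglyMeasurable,
      ← integral_integral_bridge hβ (lipschitzWith_ramp n).continuous (norm_ramp_le n)]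
    refine integral_congr_ae (Eventually.of_forall fun w => ?_)
    simp only
    rw [hT]
    refine integral_congr_ae ?_
    filter_upwards [coeFn_ofC (β w)] with x hx
    rw [hx]
  have hm : ∀ n x, AEStronglyMeasurable (fun w => ramp n (β w x)) P := fun n x =>
    ((lipschitzWith_ramp n).continuous.measurable.comp_aemeasurable
      (hβ.gaussian.aemeasurable x)).aestronglyMeasurable
  have hlim2 : Tendsto (fun n => ∫ z, T n z ∂(lawH P β)) atTop (𝓝 1) := by
    simp_rw [hE]
    have : (1 : ℝ) = ∫ x : I, (1 : ℝ) := by simp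
    rw [this]
    refine tendsto_integral_of_dominated_convergence (fun _ => 1) (fun n => ?_)
      (integrable_const _) (fun n => Eventually.of_forall fun x => ?_) ?_
    · refine Continuous.aestronglyMeasurable ?_
      exact continuous_of_dominated (hm n) (bound := fun _ => 1)
        (fun x => Eventually.of_forall fun w => norm_ramp_le n _) (integrable_const _)
        (Eventually.of_forall fun w => (lipschitzWith_ramp n).continuous.comp (β w).continuous)
    · refine (norm_integral_le_of_norm_le_const (C := 1)
        (Eventually.of_forall fun w => norm_ramp_le n _)).trans ?_
      simp
    · filter_upwards [Measure.ae_ne volume (0 : I), Measure.ae_ne volume (1 : I)] with x h0 h1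
      have : (1 : ℝ) = ∫ w, (1 : ℝ) ∂P := by simp
      rw [this]
      refine tendsto_integral_of_dominated_convergence (fun _ => 1) (fun n => hm n x)
        (integrable_const _) (fun n => Eventually.of_forall fun w => norm_ramp_le n _) ?_
      filter_upwards [ae_bridge_ne_zero hβ h0 h1] with w hw
      have := tendsto_ramp (β w x)
      rwa [indicator_of_mem (by simpa using hw)] at this
  have hint : ∫ z, S z ∂(lawH P β) = 1 := tendsto_nhds_unique hlim1 hlim2
  have hind : ∀ t : ℝ, ‖({0}ᶜ : Set ℝ).indicator (fun _ => (1 : ℝ)) t‖ ≤ 1 := fun t => by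
    by_cases ht : t = 0 <;> simp [ht]
  have hSb : ∀ z, S z ≤ 1 := fun z => by
    refine (le_abs_self _).trans ((norm_integral_le_of_norm_le_const (C := 1)
      (Eventually.of_forall fun x => hind _)).trans ?_)
    simp
  have hSi : Integrable S (lawH P β) := by
    refine Integrable.of_bound (aestronglyMeasurable_of_tendsto_ae atTop
      (fun n => (hTc n).aestronglyMeasurable) (Eventually.of_forall hS)) 1
      (Eventually.of_forall fun z => ?_)
    exact le_of_tendsto (hS z).norm (Eventually.of_forall fun n => hTb n z)
  have hzero : (fun z => 1 - S z) =ᵐ[lawH P β] 0 := by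
    refine (integral_eq_zero_iff_of_nonneg (fun z => sub_nonneg.2 (hSb z))
      ((integrable_const 1).sub hSi)).1 ?_
    rw [integral_sub (integrable_const 1) hSi, hint]
    simp
  filter_upwards [hzero] with z hz
  have hmeas : AEStronglyMeasurable
      (fun x : I => ({0}ᶜ : Set ℝ).indicator (fun _ => (1 : ℝ)) (z x)) volume :=
    ((measurable_const.indicator (measurableSet_singleton 0).compl).comp_aemeasurable
      (Lp.aestronglyMeasurable z).aemeasurable).aestronglyMeasurable
  have hi : Integrable (fun x : I => ({0}ᶜ : Set ℝ).indicator (fun _ => (1 : ℝ)) (z x)) volume :=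
    Integrable.of_bound hmeas 1 (Eventually.of_forall fun x => hind _)
  have h2 : (fun x : I => 1 - ({0}ᶜ : Set ℝ).indicator (fun _ => (1 : ℝ)) (z x)) =ᵐ[volume] 0 := by
    refine (integral_eq_zero_iff_of_nonneg (fun x => sub_nonneg.2 ((le_abs_self _).trans (hind _)))
      ((integrable_const 1).sub hi)).1 ?_
    rw [integral_sub (integrable_const 1) hi]
    simpa [S] using hz
  filter_upwards [h2] with x hx hzx
  simp [hzx] at hx

end ZeroSet

section Moments

variable {Ω : Type*} [MeasurableSpace Ω] {P : Measure Ω} {β : Ω → C(I, ℝ)}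

theorem map_coord [IsProbabilityMeasure P] (hβ : IsBrownianBridge P β) (k : ℕ) :
    (lawH P β).map (fun z => ⟪e (k + 1), z⟫) = gaussianReal 0 (coordVar k) := by
  have h1 := (measurePreserving_eval (fun k : Fin (k + 1) => gaussianReal 0 (coordVar k))
    (Fin.last k)).map_eq
  rw [← map_coords_eq_pi hβ (k + 1), Measure.map_map (measurable_pi_apply _)
    (measurable_pi_lambda _ fun k => Continuous.measurable (by fun_prop))] at h1
  exact h1

theorem memLp_coord [IsProbabilityMeasure P] (hβ : IsBrownianBridge P β) (k : ℕ) :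
    MemLp (fun z => ⟪e (k + 1), z⟫) 2 (lawH P β) := by
  have h1 := memLp_id_gaussianReal (μ := 0) (v := coordVar k) 2
  rw [← map_coord hβ k] at h1
  have hm : AEMeasurable (fun z : H => ⟪e (k + 1), z⟫) (lawH P β) :=
    Continuous.aemeasurable (by fun_prop)
  exact (memLp_map_measure_iff h1.1 hm).1 h1

theorem lintegral_coord_sq [IsProbabilityMeasure P] (hβ : IsBrownianBridge P β) (k : ℕ) :
    ∫⁻ z, ENNReal.ofReal (⟪e (k + 1), z⟫ ^ 2) ∂(lawH P β) = coordVar k := by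
  rw [← ofReal_integral_eq_lintegral_ofReal (memLp_coord hβ k).integrable_sq
    (Eventually.of_forall fun z => sq_nonneg _)]
  have hm : AEMeasurable (fun z : H => ⟪e (k + 1), z⟫) (lawH P β) :=
    Continuous.aemeasurable (by fun_prop)
  have h1 : ∫ z, ⟪e (k + 1), z⟫ ^ 2 ∂(lawH P β) = coordVar k := by
    rw [← integral_map (f := fun t : ℝ => t ^ 2) hm (by fun_prop), map_coord hβ,
      ← variance_id_gaussianReal (μ := 0) (v := coordVar k), variance_of_integral_eq_zero
      aemeasurable_id (by simp)]
    simp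
  rw [h1, ENNReal.ofReal_coe_nnreal]

theorem summable_coordVar : Summable fun k => (coordVar k : ℝ) := by
  simp_rw [coe_coordVar, mul_pow, mul_inv]
  refine Summable.mul_right _ ?_
  have h1 : Summable fun n : ℕ => ((n : ℝ) ^ 2)⁻¹ := by
    simp
  have := (summable_nat_add_iff 1).2 h1
  simpa using this

theorem norm_sq_eq_tsum (z : H) : HasSum (fun k => ⟪e (k + 1), z⟫ ^ 2) (‖z‖ ^ 2) := by
  have h1 : ∀ k, ⟪z, sineBasis k⟫ * ⟪sineBasis k, z⟫ = ⟪e (k + 1), z⟫ ^ 2 := fun k => by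
    rw [sineBasis_apply, real_inner_comm (e (k + 1)) z, sq]
  have := sineBasis.hasSum_inner_mul_inner z z
  simp_rw [h1] at this
  rwa [real_inner_self_eq_norm_sq] at this

/-- By Parseval the second moment is `∑ coordVar k`, a convergent series of inverse squares. -/
theorem lintegral_norm_sq [IsProbabilityMeasure P] (hβ : IsBrownianBridge P β) :
    ∫⁻ z, ENNReal.ofReal (‖z‖ ^ 2) ∂(lawH P β) ≠ ⊤ := by
  have h1 : ∀ z : H, ENNReal.ofReal (‖z‖ ^ 2) = ∑' k, ENNReal.ofReal (⟪e (k + 1), z⟫ ^ 2) :=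
    fun z => by
      rw [← (norm_sq_eq_tsum z).tsum_eq, ENNReal.ofReal_tsum_of_nonneg (fun k => sq_nonneg _)
        (norm_sq_eq_tsum z).summable]
  simp_rw [h1]
  rw [lintegral_tsum (f := fun k z => ENNReal.ofReal (⟪e (k + 1), z⟫ ^ 2)) fun k =>
    (ENNReal.measurable_ofReal.comp (Continuous.measurable (by fun_prop))).aemeasurable]
  simp_rw [lintegral_coord_sq hβ]
  rw [ENNReal.tsum_coe_ne_top_iff_summable, ← NNReal.summable_coe]
  exact summable_coordVar

theorem integrable_norm_sq [IsProbabilityMeasure P] (hβ : IsBrownianBridge P β) :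
    Integrable (fun z => ‖z‖ ^ 2) (lawH P β) :=
  (lintegral_ofReal_ne_top_iff_integrable (by fun_prop)
    (Eventually.of_forall fun z => sq_nonneg _)).1 (lintegral_norm_sq hβ)
end Moments

end BridgeForm

/-! ### Integration by parts -/

namespace BridgeForm

open DirichletForms

section GaussianIBP

theorem hasDerivAt_gaussianPDFReal (v : NNReal) (x : ℝ) :
    HasDerivAt (gaussianPDFReal 0 v) (-(x / v) * gaussianPDFReal 0 v x) x := by
  have h1 : HasDerivAt (fun x : ℝ => -(x - 0) ^ 2 / (2 * v)) (-(x / v)) x := by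
    have := (((hasDerivAt_id x).sub_const 0).pow 2).neg.div_const (2 * (v : ℝ))
    convert! this using 1
    simp
    ring
  have h2 := (h1.exp).const_mul (√(2 * Real.pi * v))⁻¹
  convert! h2 using 1
  rw [gaussianPDFReal]
  ring

theorem integrable_mul_gaussianPDFReal {v : NNReal} (hv : v ≠ 0) :
    Integrable (fun x => x * gaussianPDFReal 0 v x) := by
  have hv' : (0 : ℝ) < v := NNReal.coe_pos.2 (pos_iff_ne_zero.2 hv)
  have := (integrable_mul_exp_neg_mul_sq (b := (2 * (v : ℝ))⁻¹) (by positivity)).const_mul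
    (√(2 * Real.pi * v))⁻¹
  refine this.congr (Eventually.of_forall fun x => ?_)
  simp only [gaussianPDFReal, sub_zero]
  rw [show -(2 * (v : ℝ))⁻¹ * x ^ 2 = -x ^ 2 / (2 * v) by ring]
  ring

/-- This is Stein's identity: the density `p` satisfies `p' = -(x/v) p`, and ordinary integration by
parts on the line applies. -/
theorem integral_deriv_gaussianReal {v : NNReal} (hv : v ≠ 0) {f f' : ℝ → ℝ}
    (hf : ∀ x, HasDerivAt f (f' x) x) (hf' : Continuous f') {C C' : ℝ} (hC : ∀ x, ‖f x‖ ≤ C)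
    (hC' : ∀ x, ‖f' x‖ ≤ C') :
    v * ∫ x, f' x ∂(gaussianReal 0 v) = ∫ x, x * f x ∂(gaussianReal 0 v) := by
  have hv' : (v : ℝ) ≠ 0 := by simpa using hv
  have hfc : Continuous f := continuous_iff_continuousAt.2 fun x => (hf x).continuousAt
  have i1 := integrable_gaussianPDFReal 0 v
  have i2 := integrable_mul_gaussianPDFReal hv
  have key := integral_mul_deriv_eq_deriv_mul_of_integrable (u := f) (v := gaussianPDFReal 0 v)
    (u' := f') (v' := fun x => -(x / v) * gaussianPDFReal 0 v x) (fun x _ => hf x)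
    (fun x _ => hasDerivAt_gaussianPDFReal v x) ?_ ?_ ?_
  · rw [integral_gaussianReal_eq_integral_smul hv, integral_gaussianReal_eq_integral_smul hv]
    simp only [smul_eq_mul]
    have e1 : ∫ x, gaussianPDFReal 0 v x * (x * f x) =
        (-v) * ∫ x, f x * (-(x / v) * gaussianPDFReal 0 v x) := by
      rw [← integral_const_mul]
      refine integral_congr_ae (Eventually.of_forall fun x => ?_)
      simp only
      field_simp
    rw [e1, key]
    simp_rw [mul_comm (gaussianPDFReal 0 v _)]
    ring
  · refine ((i2.const_mul (-(v : ℝ)⁻¹)).bdd_mul hfc.aestronglyMeasurable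
      (Eventually.of_forall hC)).congr (Eventually.of_forall fun x => ?_)
    simp only [Pi.mul_apply]
    ring
  · exact i1.bdd_mul hf'.aestronglyMeasurable (Eventually.of_forall hC')
  · exact i1.bdd_mul hfc.aestronglyMeasurable (Eventually.of_forall hC)

/-- Fubini isolates the `i`-th coordinate, in which Stein's identity is applied with the others
frozen. -/
theorem integral_partial_pi_gaussianReal {n : ℕ} (v : Fin (n + 1) → NNReal) (i : Fin (n + 1))
    (hv : v i ≠ 0) {Ψ : (Fin (n + 1) → ℝ) → ℝ} (hΨ : BddSmooth Ψ) :
    v i * ∫ y, fderiv ℝ Ψ y (Pi.single i 1) ∂(Measure.pi fun i => gaussianReal 0 (v i)) =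
      ∫ y, y i * Ψ y ∂(Measure.pi fun i => gaussianReal 0 (v i)) := by
  obtain ⟨C, hC0, hC⟩ := hΨ.bound
  obtain ⟨C', hC0', hC'⟩ := hΨ.bound_fderiv
  have hmp := measurePreserving_piFinSuccAbove (fun i => gaussianReal 0 (v i)) i
  have hpart : ∀ y, ‖fderiv ℝ Ψ y (Pi.single i 1)‖ ≤ C' := fun y => by
    refine ((fderiv ℝ Ψ y).le_opNorm _).trans ?_
    have : ‖(Pi.single i 1 : Fin (n + 1) → ℝ)‖ = 1 := by
      rw [Pi.norm_single]
      simp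
    rw [this, mul_one]
    exact hC' y
  have hcpart : Continuous fun y => fderiv ℝ Ψ y (Pi.single i 1) :=
    hΨ.continuous_fderiv.clm_apply continuous_const
  have hins : Continuous fun p : ℝ × (Fin n → ℝ) => (i.insertNth p.1 p.2 : Fin (n + 1) → ℝ) :=
    Continuous.finInsertNth (A := fun _ => ℝ) i continuous_fst continuous_snd
  have hI1 : Integrable (fun y => fderiv ℝ Ψ y (Pi.single i 1))
      (Measure.pi fun i => gaussianReal 0 (v i)) :=
    Integrable.of_bound hcpart.aestronglyMeasurable C' (Eventually.of_forall hpart)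
  have hid : Integrable (fun x : ℝ => x) (gaussianReal 0 (v i)) :=
    (memLp_id_gaussianReal 1).integrable le_rfl
  have hI2 : Integrable (fun y : Fin (n + 1) → ℝ => y i * Ψ y)
      (Measure.pi fun i => gaussianReal 0 (v i)) := by
    have h1 : Integrable (fun y : Fin (n + 1) → ℝ => y i)
        (Measure.pi fun i => gaussianReal 0 (v i)) :=
      (measurePreserving_eval (fun i => gaussianReal 0 (v i)) i).integrable_comp_of_integrable hid
    exact h1.mul_bdd (c := C) hΨ.1.continuous.aestronglyMeasurable (Eventually.of_forall hC)
  have hsymm : ∀ p : ℝ × (Fin n → ℝ), (MeasurableEquiv.piFinSuccAbove (fun _ => ℝ) i).symm p =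
      i.insertNth p.1 p.2 := fun p => rfl
  have transfer : ∀ g : (Fin (n + 1) → ℝ) → ℝ,
      Integrable g (Measure.pi fun i => gaussianReal 0 (v i)) →
      ∫ y, g y ∂(Measure.pi fun i => gaussianReal 0 (v i)) =
        ∫ y : Fin n → ℝ, ∫ x, g (i.insertNth x y) ∂(gaussianReal 0 (v i))
          ∂(Measure.pi fun j => gaussianReal 0 (v (i.succAbove j))) := by
    intro g hg
    have h1 := (hmp.symm _).integral_comp' g
    rw [← h1, integral_prod_symm]
    · rfl
    · exact (hmp.symm _).integrable_comp_of_integrable hg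
  rw [transfer _ hI1, transfer _ hI2, ← integral_const_mul]
  refine integral_congr_ae (Eventually.of_forall fun y => ?_)
  simp only [Fin.insertNth_apply_same]
  have hline : ∀ x, HasDerivAt (fun x => (i.insertNth x y : Fin (n + 1) → ℝ)) (Pi.single i 1) x := by
    intro x
    have := hasDerivAt_update (i.insertNth 0 y : Fin (n + 1) → ℝ) i x
    rwa [show Function.update (i.insertNth 0 y : Fin (n + 1) → ℝ) i =
      fun x : ℝ => (i.insertNth x y : Fin (n + 1) → ℝ) from
      funext fun x => Fin.update_insertNth (α := fun _ => ℝ) i 0 x y] at this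
  refine integral_deriv_gaussianReal hv (f := fun x => Ψ (i.insertNth x y)) (fun x => ?_) ?_
    (fun x => hC _) (fun x => hpart _)
  · exact (hΨ.differentiable _).hasFDerivAt.comp_hasDerivAt x (hline x)
  · exact hcpart.comp (hins.comp (Continuous.prodMk_left y))

end GaussianIBP

/-! ### Closability of the Gaussian form -/

section Closability

theorem eventually_eq_sum_of_mem_testSpace {l : H} (hl : l ∈ testSpace) :
    ∀ᶠ N : ℕ in atTop, l = ∑ k : Fin N, ⟪e (k + 1), l⟫ • e (k + 1) := by
  induction hl using Submodule.span_induction with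
  | mem l hl =>
    obtain ⟨k, hk, rfl⟩ := hl
    obtain ⟨k, rfl⟩ := Nat.exists_eq_add_of_le' (show 1 ≤ k from hk)
    filter_upwards [eventually_gt_atTop k] with N hN
    rw [Finset.sum_eq_single ⟨k, hN⟩]
    · rw [inner_e_e, if_pos rfl, one_smul]
    · intro j _ hj
      rw [inner_e_e, if_neg (fun h => hj (Fin.ext h)), zero_smul]
    · simp
  | zero => simp
  | add x y _ _ hx hy =>
    filter_upwards [hx, hy] with N h1 h2
    simp_rw [inner_add_right, add_smul]
    rw [Finset.sum_add_distrib, ← h1, ← h2]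
  | smul c x _ hx =>
    filter_upwards [hx] with N h1
    simp_rw [inner_smul_right, mul_smul]
    rw [← Finset.smul_sum, ← h1]

/-- Finitely many test vectors involve finitely many sines. Taking `k < N + 1` makes the `k`-th
coordinate available for integration by parts even if `F` does not depend on it. -/
theorem exists_coords_of_mem_cylindricalH {F : H → ℝ} (hF : F ∈ cylindricalH) (k : ℕ) :
    ∃ N : ℕ, k < N + 1 ∧ ∃ Ψ : (Fin (N + 1) → ℝ) → ℝ, BddSmooth Ψ ∧
      F = fun z => Ψ (fun j => ⟪e (j + 1), z⟫) := by
  obtain ⟨m, ψ, l, hψ, hl, rfl⟩ := mem_cylindricalH_iff.1 hF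
  have h1 := (eventually_all.2 fun i => eventually_eq_sum_of_mem_testSpace (hl i)).and
    (eventually_gt_atTop k)
  obtain ⟨N, hN, hk⟩ := ((tendsto_add_atTop_nat 1).eventually h1).exists
  let L : (Fin (N + 1) → ℝ) →L[ℝ] (Fin m → ℝ) := ContinuousLinearMap.pi fun i =>
    ∑ j : Fin (N + 1), ⟪e (j + 1), l i⟫ • ContinuousLinearMap.proj (R := ℝ) (φ := fun _ => ℝ) j
  refine ⟨N, hk, fun y => ψ (L y), hψ.comp_clm L, ?_⟩
  ext z
  congr 1
  ext i
  conv_lhs => rw [hN i]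
  simp [L, sum_inner, real_inner_smul_left]

variable {Ω : Type*} [MeasurableSpace Ω] {P : Measure Ω} {β : Ω → C(I, ℝ)}

theorem integral_inner_gradient [IsProbabilityMeasure P] (hβ : IsBrownianBridge P β) {F : H → ℝ}
    (hF : F ∈ cylindricalH) (k : ℕ) :
    coordVar k * ∫ z, ⟪gradient F z, e (k + 1)⟫ ∂(lawH P β) =
      ∫ z, ⟪e (k + 1), z⟫ * F z ∂(lawH P β) := by
  obtain ⟨N, hk, Ψ, hΨ, rfl⟩ := exists_coords_of_mem_cylindricalH hF k
  have h1 := integral_partial_pi_gaussianReal (fun j : Fin (N + 1) => coordVar j) ⟨k, hk⟩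
    (coordVar_pos k).ne' hΨ
  have hcont : Continuous fun (z : H) (j : Fin (N + 1)) => ⟪e (j + 1), z⟫ := by fun_prop
  have hc1 : Continuous fun y => fderiv ℝ Ψ y (Pi.single (⟨k, hk⟩ : Fin (N + 1)) 1) :=
    hΨ.continuous_fderiv.clm_apply continuous_const
  have hc2 : Continuous fun y : Fin (N + 1) → ℝ => y ⟨k, hk⟩ * Ψ y :=
    (continuous_apply _).mul hΨ.1.continuous
  rw [← map_coords_eq_pi hβ, integral_map hcont.aemeasurable hc1.aestronglyMeasurable,
    integral_map hcont.aemeasurable hc2.aestronglyMeasurable] at h1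
  rw [← h1]
  congr 1
  refine integral_congr_ae (Eventually.of_forall fun z => ?_)
  simp only
  rw [gradient_cylindrical hΨ, inner_gradVec]
  congr 1
  ext j
  rw [inner_e_e, Pi.single_apply]
  simp [Fin.ext_iff]

/-- Suppose `v n → 0` with gradients tending to `p.2`. Tested against `G • e (k + 1)`, integration
by parts moves the derivative off `v n`, leaving pairings that tend to `0`. Every coordinate of
`p.2` is thus orthogonal to the separating algebra. -/
theorem singleValued_closedGraph_H [IsProbabilityMeasure P] (hβ : IsBrownianBridge P β)
    [IsFiniteMeasure (lawH P β)] :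
    SingleValued (isL2Gradient_H (lawH P β)).closedGraph := by
  intro p hp h0
  obtain ⟨v, hv, hv1, hv2⟩ := (isL2Gradient_H (lawH P β)).exists_seq hp
  rw [h0] at hv1
  set h := isL2Gradient_H (lawH P β)
  have hkey : ∀ k : ℕ, (fun z => ⟪e (k + 1), p.2 z⟫) =ᵐ[lawH P β] 0 := by
    intro k
    have hmem : MemLp (fun z => ⟪e (k + 1), p.2 z⟫) 2 (lawH P β) := (Lp.memLp p.2).const_inner _
    refine isSeparatingAlgebra_cylindricalH.ae_eq_zero hmem fun G hG => ?_
    obtain ⟨C, hC0, hC⟩ := bounded_of_mem_cylindricalH hG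
    have hGm := (continuous_of_mem_cylindricalH hG).aestronglyMeasurable (μ := lawH P β)
    have ha : MemLp (fun z => G z • e (k + 1)) 2 (lawH P β) :=
      MemLp.of_bound (hGm.smul aestronglyMeasurable_const) (C * ‖e (k + 1)‖)
        (Eventually.of_forall fun z => by rw [norm_smul]; gcongr; exact hC z)
    have hb : MemLp (fun z => ⟪e (k + 1), z⟫ * G z -
        coordVar k * ⟪gradient G z, e (k + 1)⟫) 2 (lawH P β) := by
      refine MemLp.sub ?_ ?_
      · refine ((memLp_coord hβ k).const_mul C).of_le
          ((Continuous.aestronglyMeasurable (by fun_prop)).mul hGm)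
          (Eventually.of_forall fun z => ?_)
        rw [norm_mul, norm_mul, mul_comm, Real.norm_of_nonneg hC0]
        gcongr
        exact hC z
      · exact ((h.memLp_grad G hG).inner_const _).const_mul _
    -- Integration by parts for `v n * G`, with the product rule, expresses the pairing with `∇(v
    -- n)` through `v n` alone; the factor `hb` depends on `G` and `k` only.
    have hn : ∀ n, coordVar k * ⟪ha.toLp _, (h.memLp_grad _ (hv n)).toLp (gradient (v n))⟫ =
        ⟪hb.toLp _, (h.memLp _ (hv n)).toLp (v n)⟫ := by
      intro n
      have ibp := integral_inner_gradient hβ (mul_mem_cylindricalH (hv n) hG) k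
      rw [L2.inner_def, L2.inner_def]
      obtain ⟨Cv, hCv0, hCv⟩ := bounded_of_mem_cylindricalH (hv n)
      have hvm := (continuous_of_mem_cylindricalH (hv n)).aestronglyMeasurable (μ := lawH P β)
      have hsplit : ∀ z, ⟪gradient (v n * G) z, e (k + 1)⟫ =
          v n z * ⟪gradient G z, e (k + 1)⟫ + ⟪G z • e (k + 1), gradient (v n) z⟫ := by
        intro z
        rw [gradient_mul (differentiable_of_mem_cylindricalH (hv n) z)
          (differentiable_of_mem_cylindricalH hG z), inner_add_left, real_inner_smul_left,
          real_inner_smul_left, real_inner_smul_left, real_inner_comm (e (k + 1)) (gradient (v n) z)]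
      have i1 : Integrable (fun z => v n z * ⟪gradient G z, e (k + 1)⟫) (lawH P β) :=
        (((h.memLp_grad G hG).inner_const _).integrable (by norm_num)).bdd_mul hvm
          (Eventually.of_forall hCv)
      have i2 : Integrable (fun z => ⟪G z • e (k + 1), gradient (v n) z⟫) (lawH P β) := by
        simp_rw [real_inner_smul_left]
        exact (((h.memLp_grad _ (hv n)).const_inner _).integrable (by norm_num)).bdd_mul hGm
          (Eventually.of_forall hC)
      simp_rw [hsplit] at ibp
      rw [integral_add i1 i2] at ibp
      have e1 : ∫ z, ⟪ha.toLp _ z, (h.memLp_grad _ (hv n)).toLp (gradient (v n)) z⟫ ∂(lawH P β) =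
          ∫ z, ⟪G z • e (k + 1), gradient (v n) z⟫ ∂(lawH P β) := by
        refine integral_congr_ae ?_
        filter_upwards [ha.coeFn_toLp, (h.memLp_grad _ (hv n)).coeFn_toLp] with z h1 h2
        rw [h1, h2]
      have e2 : ∫ z, ⟪hb.toLp _ z, (h.memLp _ (hv n)).toLp (v n) z⟫ ∂(lawH P β) =
          ∫ z, (⟪e (k + 1), z⟫ * (v n * G) z -
            coordVar k * (v n z * ⟪gradient G z, e (k + 1)⟫)) ∂(lawH P β) := by
        refine integral_congr_ae ?_
        filter_upwards [hb.coeFn_toLp, (h.memLp _ (hv n)).coeFn_toLp] with z h1 h2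
        rw [h1, h2]
        simp only [Pi.mul_apply, RCLike.inner_apply, conj_trivial]
        ring
      rw [e1, e2, integral_sub _ (i1.const_mul _), integral_const_mul, ← ibp]
      · ring
      · have hvG : AEStronglyMeasurable (v n * G) (lawH P β) := hvm.mul hGm
        refine ((memLp_coord hβ k).integrable (by norm_num)).mul_bdd (c := Cv * C) hvG
          (Eventually.of_forall fun z => ?_)
        rw [Pi.mul_apply, norm_mul]
        exact mul_le_mul (hCv z) (hC z) (norm_nonneg _) hCv0
    have hl : Tendsto (fun n => coordVar k *
        ⟪ha.toLp _, (h.memLp_grad _ (hv n)).toLp (gradient (v n))⟫) atTop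
        (𝓝 (coordVar k * ⟪ha.toLp _, p.2⟫)) := (tendsto_const_nhds.inner hv2).const_mul _
    have hr : Tendsto (fun n => ⟪hb.toLp _, (h.memLp _ (hv n)).toLp (v n)⟫) atTop (𝓝 (0 : ℝ)) := by
      have := (tendsto_const_nhds (x := hb.toLp _)).inner (𝕜 := ℝ) hv1
      rwa [inner_zero_right] at this
    simp_rw [hn] at hl
    have hz := tendsto_nhds_unique hl hr
    have hz' := (mul_eq_zero.1 hz).resolve_left (NNReal.coe_ne_zero.2 (coordVar_pos k).ne')
    rw [L2.inner_def] at hz'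
    rw [← hz']
    refine integral_congr_ae ?_
    filter_upwards [ha.coeFn_toLp] with z h1
    rw [h1, real_inner_smul_left, mul_comm]
  refine Lp.ext ?_
  filter_upwards [ae_all_iff.2 hkey, Lp.coeFn_zero H 2 (lawH P β)] with z hz h0
  rw [h0]
  exact eq_zero_of_inner_e _ hz

end Closability

end BridgeForm

/-! ### Functions of `∫ λ(x) a(z(x)) dx` in the domain of the closed gradient -/

namespace BridgeForm

open DirichletForms

section Multiplication

/-- Multiplication by a continuous function on `H`. -/
noncomputable def mulL : C(I, ℝ) →L[ℝ] H →L[ℝ] H :=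
  ((ContinuousLinearMap.mul ℝ ℝ).holderL (volume : Measure I) ⊤ 2 2).comp
    (ContinuousMap.toLp ⊤ volume ℝ)

theorem coeFn_mulL (g : C(I, ℝ)) (h : H) : ⇑(mulL g h) =ᵐ[volume] fun x => g x * h x := by
  have h1 := (ContinuousLinearMap.mul ℝ ℝ).coeFn_holder (r := 2)
    (ContinuousMap.toLp ⊤ (volume : Measure I) ℝ g) h
  have h2 : ⇑(ContinuousMap.toLp ⊤ (volume : Measure I) ℝ g) =ᵐ[volume] g :=
    ContinuousMap.coeFn_toLp (p := ⊤) (𝕜 := ℝ) volume g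
  filter_upwards [h1, h2] with x hx hx'
  rw [← hx']
  exact hx

theorem mulL_ofC (g f : C(I, ℝ)) : mulL g (ofC f) = ofC (g * f) := by
  refine Lp.ext ?_
  filter_upwards [coeFn_mulL g (ofC f), coeFn_ofC f, coeFn_ofC (g * f)] with x h1 h2 h3
  rw [h1, h2, h3, ContinuousMap.mul_apply]

theorem norm_le_of_ae_le {h : H} {C : ℝ} (hC0 : 0 ≤ C) (hC : ∀ᵐ x ∂(volume : Measure I), ‖h x‖ ≤ C) :
    ‖h‖ ≤ C := by
  simpa [measureUnivNNReal] using Lp.norm_le_of_ae_bound hC0 hC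

theorem exists_lipschitzWith {f : ℝ → ℝ} (hf : BddSmooth f) : ∃ c, LipschitzWith c f := by
  obtain ⟨C, hC0, hC⟩ := hf.bound_fderiv
  refine ⟨⟨C, hC0⟩, lipschitzWith_of_nnnorm_fderiv_le (hf.differentiable) fun x => ?_⟩
  exact hC x

/-- The composition of a continuous function on the line with a continuous path. -/
def compC {f : ℝ → ℝ} (hf : Continuous f) (u : C(I, ℝ)) : C(I, ℝ) := ⟨fun x => f (u x), hf.comp u.2⟩

theorem ofC_compC {f : ℝ → ℝ} {c : NNReal} (hf : LipschitzWith c f) (h0 : f 0 = 0) (u : C(I, ℝ)) :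
    ofC (compC hf.continuous u) = hf.compLp h0 (ofC u) := by
  refine Lp.ext ?_
  filter_upwards [coeFn_ofC (compC hf.continuous u), coeFn_ofC u, hf.coeFn_compLp h0 (ofC u)]
    with x h1 h2 h3
  rw [h1, h3, Function.comp_apply, h2]
  rfl

end Multiplication

section Projection

/-- The partial sums of the expansion in the sine basis, as continuous functions. -/
noncomputable def partialSum (N : ℕ) (z : H) : C(I, ℝ) :=
  ∑ k : Fin N, ⟪e (k + 1), z⟫ • sinC (k + 1)

theorem ofC_partialSum (N : ℕ) (z : H) :
    ofC (partialSum N z) = ∑ k : Fin N, ⟪e (k + 1), z⟫ • e (k + 1) := by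
  rw [partialSum, map_sum]
  refine Finset.sum_congr rfl fun k _ => ?_
  rw [map_smul, ofC_sinC]

/-- The partial sum `p` is an orthogonal projection: `⟪p, p⟫ = ⟪p, z⟫`, and Cauchy–Schwarz
concludes. -/
theorem norm_ofC_partialSum_le (N : ℕ) (z : H) : ‖ofC (partialSum N z)‖ ≤ ‖z‖ := by
  have h1 : ⟪ofC (partialSum N z), ofC (partialSum N z)⟫ = ⟪ofC (partialSum N z), z⟫ := by
    conv_lhs => rw [real_inner_comm]
    rw [ofC_partialSum]
    conv_lhs => rw [inner_sum]
    conv_rhs => rw [sum_inner]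
    refine Finset.sum_congr rfl fun k _ => ?_
    rw [real_inner_smul_right, real_inner_smul_left, sum_inner, Finset.sum_eq_single k]
    · rw [real_inner_smul_left, inner_e_e, if_pos rfl, mul_one]
    · intro j _ hj
      rw [real_inner_smul_left, inner_e_e, if_neg (fun h => hj (Fin.ext h)), mul_zero]
    · simp
  rw [real_inner_self_eq_norm_sq] at h1
  have h2 := h1.trans_le (real_inner_le_norm _ _)
  by_contra! hlt
  have h3 : 0 < ‖ofC (partialSum N z)‖ := (norm_nonneg z).trans_lt hlt
  nlinarith

theorem tendsto_ofC_partialSum (z : H) :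
    Tendsto (fun N => ofC (partialSum N z)) atTop (𝓝 z) := by
  have h1 := (sineBasis.hasSum_repr z).tendsto_sum_nat
  refine h1.congr fun N => ?_
  rw [ofC_partialSum, Finset.sum_range]
  refine Finset.sum_congr rfl fun k _ => ?_
  rw [sineBasis.repr_apply_apply, sineBasis_apply]

/-- The kernel of the projection `partialSum N`. -/
noncomputable def projKernel (N : ℕ) : C(I, H) :=
  ⟨fun x => ∑ k : Fin N, sinC (k + 1) x • e (k + 1), by fun_prop⟩

theorem projKernel_mem (N : ℕ) (x : I) : projKernel N x ∈ testSpace :=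
  Submodule.sum_mem (t := Finset.univ) (f := fun k : Fin N => sinC (k + 1) x • e (k + 1)) testSpace
    fun k _ => Submodule.smul_mem _ _ (e_mem_testSpace k)

theorem inner_projKernel (N : ℕ) (x : I) (z : H) : ⟪projKernel N x, z⟫ = partialSum N z x := by
  simp only [projKernel, partialSum, ContinuousMap.coe_mk, sum_inner, real_inner_smul_left,
    ContinuousMap.coe_sum, Finset.sum_apply, ContinuousMap.coe_smul, Pi.smul_apply, smul_eq_mul]
  exact Finset.sum_congr rfl fun k _ => mul_comm _ _

theorem integral_smul_projKernel (N : ℕ) (f : C(I, ℝ)) :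
    ∫ x : I, f x • projKernel N x = ofC (partialSum N (ofC f)) := by
  have h1 : ∀ x, f x • projKernel N x = ∑ k : Fin N, (f x * sinC (k + 1) x) • e (k + 1) := by
    intro x
    simp only [projKernel, ContinuousMap.coe_mk, Finset.smul_sum, mul_smul]
  simp_rw [h1]
  rw [integral_finsetSum _ fun (k : Fin N) _ =>
    (show Integrable (fun x => (f x * sinC (k + 1) x) • e (k + 1)) volume from
      (integrable_ofC (f * sinC (k + 1))).smul_const (e (k + 1))), ofC_partialSum]
  refine Finset.sum_congr rfl fun k _ => ?_
  rw [integral_smul_const, ← ofC_sinC, inner_ofC]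
  simp_rw [mul_comm (f _)]

/-- The projections are contractions, so the vector may move with `N`. -/
theorem tendsto_ofC_partialSum_of_tendsto {h : ℕ → H} {z : H} (hz : Tendsto h atTop (𝓝 z)) :
    Tendsto (fun N => ofC (partialSum N (h N))) atTop (𝓝 z) := by
  have h1 : Tendsto (fun N => ofC (partialSum N (h N - z))) atTop (𝓝 0) :=
    squeeze_zero_norm (fun N => norm_ofC_partialSum_le N _) (tendsto_iff_norm_sub_tendsto_zero.1 hz)
  have h2 := h1.add (tendsto_ofC_partialSum z)
  rw [zero_add] at h2
  refine h2.congr fun N => ?_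
  rw [← map_add]
  congr 1
  simp only [partialSum, inner_sub_right, sub_smul, Finset.sum_sub_distrib, sub_add_cancel]

end Projection

section Superposition

variable {μ : Measure H} [IsFiniteMeasure μ] {m : ℕ} {ψ : (Fin m → ℝ) → ℝ} {l : Fin m → C(I, ℝ)}
  {a b : ℝ → ℝ}

theorem hasGradientAt_quad (w : C(I, H)) (g : C(I, ℝ)) (hac : Continuous a) (hbc : Continuous b)
    (hab : ∀ t, HasDerivAt a (b t) t) (M : ℕ) (z : H) :
    HasGradientAt (fun z => quad M (g * compC hac ⟨fun x => ⟪w x, z⟫, by fun_prop⟩))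
      (quad M ⟨fun x => (g x * b ⟪w x, z⟫) • w x, by fun_prop⟩) z := by
  rw [hasGradientAt_iff_hasFDerivAt]
  unfold quad
  have h1 : ∀ k : Fin (M + 1), HasFDerivAt
      (fun z => weight M k * (g (bernstein.z k) * a ⟪w (bernstein.z k), z⟫))
      ((weight M k * (g (bernstein.z k) * b ⟪w (bernstein.z k), z⟫)) •
        innerSL ℝ (w (bernstein.z k))) z := by
    intro k
    have := ((hab ⟪w (bernstein.z k), z⟫).comp_hasFDerivAt z
      (innerSL ℝ (w (bernstein.z k))).hasFDerivAt).const_mul (g (bernstein.z k))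
      |>.const_mul (weight M k)
    convert! this using 1
    simp only [smul_smul]
  refine (HasFDerivAt.fun_sum fun k (_ : k ∈ Finset.univ) => h1 k).congr_fderiv ?_
  ext h
  simp [mul_assoc]

theorem quad_comp_mem_cylindricalH {w : C(I, H)} (hw : ∀ x, w x ∈ testSpace) (hψ : BddSmooth ψ)
    (ha : BddSmooth a) (M : ℕ) :
    (fun z => ψ fun i => quad M (l i * compC ha.1.continuous ⟨fun x => ⟪w x, z⟫, by fun_prop⟩)) ∈
      cylindricalH := by
  refine mem_cylindricalH_of_fintype (ι := Fin (M + 1))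
    (ψ := fun y => ψ fun i => ∑ k, weight M k * (l i (bernstein.z k) * a (y k)))
    (l := fun k => w (bernstein.z k)) ?_ fun k => hw _
  refine hψ.comp (BddSmooth.pi fun i => BddSmooth.sum _ fun k => ?_)
  exact ((ha.comp_clm (ContinuousLinearMap.proj (R := ℝ) (φ := fun _ => ℝ) k)).const_mul _).const_mul _

/-- Replacing the integral in `x` by quadrature gives cylindrical functions, since each `w x` is a
test vector. Values and gradients converge pointwise and stay bounded. -/
theorem hasGrad_comp_integral_kernel {w : C(I, H)} (hw : ∀ x, w x ∈ testSpace) (hψ : BddSmooth ψ)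
    (ha : BddSmooth a) (hb : BddSmooth b) (hab : ∀ t, HasDerivAt a (b t) t) :
    (isL2Gradient_H μ).HasGrad (fun z => ψ fun i => ∫ x : I, l i x * a ⟪w x, z⟫)
      (fun z => gradVec ψ (fun i => ∫ x : I, l i x * a ⟪w x, z⟫)
        (fun i => ∫ x : I, (l i x * b ⟪w x, z⟫) • w x)) := by
  have hac := ha.1.continuous
  have hbc := hb.1.continuous
  obtain ⟨Cψ, hCψ0, hCψ⟩ := hψ.bound
  obtain ⟨Cψ', hCψ0', hCψ'⟩ := hψ.bound_fderiv
  obtain ⟨Cb, hCb0, hCb⟩ := hb.bound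
  have hgrad : ∀ M z, gradient (fun z => ψ fun i => quad M (l i * compC hac
      ⟨fun x => ⟪w x, z⟫, by fun_prop⟩)) z =
      gradVec ψ (fun i => quad M (l i * compC hac ⟨fun x => ⟪w x, z⟫, by fun_prop⟩))
        (fun i => quad M ⟨fun x => (l i x * b ⟪w x, z⟫) • w x, by fun_prop⟩) := fun M z =>
    (hasGradientAt_comp (hψ.differentiable _) fun i =>
      hasGradientAt_quad w (l i) hac hbc hab M z).gradient
  refine IsL2Gradient.HasGrad.of_tendsto (fun M => (isL2Gradient_H μ).hasGrad_of_mem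
    (quad_comp_mem_cylindricalH (l := l) hw hψ ha M)) (b := fun _ => Cψ)
    (b' := fun _ => ∑ i, Cψ' * ((‖l i‖ * Cb) * ‖w‖)) (memLp_const _) (memLp_const _)
    (fun M => Eventually.of_forall fun z => hCψ _) (fun M => Eventually.of_forall fun z => ?_)
    (Eventually.of_forall fun z => ?_) (Eventually.of_forall fun z => ?_)
  · rw [hgrad]
    refine (norm_gradVec_le hCψ' _ _).trans (Finset.sum_le_sum fun i _ => ?_)
    gcongr
    refine norm_quad_le_of_forall fun x => ?_
    rw [ContinuousMap.coe_mk, norm_smul, norm_mul]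
    gcongr
    · exact (l i).norm_coe_le_norm x
    · exact hCb _
    · exact w.norm_coe_le_norm x
  · refine (hψ.1.continuous.tendsto _).comp (tendsto_pi_nhds.2 fun i => ?_)
    exact tendsto_quad (l i * compC hac ⟨fun x => ⟪w x, z⟫, by fun_prop⟩)
  · simp_rw [hgrad]
    refine tendsto_gradVec hψ.continuous_fderiv (fun i => ?_) fun i => ?_
    · exact tendsto_quad (l i * compC hac ⟨fun x => ⟪w x, z⟫, by fun_prop⟩)
    · exact tendsto_quad (⟨fun x => (l i x * b ⟪w x, z⟫) • w x, by fun_prop⟩ : C(I, H))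

/-- The kernel lemma is applied to `projKernel N`, for which `⟪w x, z⟫` is the `N`-th partial sum at
`x`. The gradient then carries two projections, one inside `b` and one outside; both disappear as `N
→ ∞`. -/
theorem hasGrad_comp_compLp (hψ : BddSmooth ψ) (ha : BddSmooth a) (hb : BddSmooth b)
    (hab : ∀ t, HasDerivAt a (b t) t) {ca cb : NNReal} (hca : LipschitzWith ca a)
    (hcb : LipschitzWith cb b) (ha0 : a 0 = 0) (hb0 : b 0 = 0) :
    (isL2Gradient_H μ).HasGrad (fun z => ψ fun i => ⟪ofC (l i), hca.compLp ha0 z⟫)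
      (fun z => gradVec ψ (fun i => ⟪ofC (l i), hca.compLp ha0 z⟫)
        (fun i => mulL (l i) (hcb.compLp hb0 z))) := by
  obtain ⟨Cψ, hCψ0, hCψ⟩ := hψ.bound
  obtain ⟨Cψ', hCψ0', hCψ'⟩ := hψ.bound_fderiv
  obtain ⟨Cb, hCb0, hCb⟩ := hb.bound
  have e1 : ∀ N i z, ∫ x : I, l i x * a ⟪projKernel N x, z⟫ =
      ⟪ofC (l i), hca.compLp ha0 (ofC (partialSum N z))⟫ := by
    intro N i z
    simp_rw [inner_projKernel]
    rw [← ofC_compC, inner_ofC]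
    rfl
  have e2 : ∀ N i z, ∫ x : I, (l i x * b ⟪projKernel N x, z⟫) • projKernel N x =
      ofC (partialSum N (mulL (l i) (hcb.compLp hb0 (ofC (partialSum N z))))) := by
    intro N i z
    rw [← ofC_compC, mulL_ofC, ← integral_smul_projKernel]
    simp_rw [inner_projKernel]
    rfl
  have key : ∀ N, (isL2Gradient_H μ).HasGrad _ _ := fun N =>
    hasGrad_comp_integral_kernel (μ := μ) (l := l) (projKernel_mem N) hψ ha hb hab
  simp_rw [e1, e2] at key
  have ht := fun z => (hca.continuous_compLp (p := 2) (μ := (volume : Measure I)) ha0).tendsto z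
    |>.comp (tendsto_ofC_partialSum z)
  have ht' := fun z => (hcb.continuous_compLp (p := 2) (μ := (volume : Measure I)) hb0).tendsto z
    |>.comp (tendsto_ofC_partialSum z)
  refine IsL2Gradient.HasGrad.of_tendsto key (b := fun _ => Cψ)
    (b' := fun _ => ∑ i, Cψ' * (‖mulL (l i)‖ * Cb)) (memLp_const _) (memLp_const _)
    (fun M => Eventually.of_forall fun z => hCψ _) (fun M => Eventually.of_forall fun z => ?_)
    (Eventually.of_forall fun z => ?_) (Eventually.of_forall fun z => ?_)
  · refine (norm_gradVec_le hCψ' _ _).trans (Finset.sum_le_sum fun i _ => ?_)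
    gcongr
    refine (norm_ofC_partialSum_le _ _).trans (((mulL (l i)).le_opNorm _).trans ?_)
    gcongr
    refine norm_le_of_ae_le hCb0 ?_
    filter_upwards [hcb.coeFn_compLp hb0 (ofC (partialSum M z))] with x hx
    rw [hx]
    exact hCb _
  · exact (hψ.1.continuous.tendsto _).comp (tendsto_pi_nhds.2 fun i =>
      tendsto_const_nhds.inner (ht z))
  · refine tendsto_gradVec hψ.continuous_fderiv (fun i => tendsto_const_nhds.inner (ht z))
      fun i => ?_
    exact tendsto_ofC_partialSum_of_tendsto (((mulL (l i)).continuous.tendsto _).comp (ht' z))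

end Superposition

end BridgeForm

/-! ### The chain rule for the absolute value map -/

namespace BridgeForm

open DirichletForms

section AbsApprox

theorem exists_bumps_sign :
    ∃ χ : ℕ → ℝ → ℝ, (∀ n, ContDiff ℝ ∞ (χ n)) ∧ (∀ n, HasCompactSupport (χ n)) ∧
      (∀ n t, |χ n t| ≤ 1) ∧ (∀ n, χ n 0 = 0) ∧
      ∀ t, Tendsto (fun n => χ n t) atTop (𝓝 (Real.sign t)) := by
  have hpos : ∀ n : ℕ, (0 : ℝ) < 1 / (n + 1) := fun n => by positivity
  -- The bump is `1` on `[1/(n+1), n+1+1/(n+1)]` and vanishes to the left of `1/(2(n+1))`, hence on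
  -- `t ≤ 0`. Its odd part `χ n t - χ n (-t)` tends to the sign, with value `0` at `0`.
  choose χ h1 h2 h3 h4 h5 using fun n : ℕ =>
    exists_bump (1 / ((n : ℝ) + 1) + ((n : ℝ) + 1) / 2) (((n : ℝ) + 1) / 2)
      (((n : ℝ) + 1) / 2 + 1 / ((n : ℝ) + 1) / 2) (by positivity) (by linarith [hpos n])
  have hneg : ∀ n t, t ≤ 0 → χ n t = 0 := fun n t ht => by
    refine h5 n t ?_
    rw [abs_sub_comm]
    refine le_trans ?_ (le_abs_self _)
    linarith [hpos n]
  have hposlim : ∀ t, 0 < t → Tendsto (fun n => χ n t) atTop (𝓝 1) := fun t ht => by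
    have hev : ∀ᶠ n : ℕ in atTop, 1 / ((n : ℝ) + 1) < t :=
      tendsto_one_div_add_atTop_nhds_zero_nat.eventually_lt_const ht
    have hev' : ∀ᶠ n : ℕ in atTop, t ≤ (n : ℝ) :=
      tendsto_natCast_atTop_atTop.eventually_ge_atTop t
    refine tendsto_const_nhds.congr' ?_
    filter_upwards [hev, hev'] with n hn hn'
    refine (h4 n t ?_).symm
    rw [abs_le]
    constructor <;> linarith [hpos n]
  refine ⟨fun n t => χ n t - χ n (-t), fun n => (h1 n).sub ((h1 n).comp contDiff_neg),
    fun n => (h2 n).sub ((h2 n).comp_homeomorph (Homeomorph.neg ℝ)), fun n t => ?_, fun n => ?_,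
    fun t => ?_⟩
  · rw [abs_le]
    constructor <;> linarith [(h3 n t).1, (h3 n t).2, (h3 n (-t)).1, (h3 n (-t)).2]
  · simp
  · rcases lt_trichotomy t 0 with ht | rfl | ht
    · rw [Real.sign_of_neg ht]
      have := (hposlim (-t) (by linarith)).const_sub 0
      rw [zero_sub] at this
      refine this.congr fun n => ?_
      beta_reduce
      rw [hneg n t ht.le]
    · simp
    · rw [Real.sign_of_pos ht]
      refine (hposlim t ht).congr fun n => ?_
      beta_reduce
      rw [hneg n (-t) (by linarith), sub_zero]

theorem abs_sign_le (t : ℝ) : |Real.sign t| ≤ 1 := by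
  rcases Real.sign_apply_eq t with h | h | h <;> simp [h]

theorem integral_sign (t : ℝ) : ∫ s in (0 : ℝ)..t, Real.sign s = |t| := by
  rcases le_total 0 t with ht | ht
  · rw [intervalIntegral.integral_of_le ht, setIntegral_congr_fun measurableSet_Ioc
      (g := fun _ => (1 : ℝ)) fun s hs => Real.sign_of_pos hs.1]
    simp [ht, abs_of_nonneg]
  · rw [intervalIntegral.integral_symm, intervalIntegral.integral_of_le ht,
      integral_Ioc_eq_integral_Ioo, setIntegral_congr_fun measurableSet_Ioo
      (g := fun _ => (-1 : ℝ)) fun s hs => Real.sign_of_neg hs.2]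
    simp [ht, abs_of_nonpos]

theorem measurable_sign : Measurable Real.sign :=
  Measurable.ite measurableSet_Iio measurable_const
    (Measurable.ite measurableSet_Ioi measurable_const measurable_const)

/-- The sign of an element of `H`. -/
noncomputable def signL (z : H) : H :=
  (MemLp.of_bound (measurable_sign.comp_aemeasurable
    (Lp.aestronglyMeasurable z).aemeasurable).aestronglyMeasurable 1
    (Eventually.of_forall fun x => abs_sign_le (z x)) :
      MemLp (fun x => Real.sign (z x)) 2 volume).toLp _

theorem coeFn_signL (z : H) : ⇑(signL z) =ᵐ[volume] fun x => Real.sign (z x) :=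
  MemLp.coeFn_toLp _

theorem tendsto_compLp {a : ℕ → ℝ → ℝ} {ρ : ℝ → ℝ} {c : ℕ → NNReal}
    (hc : ∀ n, LipschitzWith (c n) (a n)) (h0 : ∀ n, a n 0 = 0)
    (hlim : ∀ t, Tendsto (fun n => a n t) atTop (𝓝 (ρ t))) {z y : H}
    (hy : ⇑y =ᵐ[volume] fun x => ρ (z x)) {b : I → ℝ} (hb : MemLp b 2 volume)
    (hab : ∀ n x, |a n (z x)| ≤ b x) :
    Tendsto (fun n => (hc n).compLp (h0 n) z) atTop (𝓝 y) := by
  have h1 := (tendsto_eLpNorm_two_of_dominated (m := (volume : Measure I))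
    (f := fun n x => a n (z x)) (g := fun x => ρ (z x)) (b := b)
    (fun n => (hc n).continuous.comp_aestronglyMeasurable (Lp.aestronglyMeasurable z)) hb
    (fun n => Eventually.of_forall fun x => hab n x) (Eventually.of_forall fun x => hlim _)).2
  rw [Lp.tendsto_Lp_iff_tendsto_eLpNorm']
  refine h1.congr fun n => eLpNorm_congr_ae ?_
  filter_upwards [(hc n).coeFn_compLp (h0 n) z, hy] with x h2 h3
  rw [Pi.sub_apply, Pi.sub_apply, h2, h3]
  rfl

variable {μ : Measure H} [IsFiniteMeasure μ] {m : ℕ} {ψ : (Fin m → ℝ) → ℝ} {l : Fin m → C(I, ℝ)}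

/-- The absolute value is the primitive of the sign. Primitives of the bumps from
`exists_bumps_sign` replace `|t|`, and bounded convergence passes both values and gradients to the
limit. -/
theorem hasGrad_comp_abs (hψ : BddSmooth ψ) :
    (isL2Gradient_H μ).HasGrad (fun z => ψ fun i => ⟪ofC (l i), |z|⟫)
      (fun z => gradVec ψ (fun i => ⟪ofC (l i), |z|⟫) (fun i => mulL (l i) (signL z))) := by
  obtain ⟨χ, h1, h2, h3, h4, h5⟩ := exists_bumps_sign
  have ha : ∀ n, BddSmooth (fun t => ∫ s in (0 : ℝ)..t, χ n s) := fun n =>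
    bddSmooth_primitive (h1 n) (h2 n)
  have hb : ∀ n, BddSmooth (χ n) := fun n => BddSmooth.of_hasCompactSupport (h1 n) (h2 n)
  choose ca hca using fun n => exists_lipschitzWith (ha n)
  choose cb hcb using fun n => exists_lipschitzWith (hb n)
  have ha0 : ∀ n, ∫ s in (0 : ℝ)..0, χ n s = 0 := fun n => by simp
  obtain ⟨Cψ, hCψ0, hCψ⟩ := hψ.bound
  obtain ⟨Cψ', hCψ0', hCψ'⟩ := hψ.bound_fderiv
  have key : ∀ n, (isL2Gradient_H μ).HasGrad _ _ := fun n =>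
    hasGrad_comp_compLp (μ := μ) (l := l) hψ (ha n) (hb n)
      (hasDerivAt_primitive (h1 n).continuous) (hca n) (hcb n) (ha0 n) (h4 n)
  have ht : ∀ z, Tendsto (fun n => (hca n).compLp (ha0 n) z) atTop (𝓝 |z|) := fun z => by
    refine tendsto_compLp hca ha0 (ρ := fun t => |t|) (fun t => ?_) (Lp.coeFn_abs z)
      (Lp.memLp z).norm fun n x => ?_
    · rw [← integral_sign]
      exact tendsto_primitive (fun n => (h1 n).continuous) h3 h5 t
    · simpa using abs_primitive_le (h3 n) (z x)
  have ht' : ∀ z, Tendsto (fun n => (hcb n).compLp (h4 n) z) atTop (𝓝 (signL z)) := fun z =>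
    tendsto_compLp hcb h4 h5 (coeFn_signL z) (memLp_const 1) fun n x => h3 n _
  refine IsL2Gradient.HasGrad.of_tendsto key (b := fun _ => Cψ)
    (b' := fun _ => ∑ i, Cψ' * (‖mulL (l i)‖ * 1)) (memLp_const _) (memLp_const _)
    (fun M => Eventually.of_forall fun z => hCψ _) (fun M => Eventually.of_forall fun z => ?_)
    (Eventually.of_forall fun z => ?_) (Eventually.of_forall fun z => ?_)
  · refine (norm_gradVec_le hCψ' _ _).trans (Finset.sum_le_sum fun i _ => ?_)
    gcongr
    refine ((mulL (l i)).le_opNorm _).trans ?_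
    gcongr
    refine norm_le_of_ae_le zero_le_one ?_
    filter_upwards [(hcb M).coeFn_compLp (h4 M) z] with x hx
    rw [hx]
    exact h3 M _
  · exact (hψ.1.continuous.tendsto _).comp (tendsto_pi_nhds.2 fun i =>
      tendsto_const_nhds.inner (ht z))
  · exact tendsto_gradVec hψ.continuous_fderiv (fun i => tendsto_const_nhds.inner (ht z))
      fun i => ((mulL (l i)).continuous.tendsto _).comp (ht' z)

end AbsApprox

/-! ### The gradients of `f` and of `f ∘ j` have equal norms -/

section Isometry

theorem gradVec_mulL {ι : Type*} [Fintype ι] [DecidableEq ι] (ψ : (ι → ℝ) → ℝ) (y : ι → ℝ)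
    (l : ι → C(I, ℝ)) (s : H) : gradVec ψ y (fun i => mulL (l i) s) =
      mulL (∑ i, fderiv ℝ ψ y (Pi.single i 1) • l i) s := by
  simp [gradVec]

theorem gradVec_ofC {ι : Type*} [Fintype ι] [DecidableEq ι] (ψ : (ι → ℝ) → ℝ) (y : ι → ℝ)
    (l : ι → C(I, ℝ)) : gradVec ψ y (fun i => ofC (l i)) =
      ofC (∑ i, fderiv ℝ ψ y (Pi.single i 1) • l i) := by
  simp [gradVec]

/-- Off the zero set the sign has modulus one. This is where nullity of the zero set is needed. -/
theorem norm_mulL_signL {z : H} (hz : ∀ᵐ x ∂(volume : Measure I), z x ≠ 0) (g : C(I, ℝ)) :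
    ‖mulL g (signL z)‖ = ‖ofC g‖ := by
  have h1 : ∀ᵐ x ∂(volume : Measure I), ‖mulL g (signL z) x‖ = ‖ofC g x‖ := by
    filter_upwards [coeFn_mulL g (signL z), coeFn_ofC g, coeFn_signL z, hz] with x h1 h2 h3 h4
    rw [h1, h2, h3, norm_mul]
    rcases lt_or_gt_of_ne h4 with h | h
    · simp [Real.sign_of_neg h]
    · simp [Real.sign_of_pos h]
  exact le_antisymm (Lp.norm_le_norm_of_ae_le (h1.mono fun x hx => hx.le))
    (Lp.norm_le_norm_of_ae_le (h1.mono fun x hx => hx.ge))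

/-- The common factor `signL z` comes out of the gradient of `f ∘ j`; what it multiplies is the
gradient of the extension of `f` at `|z|`. -/
theorem exists_hasGrad_comp_j {μ : Measure H} [IsFiniteMeasure μ]
    (hμ : ∀ᵐ z ∂μ, ∀ᵐ x ∂(volume : Measure I), z x ≠ 0) {f : K → ℝ} (hf : f ∈ cylindricalK) :
    ∃ g : H → H, (isL2Gradient_H μ).HasGrad (f ∘ j) g ∧ ∀ᵐ z ∂μ, ‖g z‖ = ‖gradK f (j z)‖ := by
  obtain ⟨F, hF, h⟩ := hf
  obtain ⟨m, ψ, l, hψ, hl, rfl⟩ := mem_cylindricalH_iff.1 hF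
  choose c hc using fun i => exists_of_mem_testSpace (hl i)
  obtain rfl : l = fun i => ofC (c i) := funext fun i => (hc i).symm
  refine ⟨_, (hasGrad_comp_abs (l := c) hψ).congr (Eventually.of_forall fun z => (h (j z)).symm)
    ae_eq_rfl, ?_⟩
  filter_upwards [hμ] with z hz
  rw [gradK_eq_gradient hF h, gradient_cylindrical hψ, gradVec_mulL, gradVec_ofC,
    norm_mulL_signL hz]
  rfl

end Isometry

end BridgeForm

/-! ### A nest of compact sets -/

namespace BridgeForm

open DirichletForms

theorem exists_weights {a : ℕ → ℝ} (ha0 : ∀ k, 0 ≤ a k) (ha : Summable a) :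
    ∃ c : ℕ → ℝ, (∀ k, 1 ≤ c k) ∧ Tendsto c atTop atTop ∧ Summable fun k => c k ^ 2 * a k := by
  -- The geometric term keeps every tail `r k` positive. The weight is essentially `r ^ (-1/4)`.
  let a' : ℕ → ℝ := fun k => a k + (1 / 2) ^ k
  have hpos : ∀ k, 0 < a' k := fun k => add_pos_of_nonneg_of_pos (ha0 k) (by positivity)
  have hsum : Summable a' := ha.add summable_geometric_two
  let r : ℕ → ℝ := fun k => ∑' i, a' (i + k)
  have hr : ∀ k, r k = a' k + r (k + 1) := fun k => by
    have := ((summable_nat_add_iff k).2 hsum).tsum_eq_zero_add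
    simp only [zero_add] at this
    rw [show r k = _ from this]
    congr 1
    refine tsum_congr fun i => ?_
    congr 1
    ring
  have hr0 : ∀ k, 0 ≤ r k := fun k => tsum_nonneg fun i => (hpos _).le
  have hrpos : ∀ k, 0 < r k := fun k => by rw [hr k]; linarith [hpos k, hr0 (k + 1)]
  have hlim : Tendsto r atTop (𝓝 0) := tendsto_sum_nat_add a'
  have hsq : Tendsto (fun k => √(√(r k))) atTop (𝓝[>] 0) := by
    refine tendsto_nhdsWithin_iff.2 ⟨?_, Eventually.of_forall fun k =>
      Real.sqrt_pos.2 (Real.sqrt_pos.2 (hrpos k))⟩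
    have h1 := ((Real.continuous_sqrt.comp Real.continuous_sqrt).tendsto 0).comp hlim
    simpa [Function.comp_def] using h1
  have hinv := tendsto_inv_nhdsGT_zero.comp hsq
  have key : Summable fun k => (√(√(r k)))⁻¹ ^ 2 * a' k := by
    refine summable_of_sum_range_le (c := 2 * √(r 0))
      (fun k => mul_nonneg (by positivity) (hpos k).le) fun n => ?_
    -- As `a' k = r k - r (k + 1)`, the term `a' k / √(r k)` is at most `2(√(r k) - √(r (k + 1)))`,
    -- and the sum telescopes.
    have hk : ∀ k, (√(√(r k)))⁻¹ ^ 2 * a' k ≤ 2 * (√(r k) - √(r (k + 1))) := by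
      intro k
      have hs := Real.sqrt_pos.2 (hrpos k)
      rw [inv_pow, Real.sq_sqrt hs.le, inv_mul_le_iff₀ hs]
      have h1 := Real.sq_sqrt (hrpos k).le
      have h2 := Real.sq_sqrt (hrpos (k + 1)).le
      nlinarith [hr k, sq_nonneg (√(r k) - √(r (k + 1)))]
    refine (Finset.sum_le_sum fun k _ => hk k).trans ?_
    rw [← Finset.mul_sum, Finset.sum_range_sub']
    have := Real.sqrt_nonneg (r n)
    linarith
  refine ⟨fun k => 1 + (√(√(r k)))⁻¹, fun k => le_add_of_nonneg_right (by positivity),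
    tendsto_atTop_add_const_left _ _ hinv, ?_⟩
  refine Summable.of_nonneg_of_le (fun k => mul_nonneg (sq_nonneg _) (ha0 k)) (fun k => ?_)
    ((ha.mul_left 2).add (key.mul_left 2))
  have h1 : a k ≤ a' k := le_add_of_nonneg_right (by positivity)
  have h2 := mul_le_mul_of_nonneg_left h1 (sq_nonneg (√(√(r k)))⁻¹)
  have h3 := mul_nonneg (sq_nonneg (1 - (√(√(r k)))⁻¹)) (ha0 k)
  nlinarith

section Weighted

/-- The partial sums of `∑ c_k ⟪e_k, z⟫²`. -/
noncomputable def weightedSq (c : ℕ → ℝ) (m : ℕ) (z : H) : ℝ :=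
  ∑ k : Fin m, c k * ⟪e (k + 1), z⟫ ^ 2

/-- The partial sums of `∑ c_k ⟪e_k, z⟫ e_k`. -/
noncomputable def weightedSum (c : ℕ → ℝ) (m : ℕ) (z : H) : H :=
  ∑ k : Fin m, (c k * ⟪e (k + 1), z⟫) • e (k + 1)

variable {c : ℕ → ℝ}

/-- By Riesz–Fischer there is a vector of `H` with coordinates `c k * ⟪e (k + 1), z⟫`; the weighted
sums are its projections. -/
theorem weightedSum_tsum {z : H} (hz : Summable fun k => (c k * ⟪e (k + 1), z⟫) ^ 2) :
    Tendsto (fun m => weightedSum c m z) atTop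
      (𝓝 (∑' k, (c k * ⟪e (k + 1), z⟫) • e (k + 1))) ∧
    (∀ m, ‖weightedSum c m z‖ ≤ ‖∑' k, (c k * ⟪e (k + 1), z⟫) • e (k + 1)‖) ∧
    HasSum (fun k => (c k * ⟪e (k + 1), z⟫) ^ 2)
      (‖∑' k, (c k * ⟪e (k + 1), z⟫) • e (k + 1)‖ ^ 2) := by
  have hmem : Memℓp (fun k => c k * ⟪e (k + 1), z⟫ : ℕ → ℝ) 2 :=
    memℓp_gen (by simpa [← abs_mul] using hz)
  let x : lp (fun _ : ℕ => ℝ) 2 := ⟨_, hmem⟩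
  have hV : HasSum (fun k => (c k * ⟪e (k + 1), z⟫) • e (k + 1)) (sineBasis.repr.symm x) := by
    have := sineBasis.hasSum_repr_symm x
    simp_rw [sineBasis_apply] at this
    exact this
  rw [hV.tsum_eq]
  have hcoord : ∀ k, ⟪e (k + 1), sineBasis.repr.symm x⟫ = c k * ⟪e (k + 1), z⟫ := by
    intro k
    rw [← sineBasis_apply, ← sineBasis.repr_apply_apply, LinearIsometryEquiv.apply_symm_apply,
      sineBasis_apply]
  have hsum : ∀ m, weightedSum c m z = ofC (partialSum m (sineBasis.repr.symm x)) := by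
    intro m
    rw [ofC_partialSum]
    simp_rw [hcoord]
    rfl
  refine ⟨?_, fun m => ?_, ?_⟩
  · simp_rw [hsum]
    exact tendsto_ofC_partialSum _
  · rw [hsum]
    exact norm_ofC_partialSum_le _ _
  · have := norm_sq_eq_tsum (sineBasis.repr.symm x)
    simp_rw [hcoord] at this
    exact this

theorem summable_weightedSq (hc : ∀ k, 1 ≤ c k) {z : H}
    (hz : Summable fun k => (c k * ⟪e (k + 1), z⟫) ^ 2) :
    Summable fun k => c k * ⟪e (k + 1), z⟫ ^ 2 := by
  refine Summable.of_nonneg_of_le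
    (fun k => mul_nonneg (zero_le_one.trans (hc k)) (sq_nonneg _)) (fun k => ?_) hz
  rw [mul_pow]
  exact mul_le_mul_of_nonneg_right (by nlinarith [hc k]) (sq_nonneg _)

theorem weightedSq_tsum (hc : ∀ k, 1 ≤ c k) {z : H}
    (hz : Summable fun k => c k * ⟪e (k + 1), z⟫ ^ 2) :
    Tendsto (fun m => weightedSq c m z) atTop (𝓝 (∑' k, c k * ⟪e (k + 1), z⟫ ^ 2)) ∧
    ∀ m, weightedSq c m z ≤ ∑' k, c k * ⟪e (k + 1), z⟫ ^ 2 := by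
  have h1 : ∀ m, weightedSq c m z = ∑ k ∈ Finset.range m, c k * ⟪e (k + 1), z⟫ ^ 2 := fun m => by
    rw [Finset.sum_range]
    rfl
  refine ⟨?_, fun m => ?_⟩
  · simp_rw [h1]
    exact hz.hasSum.tendsto_sum_nat
  · rw [h1]
    exact hz.sum_le_tsum _ fun k _ => mul_nonneg (zero_le_one.trans (hc k)) (sq_nonneg _)

theorem continuous_weightedSq (c : ℕ → ℝ) (m : ℕ) : Continuous (weightedSq c m) := by
  unfold weightedSq
  fun_prop

theorem coord_sq_le_of_weightedSq_le (hc : ∀ k, 1 ≤ c k) {R : ℝ} {z : H}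
    (hz : ∀ m, weightedSq c m z ≤ R) (k : ℕ) : c k * ⟪e (k + 1), z⟫ ^ 2 ≤ R := by
  refine le_trans ?_ (hz (k + 1))
  exact Finset.single_le_sum (f := fun i : Fin (k + 1) => c i * ⟪e (i + 1), z⟫ ^ 2)
    (fun i _ => mul_nonneg (zero_le_one.trans (hc i)) (sq_nonneg _))
    (Finset.mem_univ (Fin.last k))

/-- Beyond `N` the weights exceed `1/δ`, so each squared coordinate of the tail is at most `δ` times
its weighted version. -/
theorem norm_sub_partialSum_sq_le (hc : ∀ k, 1 ≤ c k) {R δ : ℝ} (hδ : 0 ≤ δ) {z : H}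
    (hz : ∀ m, weightedSq c m z ≤ R) {N : ℕ} (hN : ∀ k, N ≤ k → 1 ≤ δ * c k) :
    ‖z - ofC (partialSum N z)‖ ^ 2 ≤ δ * R := by
  have hcoord : ∀ k, ⟪e (k + 1), z - ofC (partialSum N z)⟫ ^ 2 ≤
      δ * (c k * ⟪e (k + 1), z⟫ ^ 2) := by
    intro k
    have h0 : 0 ≤ δ * (c k * ⟪e (k + 1), z⟫ ^ 2) :=
      mul_nonneg hδ (mul_nonneg (zero_le_one.trans (hc k)) (sq_nonneg _))
    rw [inner_sub_right, ofC_partialSum, inner_sum]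
    by_cases hk : k < N
    · rw [Finset.sum_eq_single ⟨k, hk⟩]
      · rw [real_inner_smul_right, inner_e_e, if_pos rfl, mul_one, sub_self]
        simpa using h0
      · intro i _ hi
        rw [real_inner_smul_right, inner_e_e, if_neg (fun h => hi (Fin.ext h.symm)), mul_zero]
      · simp
    · rw [Finset.sum_eq_zero, sub_zero]
      · nlinarith [hN k (not_lt.1 hk), sq_nonneg ⟪e (k + 1), z⟫]
      · intro i _
        rw [real_inner_smul_right, inner_e_e, if_neg (fun h : k = i => hk (h ▸ i.2)), mul_zero]
  have h1 := norm_sq_eq_tsum (z - ofC (partialSum N z))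
  rw [← h1.tsum_eq]
  refine h1.summable.tsum_le_of_sum_range_le fun m => ?_
  refine (Finset.sum_le_sum fun k _ => hcoord k).trans ?_
  rw [← Finset.mul_sum, Finset.sum_range]
  exact mul_le_mul_of_nonneg_left (hz m) hδ

theorem isCompact_weightedSq_le (hc : ∀ k, 1 ≤ c k) (hlim : Tendsto c atTop atTop) {R : ℝ}
    (hR : 0 < R) : IsCompact {z : H | ∀ m, weightedSq c m z ≤ R} := by
  refine TotallyBounded.isCompact_of_isClosed ?_ ?_
  · rw [Metric.totallyBounded_iff]
    intro ε hε
    -- With this threshold the tail beyond `N` has norm at most `ε / 4`; the first `N` coordinates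
    -- range over a compact cube, covered by balls of radius `ε / 2`.
    obtain ⟨N, hN⟩ := eventually_atTop.1 (hlim.eventually_ge_atTop (16 * R / ε ^ 2))
    have hδ : ∀ k, N ≤ k → 1 ≤ ε ^ 2 / (16 * R) * c k := fun k hk => by
      have := hN k hk
      rw [div_le_iff₀ (by positivity)] at this
      rw [div_mul_eq_mul_div, le_div_iff₀ (by positivity)]
      linarith
    let T : (Fin N → ℝ) → H := fun y => ∑ k : Fin N, y k • e (k + 1)
    have hT : Continuous T := by fun_prop
    have hcomp : IsCompact (T '' Set.pi univ fun _ => Icc (-√R) (√R)) :=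
      (isCompact_univ_pi fun _ => isCompact_Icc).image hT
    obtain ⟨t, ht, htcov⟩ := Metric.totallyBounded_iff.1 hcomp.totallyBounded (ε / 2) (by positivity)
    refine ⟨t, ht, fun z hz => ?_⟩
    have hmem : ofC (partialSum N z) ∈ T '' Set.pi univ fun _ => Icc (-√R) (√R) := by
      refine ⟨fun k => ⟪e (k + 1), z⟫, fun k _ => ?_, (ofC_partialSum N z).symm⟩
      rw [mem_Icc, ← abs_le]
      refine Real.abs_le_sqrt ?_
      have h1 := coord_sq_le_of_weightedSq_le hc hz k
      nlinarith [hc k, sq_nonneg ⟪e ((k : ℕ) + 1), z⟫]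
    obtain ⟨y, hy, hyb⟩ := mem_iUnion₂.1 (htcov hmem)
    refine mem_iUnion₂.2 ⟨y, hy, ?_⟩
    have h1 := norm_sub_partialSum_sq_le hc (by positivity) hz hδ
    have h2 : ε ^ 2 / (16 * R) * R = (ε / 4) ^ 2 := by
      field_simp
      ring
    rw [h2] at h1
    have h3 := abs_le_of_sq_le_sq h1 (by positivity)
    rw [Metric.mem_ball] at hyb ⊢
    have h4 : dist z (ofC (partialSum N z)) ≤ ε / 4 := by
      rw [dist_eq_norm]
      exact (le_abs_self _).trans h3
    linarith [dist_triangle z (ofC (partialSum N z)) y]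
  · simp only [ofPred_forall]
    exact isClosed_iInter fun m => isClosed_le (continuous_weightedSq c m) continuous_const

theorem hasGradientAt_weightedSq (c : ℕ → ℝ) (m : ℕ) (z : H) :
    HasGradientAt (weightedSq c m) ((2 : ℝ) • weightedSum c m z) z := by
  rw [hasGradientAt_iff_hasFDerivAt]
  have h1 : ∀ k : Fin m, HasFDerivAt (fun z => c k * ⟪e (k + 1), z⟫ ^ 2)
      ((2 * (c k * ⟪e (k + 1), z⟫)) • innerSL ℝ (e ((k : ℕ) + 1))) z := by
    intro k
    have := (((innerSL ℝ (e ((k : ℕ) + 1))).hasFDerivAt (x := z)).pow 2).const_mul (c k)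
    convert! this using 1
    simp only [smul_smul]
    congr 1
    simp
    ring
  refine (HasFDerivAt.fun_sum fun k (_ : k ∈ Finset.univ) => h1 k).congr_fderiv ?_
  ext h
  simp [weightedSum, Finset.smul_sum, smul_smul]

variable {η : ℝ → ℝ}

/-- Weights at least `1` confine the support to `|y k| ≤ √(2/r)`, so the function of the coordinates
is smooth with compact support. -/
theorem cutoff_mem_cylindricalH (hc : ∀ k, 1 ≤ c k) (hη : ContDiff ℝ ∞ η)
    (hη0 : ∀ t, 2 ≤ |t| → η t = 0) {r : ℝ} (hr : 0 < r) (m : ℕ) :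
    (fun z => η (r * weightedSq c m z)) ∈ cylindricalH := by
  refine mem_cylindricalH_of_fintype (ι := Fin m) (l := fun k => e (k + 1))
    (ψ := fun y => η (r * ∑ k : Fin m, c k * y k ^ 2)) ?_ fun k => e_mem_testSpace k
  refine BddSmooth.of_hasCompactSupport (hη.comp (by fun_prop)) ?_
  refine HasCompactSupport.intro (isCompact_closedBall (0 : Fin m → ℝ) (√(2 / r))) fun y hy => ?_
  refine hη0 _ ?_
  by_contra! hlt
  refine hy (mem_closedBall_zero_iff.2 ((pi_norm_le_iff_of_nonneg (Real.sqrt_nonneg _)).2 fun k => ?_))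
  refine Real.abs_le_sqrt ?_
  rw [le_div_iff₀ hr]
  have h1 : c k * y k ^ 2 ≤ ∑ k : Fin m, c k * y k ^ 2 :=
    Finset.single_le_sum (f := fun k : Fin m => c k * y k ^ 2)
      (fun i _ => mul_nonneg (zero_le_one.trans (hc i)) (sq_nonneg _)) (Finset.mem_univ k)
  have h2 : y k ^ 2 ≤ c k * y k ^ 2 := by nlinarith [hc k, sq_nonneg (y k)]
  have h3 := (le_abs_self _).trans_lt hlt
  nlinarith

theorem gradient_cutoff (hη : ContDiff ℝ ∞ η) (r : ℝ) (m : ℕ) (z : H) :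
    gradient (fun z => η (r * weightedSq c m z)) z =
      (deriv η (r * weightedSq c m z) * r * 2) • weightedSum c m z := by
  have h1 := (hasGradientAt_weightedSq c m z)
  have hd : HasDerivAt (fun t => η (r * t)) (deriv η (r * weightedSq c m z) * r)
      (weightedSq c m z) := by
    have hη' : HasDerivAt η (deriv η (r * weightedSq c m z)) (r * weightedSq c m z) :=
      ((hη.differentiable (by simp)) _).hasDerivAt
    have := hη'.comp (weightedSq c m z) ((hasDerivAt_id (weightedSq c m z)).const_mul r)
    simpa [Function.comp_def] using this
  have h2 := gradient_real_comp (φ := fun t => η (r * t)) hd.differentiableAt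
    h1.hasFDerivAt.differentiableAt
  rw [hd.deriv, h1.gradient, smul_smul] at h2
  exact h2

theorem cutoff_mul_mem_cylindricalK (hc : ∀ k, 1 ≤ c k) (hη : ContDiff ℝ ∞ η)
    (hη0 : ∀ t, 2 ≤ |t| → η t = 0) {r : ℝ} (hr : 0 < r) (m : ℕ) {f : K → ℝ}
    (hf : f ∈ cylindricalK) :
    (fun z : K => η (r * weightedSq c m z) * f z) ∈ cylindricalK ∧
      ∀ z : K, gradK (fun z : K => η (r * weightedSq c m z) * f z) z =
        η (r * weightedSq c m z) • gradK f z +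
          (f z * (deriv η (r * weightedSq c m z) * r * 2)) • weightedSum c m (z : H) := by
  obtain ⟨F, hF, h⟩ := hf
  have hΘ := cutoff_mem_cylindricalH hc hη hη0 hr m
  have hmul := mul_mem_cylindricalH hΘ hF
  have hval : ∀ z : K, η (r * weightedSq c m z) * f z =
      ((fun z => η (r * weightedSq c m z)) * F) z := fun z => by rw [h]; rfl
  refine ⟨⟨_, hmul, hval⟩, fun z => ?_⟩
  rw [gradK_eq_gradient hmul hval, gradK_eq_gradient hF h,
    gradient_mul (differentiable_of_mem_cylindricalH hΘ _)
      (differentiable_of_mem_cylindricalH hF _), gradient_cutoff hη, smul_smul, h]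

end Weighted

end BridgeForm

/-! ### Compact nests, quasi-regularity and the conclusion -/

namespace BridgeForm

open DirichletForms

section CompactNest

variable {ν : Measure K}

theorem integrable_coord_sq (hν : Integrable (fun z : K => ‖(z : H)‖ ^ 2) ν) (k : ℕ) :
    Integrable (fun z : K => ⟪e (k + 1), (z : H)⟫ ^ 2) ν := by
  refine hν.mono' (Continuous.aestronglyMeasurable (by fun_prop)) (Eventually.of_forall fun z => ?_)
  rw [Real.norm_of_nonneg (sq_nonneg _)]
  exact le_hasSum (norm_sq_eq_tsum (z : H)) k fun j _ => sq_nonneg _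

theorem summable_integral_coord_sq (hν : Integrable (fun z : K => ‖(z : H)‖ ^ 2) ν) :
    Summable fun k => ∫ z : K, ⟪e (k + 1), (z : H)⟫ ^ 2 ∂ν := by
  refine summable_of_sum_range_le (c := ∫ z : K, ‖(z : H)‖ ^ 2 ∂ν)
    (fun k => integral_nonneg fun z => sq_nonneg _) fun n => ?_
  rw [← integral_finsetSum _ fun k _ => integrable_coord_sq hν k]
  refine integral_mono (integrable_finsetSum _ fun k _ => integrable_coord_sq hν k) hν fun z => ?_
  exact sum_le_hasSum _ (fun k _ => sq_nonneg _) (norm_sq_eq_tsum (z : H))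

/-- Monotone convergence makes `∑ (c_k ⟪e_k, z⟫)²` integrable. It is the squared norm of the
weighted series, which is half the gradient of `∑ c_k ⟪e_k, z⟫²`. -/
theorem ae_summable_memLp_weightedSum (hν : Integrable (fun z : K => ‖(z : H)‖ ^ 2) ν) {c : ℕ → ℝ}
    (hc : Summable fun k => c k ^ 2 * ∫ z : K, ⟪e (k + 1), (z : H)⟫ ^ 2 ∂ν) :
    (∀ᵐ z : K ∂ν, Summable fun k => (c k * ⟪e (k + 1), (z : H)⟫) ^ 2) ∧
      MemLp (fun z : K => ∑' k, (c k * ⟪e (k + 1), (z : H)⟫) • e (k + 1)) 2 ν := by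
  have hfin : ∫⁻ z : K, ∑' k, ENNReal.ofReal ((c k * ⟪e (k + 1), (z : H)⟫) ^ 2) ∂ν ≠ ⊤ := by
    rw [lintegral_tsum (f := fun k (z : K) => ENNReal.ofReal ((c k * ⟪e (k + 1), (z : H)⟫) ^ 2))
      fun k => (ENNReal.measurable_ofReal.comp (Continuous.measurable (by fun_prop))).aemeasurable]
    have : ∀ k, ∫⁻ z : K, ENNReal.ofReal ((c k * ⟪e (k + 1), (z : H)⟫) ^ 2) ∂ν =
        ENNReal.ofReal (c k ^ 2 * ∫ z : K, ⟪e (k + 1), (z : H)⟫ ^ 2 ∂ν) := by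
      intro k
      simp_rw [mul_pow]
      rw [← integral_const_mul, ofReal_integral_eq_lintegral_ofReal
        ((integrable_coord_sq hν k).const_mul _) (Eventually.of_forall fun z => by positivity)]
    simp_rw [this]
    rw [← ENNReal.ofReal_tsum_of_nonneg (fun k => mul_nonneg (sq_nonneg _)
      (integral_nonneg fun z => sq_nonneg _)) hc]
    exact ENNReal.ofReal_ne_top
  have hsum : ∀ᵐ z : K ∂ν, Summable fun k => (c k * ⟪e (k + 1), (z : H)⟫) ^ 2 := by
    have hm : Measurable fun z : K => ∑' k, ENNReal.ofReal ((c k * ⟪e (k + 1), (z : H)⟫) ^ 2) :=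
      Measurable.tsum fun k =>
        ENNReal.measurable_ofReal.comp (Continuous.measurable (by fun_prop))
    filter_upwards [ae_lt_top hm hfin] with z hz
    have := ENNReal.summable_toReal hz.ne
    simpa only [ENNReal.toReal_ofReal (sq_nonneg _)] using this
  refine ⟨hsum, ?_⟩
  have hmeas : AEStronglyMeasurable
      (fun z : K => ∑' k, (c k * ⟪e (k + 1), (z : H)⟫) • e (k + 1)) ν := by
    refine aestronglyMeasurable_of_tendsto_ae atTop (f := fun m (z : K) => weightedSum c m (z : H))
      (fun m => Continuous.aestronglyMeasurable ?_) ?_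
    · unfold weightedSum
      fun_prop
    · filter_upwards [hsum] with z hz
      exact (weightedSum_tsum hz).1
  rw [memLp_two_iff_integrable_sq_norm hmeas]
  refine (lintegral_ofReal_ne_top_iff_integrable (hmeas.norm.pow 2)
    (Eventually.of_forall fun z => sq_nonneg _)).1 ?_
  convert hfin using 1
  refine lintegral_congr_ae ?_
  filter_upwards [hsum] with z hz
  rw [← ENNReal.ofReal_tsum_of_nonneg (fun k => sq_nonneg _) hz,
    (weightedSum_tsum hz).2.2.tsum_eq]
  rfl

/-- A cylindrical `f` is multiplied by `η(S/(n+1))`, `S = ∑ c_k ⟪e_k, z⟫²`, which vanishes off the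
`n`-th compact set. The gradient of the cut-off is at most a multiple of `‖W‖`, which lies in `L²`,
and for each `z` it vanishes for large `n` because `η = 1` near `0`. -/
theorem exists_compact_nest [IsFiniteMeasure ν] (hν : Integrable (fun z : K => ‖(z : H)‖ ^ 2) ν)
    (hs : SingleValued (isL2Gradient_K ν).closedGraph) :
    ∃ F : ℕ → Set K, IsNest (graphForm (isL2Gradient_K ν).closedGraph) F ∧
      ∀ k, IsCompact (F k) := by
  obtain ⟨c, hc1, hclim, hcs⟩ := exists_weights
    (fun k => integral_nonneg fun z => sq_nonneg _) (summable_integral_coord_sq hν)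
  obtain ⟨hsum, hW⟩ := ae_summable_memLp_weightedSum hν hcs
  obtain ⟨η, hη, hηc, hη01, hη1, hη0⟩ := exists_bump 0 1 2 one_pos one_lt_two
  simp only [sub_zero] at hη1 hη0
  obtain ⟨C', hC'0, hC'⟩ := (BddSmooth.of_hasCompactSupport hη hηc).bound_fderiv
  have hηb : ∀ t, ‖η t‖ ≤ 1 := fun t => abs_le_one_of_mem (hη01 t)
  have hηd : ∀ t, ‖deriv η t‖ ≤ C' := fun t => (IsL2Gradient.norm_deriv_eq η t).trans_le (hC' t)
  have hηdc : Continuous (deriv η) := hη.continuous_deriv (by simp)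
  have hclosed : ∀ n : ℕ, IsClosed {z : K | ∀ m, weightedSq c m z ≤ 2 * ((n : ℝ) + 1)} := fun n => by
    simp only [ofPred_forall]
    exact isClosed_iInter fun m => isClosed_le
      ((continuous_weightedSq c m).comp continuous_subtype_val) continuous_const
  refine ⟨fun n => {z : K | ∀ m, weightedSq c m z ≤ 2 * ((n : ℝ) + 1)},
    IsL2Gradient.isNest_of_tendsto hs hclosed (fun n n' hn z hz m => (hz m).trans ?_) fun f hf => ?_,
    fun n => ?_⟩
  · have : (n : ℝ) ≤ n' := by exact_mod_cast hn
    linarith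
  · obtain ⟨Cf, hCf⟩ := isSeparatingAlgebra_cylindricalK.bounded f hf
    obtain ⟨Cg, hCg0, hCg⟩ := bounded_gradK hf
    have hCf0 : 0 ≤ Cf := (abs_nonneg _).trans (hCf (j 0))
    have hrpos : ∀ n : ℕ, (0 : ℝ) < ((n : ℝ) + 1)⁻¹ := fun n => by positivity
    have hrle : ∀ n : ℕ, ((n : ℝ) + 1)⁻¹ ≤ 1 := fun n =>
      inv_le_one_of_one_le₀ (by linarith [n.cast_nonneg (α := ℝ)])
    let S : K → ℝ := fun z => ∑' k, c k * ⟪e (k + 1), (z : H)⟫ ^ 2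
    let W : K → H := fun z => ∑' k, (c k * ⟪e (k + 1), (z : H)⟫) • e (k + 1)
    -- The vector `V` stands for a partial weighted sum or for `W z` itself, so one bound serves for
    -- both limits, `m → ∞` and `n → ∞`.
    have hbd : ∀ (n : ℕ) (s : ℝ) (z : K) (V : H), ‖V‖ ≤ ‖W z‖ →
        ‖η (((n : ℝ) + 1)⁻¹ * s) • gradK f z +
          (f z * (deriv η (((n : ℝ) + 1)⁻¹ * s) * ((n : ℝ) + 1)⁻¹ * 2)) • V‖ ≤
        Cg + Cf * C' * 2 * ‖W z‖ := by
      intro n s z V hV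
      refine (norm_add_le _ _).trans (add_le_add ?_ ?_)
      · rw [norm_smul]
        calc _ ≤ 1 * Cg := mul_le_mul (hηb _) (hCg z) (norm_nonneg _) zero_le_one
          _ = Cg := one_mul _
      · rw [norm_smul, norm_mul, norm_mul, norm_mul, Real.norm_of_nonneg (hrpos n).le,
          Real.norm_of_nonneg (zero_le_two (α := ℝ))]
        have h1 : ‖deriv η (((n : ℝ) + 1)⁻¹ * s)‖ * ((n : ℝ) + 1)⁻¹ ≤ C' * 1 :=
          mul_le_mul (hηd _) (hrle n) (hrpos n).le hC'0
        rw [mul_one] at h1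
        calc _ ≤ Cf * (C' * 2) * ‖W z‖ := by
              refine mul_le_mul (mul_le_mul (hCf z) ?_ (by positivity) hCf0) hV (norm_nonneg _)
                (by positivity)
              linarith
          _ = Cf * C' * 2 * ‖W z‖ := by ring
    have hbmem : MemLp (fun z => Cg + Cf * C' * 2 * ‖W z‖) 2 ν :=
      (memLp_const Cg).add (hW.norm.const_mul (Cf * C' * 2))
    have hgrad : ∀ n : ℕ, (isL2Gradient_K ν).HasGrad (fun z => η (((n : ℝ) + 1)⁻¹ * S z) * f z)
        (fun z => η (((n : ℝ) + 1)⁻¹ * S z) • gradK f z +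
          (f z * (deriv η (((n : ℝ) + 1)⁻¹ * S z) * ((n : ℝ) + 1)⁻¹ * 2)) • W z) := by
      intro n
      have hcut := fun m => cutoff_mul_mem_cylindricalK hc1 hη hη0 (hrpos n) m hf
      have harg : ∀ z : K, (Summable fun k => (c k * ⟪e (k + 1), (z : H)⟫) ^ 2) →
          Tendsto (fun m => ((n : ℝ) + 1)⁻¹ * weightedSq c m z) atTop
            (𝓝 (((n : ℝ) + 1)⁻¹ * S z)) := fun z hz =>
        (weightedSq_tsum hc1 (summable_weightedSq hc1 hz)).1.const_mul _
      refine IsL2Gradient.HasGrad.of_tendsto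
        (fun m => (isL2Gradient_K ν).hasGrad_of_mem (hcut m).1) (b := fun _ => Cf)
        (memLp_const Cf) hbmem (fun m => Eventually.of_forall fun z => ?_) (fun m => ?_) ?_ ?_
      · rw [norm_mul]
        calc _ ≤ 1 * Cf := mul_le_mul (hηb _) (hCf z) (abs_nonneg _) zero_le_one
          _ = Cf := one_mul _
      · filter_upwards [hsum] with z hz
        rw [(hcut m).2]
        exact hbd n _ z _ ((weightedSum_tsum hz).2.1 m)
      · filter_upwards [hsum] with z hz
        exact ((hη.continuous.tendsto _).comp (harg z hz)).mul_const _
      · filter_upwards [hsum] with z hz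
        simp_rw [(hcut _).2]
        refine (((hη.continuous.tendsto _).comp (harg z hz)).smul_const _).add
          (Tendsto.smul ?_ (weightedSum_tsum hz).1)
        exact ((((hηdc.tendsto _).comp (harg z hz)).mul_const _).mul_const _).const_mul _
    -- Valid at every `z`: where the series diverges, `S z` is `0` by convention.
    have hev : ∀ z, ∀ᶠ n : ℕ in atTop, |((n : ℝ) + 1)⁻¹ * S z| < 1 := fun z => by
      have h0 : Tendsto (fun n : ℕ => ((n : ℝ) + 1)⁻¹) atTop (𝓝 0) := by
        simpa only [one_div] using tendsto_one_div_add_atTop_nhds_zero_nat (𝕜 := ℝ)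
      have h1 := (h0.mul_const (S z)).abs
      rw [zero_mul, abs_zero] at h1
      exact h1.eventually_lt_const one_pos
    have hη1' : ∀ t, |t| < 1 → η t = 1 ∧ deriv η t = 0 := fun t ht => by
      refine ⟨hη1 t ht.le, ?_⟩
      have : η =ᶠ[𝓝 t] fun _ => 1 := by
        filter_upwards [(isOpen_lt continuous_abs continuous_const).mem_nhds ht] with s hs
        exact hη1 s (le_of_lt hs)
      rw [this.deriv_eq, deriv_const]
    refine ⟨_, _, hgrad, fun n => ?_, ?_, ?_⟩
    -- Off the `n`-th set some partial sum exceeds `2(n + 1)`, so the argument of `η` is at least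
    -- `2`.
    · filter_upwards [hsum] with z hz hzF
      simp only [not_forall, not_le] at hzF
      obtain ⟨m, hm⟩ := hzF
      have h1 := hm.trans_le ((weightedSq_tsum hc1 (summable_weightedSq hc1 hz)).2 m)
      rw [hη0, zero_mul]
      refine le_trans ?_ (le_abs_self _)
      rw [inv_mul_eq_div, le_div_iff₀ (by positivity)]
      exact h1.le
    · refine (tendsto_eLpNorm_two_of_dominated (fun n => (hgrad n).1.1) (memLp_const Cf)
        (fun n => Eventually.of_forall fun z => ?_) (Eventually.of_forall fun z => ?_)).2
      · rw [norm_mul]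
        calc _ ≤ 1 * Cf := mul_le_mul (hηb _) (hCf z) (abs_nonneg _) zero_le_one
          _ = Cf := one_mul _
      · refine tendsto_const_nhds.congr' ?_
        filter_upwards [hev z] with n hn
        rw [(hη1' _ hn).1, one_mul]
    · refine (tendsto_eLpNorm_two_of_dominated (fun n => (hgrad n).2.1.1) hbmem
        (fun n => Eventually.of_forall fun z => hbd n _ z _ le_rfl)
        (Eventually.of_forall fun z => ?_)).2
      refine tendsto_const_nhds.congr' ?_
      filter_upwards [hev z] with n hn
      rw [(hη1' _ hn).1, (hη1' _ hn).2]
      simp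
  · exact isClosed_cone.isClosedEmbedding_subtypeVal.isCompact_preimage
      (isCompact_weightedSq_le hc1 hclim (by positivity))

/-- Only the compact nest needs work: cylindrical functions are continuous, hence quasi-continuous
for the trivial nest, and countably many rescaled sines of coordinates, enumerated by pairing,
separate all points. -/
theorem isQuasiRegular_K [IsFiniteMeasure ν] (hν : Integrable (fun z : K => ‖(z : H)‖ ^ 2) ν)
    (hs : SingleValued (isL2Gradient_K ν).closedGraph) :
    IsQuasiRegular (graphForm (isL2Gradient_K ν).closedGraph) where
  compact_nest := exists_compact_nest hν hs
  dense_quasiContinuous u ε hε := by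
    obtain ⟨w, ⟨y, f, hf, hw, -⟩, hlt⟩ := IsL2Gradient.exists_energyOne_lt hs
      (S := (isL2Gradient_K ν).graph) (isL2Gradient_K ν).graph.le_topologicalClosure
      (fun f hf => subset_closure ((isL2Gradient_K ν).toLp_mem_graph hf)) u hε
    refine ⟨w, ⟨f, ⟨_, IsL2Gradient.isNest_univ _, fun _ =>
      (isSeparatingAlgebra_cylindricalK.continuous f hf).continuousOn⟩, hw.symm⟩, hlt⟩
  separating := by
    let f : ℕ → K → ℝ := fun i z =>
      Real.sin ((((Nat.unpair i).2 : ℝ) + 1)⁻¹ * ⟪e ((Nat.unpair i).1 + 1), (z : H)⟫)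
    have hf : ∀ i, f i ∈ cylindricalK := fun i =>
      restrict_mem_cylindricalK (sin_mem_cylindricalH _ _)
    refine ⟨fun i => ⟨_, mem_graphForm_dom.2 ⟨_, (isL2Gradient_K ν).toLp_mem_closedGraph (hf i)⟩⟩,
      f, ∅, fun i => ⟨⟨_, IsL2Gradient.isNest_univ _, fun _ =>
        (isSeparatingAlgebra_cylindricalK.continuous _ (hf i)).continuousOn⟩,
        ((isL2Gradient_K ν).memLp _ (hf i)).coeFn_toLp.symm⟩, ⟨_, IsL2Gradient.isNest_univ _, empty_subset _⟩, ?_⟩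
    intro y _ z _ hyz
    obtain ⟨k, n, h⟩ := exists_sin_ne (Subtype.coe_injective.ne hyz)
    refine ⟨Nat.pair k n, ?_⟩
    simpa [f] using h

end CompactNest

section Main

variable {Ω : Type*} [MeasurableSpace Ω] {P : Measure Ω} {β : Ω → C(I, ℝ)}

/-- The pointwise equality of gradient norms becomes equality of `L²` norms because `j` is measure
preserving. -/
theorem exists_mem_closedGraph_compJ [IsFiniteMeasure (lawH P β)] [IsFiniteMeasure (lawAbs P β)]
    (hμ : ∀ᵐ z ∂(lawH P β), ∀ᵐ x ∂(volume : Measure I), z x ≠ 0)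
    {p : Lp ℝ 2 (lawAbs P β) × Lp H 2 (lawAbs P β)}
    (hp : p ∈ (isL2Gradient_K (lawAbs P β)).graph) :
    ∃ w, (compJ p.1, w) ∈ (isL2Gradient_H (lawH P β)).closedGraph ∧ ‖w‖ = ‖p.2‖ := by
  obtain ⟨f, hf, h1, h2⟩ := hp
  obtain ⟨g, hg, hn⟩ := exists_hasGrad_comp_j hμ hf
  have hj := measurePreserving_j P β
  refine ⟨hg.2.1.toLp g, hg.mem_closedGraph ?_ hg.2.1.coeFn_toLp.symm, ?_⟩
  · exact ((Lp.coeFn_compMeasurePreserving p.1 hj).trans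
      (hj.quasiMeasurePreserving.ae_eq_comp h1)).symm
  · rw [Lp.norm_toLp, Lp.norm_def, eLpNorm_congr_ae h2, eLpNorm_congr_norm_ae hn,
      ← eLpNorm_comp_measurePreserving (continuous_gradK hf).aestronglyMeasurable hj]
    rfl

theorem integrable_norm_sq_lawAbs [IsProbabilityMeasure P] (hβ : IsBrownianBridge P β) :
    Integrable (fun z : K => ‖(z : H)‖ ^ 2) (lawAbs P β) := by
  refine ((measurePreserving_j P β).integrable_comp
    (Continuous.aestronglyMeasurable (by fun_prop))).1 ?_
  refine (integrable_norm_sq hβ).congr (Eventually.of_forall fun z => ?_)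
  simp only [Function.comp_apply, j]
  rw [norm_abs_eq_norm]

end Main

end BridgeForm

theorem proposition5p1 {Ω : Type*} [MeasurableSpace Ω] (P : Measure Ω) [IsProbabilityMeasure P]
    (β : Ω → C(unitInterval, ℝ)) (hβ : BridgeForm.IsBrownianBridge P β) :
    DirichletForms.Closable (BridgeForm.lawAbs P β) BridgeForm.cylindricalK
        (BridgeForm.preFormK (BridgeForm.lawAbs P β)) ∧
      ∃ (𝓔 : DirichletForms.SymmForm (Lp ℝ 2 (BridgeForm.lawAbs P β)))
        (Λ : DirichletForms.SymmForm (Lp ℝ 2 (BridgeForm.lawH P β))),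
        DirichletForms.IsClosureOf (BridgeForm.lawAbs P β) 𝓔 BridgeForm.cylindricalK
          (BridgeForm.preFormK (BridgeForm.lawAbs P β)) ∧
        DirichletForms.IsClosureOf (BridgeForm.lawH P β) Λ BridgeForm.cylindricalH
          (BridgeForm.preFormH (BridgeForm.lawH P β)) ∧
        DirichletForms.IsDirichletForm 𝓔 ∧
        DirichletForms.IsLocalForm 𝓔 ∧
        DirichletForms.IsQuasiRegular 𝓔 ∧
        ∃ hj : ∀ f ∈ 𝓔.dom, BridgeForm.compJ f ∈ Λ.dom,
          ∀ f g : 𝓔.dom,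
            𝓔.form f g = Λ.form ⟨BridgeForm.compJ f, hj f f.2⟩ ⟨BridgeForm.compJ g, hj g g.2⟩ := by
  open DirichletForms BridgeForm in
  have := isProbabilityMeasure_lawH hβ
  have : IsProbabilityMeasure (lawAbs P β) :=
    Measure.isProbabilityMeasure_map (measurePreserving_j P β).measurable.aemeasurable
  have hsH := singleValued_closedGraph_H hβ
  have hcH := (isL2Gradient_H (lawH P β)).isClosed_closedGraph
  -- As a function this is `compJ`, by definition; being continuous and linear, it can serve as the
  -- map of the transfer lemmas.
  let ι : Lp ℝ 2 (lawAbs P β) →L[ℝ] Lp ℝ 2 (lawH P β) :=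
    (Lp.compMeasurePreservingₗᵢ ℝ j (measurePreserving_j P β)).toContinuousLinearMap
  have hι : ∀ p ∈ (isL2Gradient_K (lawAbs P β)).graph, ∃ w,
      (ι p.1, w) ∈ (isL2Gradient_H (lawH P β)).closedGraph ∧ ‖w‖ = ‖p.2‖ := fun p hp =>
    exists_mem_closedGraph_compJ (ae_ne_zero hβ) hp
  have hsK : SingleValued (isL2Gradient_K (lawAbs P β)).closedGraph :=
    singleValued_closure_of_isometry hsH hcH ι hι
  obtain ⟨hj, hform⟩ := graphForm_eq_of_isometry hsK hsH ι fun p hp =>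
    exists_mem_of_mem_closure hsH hcH ι hι hp
  exact ⟨(isL2Gradient_K _).closable hsK, _, _, (isL2Gradient_K _).isClosureOf hsK,
    (isL2Gradient_H _).isClosureOf hsH,
    IsL2Gradient.isDirichletForm isSeparatingAlgebra_cylindricalK hsK hasChainRule_K,
    IsL2Gradient.isLocalForm hsK hasChainRule_K,
    isQuasiRegular_K (integrable_norm_sq_lawAbs hβ) hsK, hj, hform⟩
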